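/- For $\nu\in\mathbb C$, $z\neq0$ let $I_\nu(z)=\sum_{m\ge0}\frac{(z/2)^{2m+\nu}}{m!\,\Gamma(m+\nu+1)}$ (principal branch) and let $$K_\nu(z)=\frac{\pi}{2}\,\frac{I_{-\nu}(z)-I_\nu(z)}{\sin \nu\pi}$$ be the Macdonald function (at integers $\nu$ defined as the limit). Consider the Hilbert spaces $L^2(\mathbb R_+,dx/x)$ and $L^2(\mathbb R_+,\frac2\pi|\Gamma(is)|^{-2}ds)$; an even function of $s\in\mathbb R$ is identified with its restriction to $\mathbb R_+=(0,\infty)$. Let $\mathcal H[w]$ be the space of even functions $f$ which are holomorphic in some strip $|\mathrm{Im}\, s|<1+\delta$, $\delta>0$, and satisfy $f(s)=O\bigl((|s|e^{\pi|\mathrm{Re}\, s|})^{-1/2}|s|^{-1/2-\varepsilon}\bigr)$, for some $\varepsilon>0$, as $s\to\infty$ in the strip $|\mathrm{Im}\, s|\le1$. Let $\mathcal L$ be the operator $$\mathcal Lf(s)=\frac{1}{is}\bigl(f(s-i)-f(s+i)\bigr)$$ in $L^2(\mathbb R_+,\frac2\pi|\Gamma(is)|^{-2}ds)$ with domain $\mathcal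 H[w]$, and let $P$ be the operator $Pg(x)=\frac2x g(x)$ in $L^2(\mathbb R_+,dx/x)$ with its maximal domain $\{g:\frac2x g\in L^2(\mathbb R_+,dx/x)\}$. **Theorem.** (a) For all $\nu\in\mathbb C$ and $z\ne0$, $\;K_{\nu-1}(z)-K_{\nu+1}(z)=-\frac{2\nu}{z}K_\nu(z)$. (b) There is a unitary operator $\mathfrak K:L^2(\mathbb R_+,dx/x)\to L^2(\mathbb R_+,\frac2\pi|\Gamma(is)|^{-2}ds)$ (the Kontorovich--Lebedev transform) such that $$\mathfrak Kg(s)=\int_0^\infty K_{is}(x)g(x)\frac{dx}{x}\ \text{ for a.e. } s,\qquad \mathfrak K^{-1}f(x)=\frac2\pi\int_0^\infty f(s)K_{is}(x)\frac{ds}{|\Gamma(is)|^2}\ \text{ for a.e. } x,$$ the first formula for every $g\in L^2(\mathbb R_+,dx/x)$ for which the integral converges absolutely for a.e. $s>0$ (in particular for all $g$ supported in a compact subset of $(0,\infty)$), the second for every $f$ in the target space for which the integral converges absolutely for a.e. $x>0$. The operator $\mathcal L$ is closable and essentially self-adjoint, and $\mathfrak K$ is a unitary equivalence between $P$ and the closure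 $\overline{\mathcal L}$: for all $g,h\in L^2(\mathbb R_+,dx/x)$, one has $g\in\mathrm{dom}\,P$ and $Pg=h$ if and only if $\mathfrak Kg\in\mathrm{dom}\,\overline{\mathcal L}$ and $\overline{\mathcal L}\,\mathfrak Kg=\mathfrak Kh$. -/

import Mathlib

open MeasureTheory Filter Topology

noncomputable section

namespace KontorovichLebedev

/-- The modified Bessel function of the first kind (principal branch),
`I_ν(z) = ∑ (z/2)^(2m+ν) / (m! Γ(m+ν+1))`.  Where `Γ` has a pole, Mathlib's value is `0`, so the
corresponding term is `0`, as it should be. -/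
def besselI (ν z : ℂ) : ℂ :=
  ∑' m : ℕ, (z / 2) ^ (2 * (m : ℂ) + ν) / ((m.factorial : ℂ) * Complex.Gamma ((m : ℂ) + ν + 1))

/-- The quotient `(π/2) (I_{-ν}(z) - I_ν(z)) / sin (νπ)`, meaningful for `ν ∉ ℤ`. -/
def macdonaldQuotient (ν z : ℂ) : ℂ :=
  (Real.pi / 2 : ℂ) * (besselI (-ν) z - besselI ν z) / Complex.sin (ν * Real.pi)

open Classical in
/-- The Macdonald function `K_ν(z)`; at integers `ν` it is defined by passing to the limit. -/
def macdonaldK (ν z : ℂ) : ℂ :=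
  if Complex.sin (ν * Real.pi) = 0 then limUnder (𝓝[≠] ν) (fun μ => macdonaldQuotient μ z)
  else macdonaldQuotient ν z

/-- The measure `dx / x` on `(0, ∞)`. -/
def measX : Measure ℝ :=
  (volume.restrict (Set.Ioi 0)).withDensity (fun x => ENNReal.ofReal (1 / x))

/-- The measure `(2/π) |Γ(is)|⁻² ds` on `(0, ∞)`. -/
def measS : Measure ℝ :=
  (volume.restrict (Set.Ioi 0)).withDensity
    (fun s => ENNReal.ofReal (2 / Real.pi / ‖Complex.Gamma (Complex.I * s)‖ ^ 2))

/-- The space `L²(ℝ₊, dx/x)`. -/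
abbrev L2X := Lp ℂ 2 measX

/-- The space `L²(ℝ₊, (2/π)|Γ(is)|⁻² ds)`.  An even function on the line is identified with its
restriction to `ℝ₊`. -/
abbrev L2S := Lp ℂ 2 measS

/-- The comparison function `Ψ(s) = |s| exp (π |Re s|)` of the weight `|Γ(is)|⁻²` in a strip. -/
def weightPsi (s : ℂ) : ℝ := ‖s‖ * Real.exp (Real.pi * |s.re|)

/-- The even functions of the space `𝓗[w]`, `w(s) = |Γ(is)|⁻²`: even functions, holomorphic in
a strip larger than `|Im s| ≤ 1`, which are `O(Ψ(s)^(-1/2) |s|^(-1/2-ε))`, for some `ε > 0`, as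
`s → ∞` in the strip `|Im s| ≤ 1`. -/
structure IsEvenWDecreasing (F : ℂ → ℂ) : Prop where
  holo_even : ∃ δ : ℝ, 0 < δ ∧ DifferentiableOn ℂ F {s | |s.im| < 1 + δ} ∧
    ∀ s : ℂ, |s.im| < 1 + δ → F (-s) = F s
  decay : ∃ ε : ℝ, 0 < ε ∧ F =O[Bornology.cobounded ℂ ⊓ 𝓟 {s | |s.im| ≤ 1}]
    fun s => weightPsi s ^ (-(1 / 2) : ℝ) * ‖s‖ ^ (-(1 / 2) - ε : ℝ)

/-- The difference expression `(F(s - i) - F(s + i)) / (i s)`. -/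
def diffExpr (F : ℂ → ℂ) (s : ℂ) : ℂ :=
  (F (s - Complex.I) - F (s + Complex.I)) / (Complex.I * s)

theorem IsEvenWDecreasing.zero : IsEvenWDecreasing (fun _ => 0) :=
  ⟨⟨1, one_pos, differentiableOn_const _, fun _ _ => rfl⟩,
    ⟨1, one_pos, Asymptotics.isBigO_zero _ _⟩⟩

theorem IsEvenWDecreasing.smul {F : ℂ → ℂ} (c : ℂ) (hF : IsEvenWDecreasing F) :
    IsEvenWDecreasing (fun s => c * F s) := by
  obtain ⟨⟨δ, hδ, hd, he⟩, ε, hε, hb⟩ := hF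
  exact ⟨⟨δ, hδ, hd.const_mul c, fun s hs => by simp only [he s hs]⟩, ε, hε, hb.const_mul_left c⟩

theorem isBigO_of_le {F : ℂ → ℂ} {ε ε' : ℝ} (h : ε' ≤ ε)
    (hF : F =O[Bornology.cobounded ℂ ⊓ 𝓟 {s | |s.im| ≤ 1}]
      fun s => weightPsi s ^ (-(1 / 2) : ℝ) * ‖s‖ ^ (-(1 / 2) - ε)) :
    F =O[Bornology.cobounded ℂ ⊓ 𝓟 {s | |s.im| ≤ 1}]
      fun s => weightPsi s ^ (-(1 / 2) : ℝ) * ‖s‖ ^ (-(1 / 2) - ε') := by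
  refine hF.trans (Asymptotics.IsBigO.of_bound 1 ?_)
  have h1 : ∀ᶠ s : ℂ in Bornology.cobounded ℂ, 1 ≤ ‖s‖ :=
    tendsto_norm_cobounded_atTop.eventually_ge_atTop 1
  filter_upwards [h1.filter_mono inf_le_left] with s hs
  rw [one_mul, norm_mul, norm_mul]
  refine mul_le_mul_of_nonneg_left ?_ (norm_nonneg _)
  rw [Real.norm_of_nonneg (by positivity), Real.norm_of_nonneg (by positivity)]
  exact Real.rpow_le_rpow_of_exponent_le hs (by linarith)

theorem IsEvenWDecreasing.add {F G : ℂ → ℂ} (hF : IsEvenWDecreasing F)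
    (hG : IsEvenWDecreasing G) : IsEvenWDecreasing (fun s => F s + G s) := by
  obtain ⟨⟨δ, hδ, hd, he⟩, ε, hε, hb⟩ := hF
  obtain ⟨⟨δ', hδ', hd', he'⟩, ε', hε', hb'⟩ := hG
  have m1 : min δ δ' ≤ δ := min_le_left _ _
  have m2 : min δ δ' ≤ δ' := min_le_right _ _
  refine ⟨⟨min δ δ', lt_min hδ hδ', (hd.mono ?_).add (hd'.mono ?_), ?_⟩, min ε ε',
    lt_min hε hε', (isBigO_of_le (min_le_left _ _) hb).add (isBigO_of_le (min_le_right _ _) hb')⟩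
  · intro s (hs : |s.im| < 1 + min δ δ')
    exact (by linarith : |s.im| < 1 + δ)
  · intro s (hs : |s.im| < 1 + min δ δ')
    exact (by linarith : |s.im| < 1 + δ')
  · intro s hs
    rw [he s (by linarith), he' s (by linarith)]

theorem diffExpr_add (F G : ℂ → ℂ) (s : ℂ) :
    diffExpr (fun s => F s + G s) s = diffExpr F s + diffExpr G s := by
  simp only [diffExpr]; ring

theorem diffExpr_smul (c : ℂ) (F : ℂ → ℂ) (s : ℂ) :
    diffExpr (fun s => c * F s) s = c * diffExpr F s := by
  simp only [diffExpr]; ring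

/-- The graph of the difference operator `𝓛` with domain `𝓗[w]` (even functions), in
`L²(ℝ₊, (2/π)|Γ(is)|⁻² ds)`.  For `F` in `𝓗[w]` both `F` and `diffExpr F` are square integrable,
by the decay condition and because `diffExpr F` has a removable singularity at `0`. -/
def diffGraph : Submodule ℂ (L2S × L2S) where
  carrier := {p | ∃ F : ℂ → ℂ, IsEvenWDecreasing F ∧
    (p.1 =ᵐ[measS] fun s : ℝ => F s) ∧ (p.2 =ᵐ[measS] fun s : ℝ => diffExpr F s)}
  zero_mem' := by
    refine ⟨fun _ => 0, IsEvenWDecreasing.zero, ?_, ?_⟩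
    · filter_upwards [Lp.coeFn_zero ℂ 2 measS] with s hs
      simpa using hs
    · filter_upwards [Lp.coeFn_zero ℂ 2 measS] with s hs
      simpa [diffExpr] using hs
  add_mem' := by
    rintro p q ⟨F, hF, h1, h2⟩ ⟨G, hG, h3, h4⟩
    refine ⟨fun s => F s + G s, hF.add hG, ?_, ?_⟩
    · filter_upwards [Lp.coeFn_add p.1 q.1, h1, h3] with s hs h h'
      rw [Prod.fst_add, hs, Pi.add_apply, h, h']
    · filter_upwards [Lp.coeFn_add p.2 q.2, h2, h4] with s hs h h'
      rw [Prod.snd_add, hs, Pi.add_apply, h, h', diffExpr_add]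
  smul_mem' := by
    rintro c p ⟨F, hF, h1, h2⟩
    refine ⟨fun s => c * F s, hF.smul c, ?_, ?_⟩
    · filter_upwards [Lp.coeFn_smul c p.1, h1] with s hs h
      rw [Prod.smul_fst, hs, Pi.smul_apply, h, smul_eq_mul]
    · filter_upwards [Lp.coeFn_smul c p.2, h2] with s hs h
      rw [Prod.smul_snd, hs, Pi.smul_apply, h, smul_eq_mul, diffExpr_smul]

/-- The difference operator `𝓛 f(s) = (f(s - i) - f(s + i)) / (i s)` with domain `𝓗[w]`. -/
def diffOp : L2S →ₗ.[ℂ] L2S := diffGraph.toLinearPMap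

/-- The graph of the multiplication by `2/x` in `L²(ℝ₊, dx/x)`. -/
def mulGraph : Submodule ℂ (L2X × L2X) where
  carrier := {p | p.2 =ᵐ[measX] fun x : ℝ => ((2 / x : ℝ) : ℂ) * p.1 x}
  zero_mem' := by
    change (0 : L2X) =ᵐ[measX] fun x : ℝ => ((2 / x : ℝ) : ℂ) * (0 : L2X) x
    filter_upwards [Lp.coeFn_zero ℂ 2 measX] with x hx
    rw [hx, Pi.zero_apply, mul_zero]
  add_mem' := by
    intro p q hp hq
    change (p + q).2 =ᵐ[measX] fun x : ℝ => ((2 / x : ℝ) : ℂ) * (p + q).1 x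
    filter_upwards [Lp.coeFn_add p.1 q.1, Lp.coeFn_add p.2 q.2, hp, hq] with x h1 h2 h3 h4
    rw [Prod.fst_add, Prod.snd_add, h1, h2, Pi.add_apply, Pi.add_apply, h3, h4, mul_add]
  smul_mem' := by
    intro c p hp
    change (c • p).2 =ᵐ[measX] fun x : ℝ => ((2 / x : ℝ) : ℂ) * (c • p).1 x
    filter_upwards [Lp.coeFn_smul c p.1, Lp.coeFn_smul c p.2, hp] with x h1 h2 h3
    rw [Prod.smul_fst, Prod.smul_snd, h1, h2, Pi.smul_apply, Pi.smul_apply, h3]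
    simp only [smul_eq_mul]
    ring

/-- The operator `P g(x) = (2/x) g(x)` on its maximal domain `{g | (2/x) g ∈ L²(ℝ₊, dx/x)}`. -/
def mulOp : L2X →ₗ.[ℂ] L2X := mulGraph.toLinearPMap

theorem mulOp_graph : mulOp.graph = mulGraph := by
  refine Submodule.toLinearPMap_graph_eq _ ?_
  rintro ⟨g, h⟩ (hp : h =ᵐ[measX] _) (hg : g = 0)
  subst hg
  change h = 0
  rw [Lp.eq_zero_iff_ae_eq_zero]
  filter_upwards [hp, Lp.coeFn_zero ℂ 2 measX] with x h1 h2
  rw [h1, h2, Pi.zero_apply, mul_zero]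

theorem volume_absCont : volume.restrict (Set.Ioi (0 : ℝ)) ≪ measS := by
  have hne : ∀ s : ℝ, 0 < s → ∀ m : ℕ, Complex.I * s ≠ -m := by
    intro s hs m h
    have := congrArg Complex.im h
    simp at this
    exact hs.ne' this
  refine withDensity_absolutelyContinuous' ?_ ?_
  · refine (AEMeasurable.ennreal_ofReal ?_)
    refine ContinuousOn.aemeasurable ?_ measurableSet_Ioi
    intro s hs
    refine ContinuousAt.continuousWithinAt ?_
    have h1 : ContinuousAt (fun s : ℝ => Complex.Gamma (Complex.I * s)) s :=
      ContinuousAt.comp (f := fun s : ℝ => Complex.I * (s : ℂ)) (g := Complex.Gamma)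
        (Complex.differentiableAt_Gamma _ (hne s hs)).continuousAt (by fun_prop)
    exact continuousAt_const.div (h1.norm.pow 2)
      (pow_ne_zero 2 (norm_ne_zero_iff.mpr (Complex.Gamma_ne_zero (hne s hs))))
  · filter_upwards [ae_restrict_mem measurableSet_Ioi] with s hs
    have : 0 < ‖Complex.Gamma (Complex.I * s)‖ :=
      norm_pos_iff.mpr (Complex.Gamma_ne_zero (hne s hs))
    rw [Ne, ENNReal.ofReal_eq_zero, not_le]
    positivity

theorem diffExpr_eq_zero {F : ℂ → ℂ} (hF : IsEvenWDecreasing F)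
    (h0 : (fun s : ℝ => F s) =ᵐ[measS] 0) (s : ℝ) : diffExpr F s = 0 := by
  obtain ⟨⟨δ, hδ, hd, -⟩, -⟩ := hF
  have hopen : IsOpen {s : ℂ | |s.im| < 1 + δ} :=
    isOpen_lt (by fun_prop) continuous_const
  have hconv : Convex ℝ {s : ℂ | |s.im| < 1 + δ} := by
    have : {s : ℂ | |s.im| < 1 + δ} = Complex.imLm ⁻¹' Set.Ioo (-(1 + δ)) (1 + δ) := by
      ext z; simp [abs_lt]
    rw [this]
    exact (convex_Ioo _ _).linear_preimage _
  have hreal : ∀ t : ℝ, (t : ℂ) ∈ {s : ℂ | |s.im| < 1 + δ} := by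
    intro t; simp; linarith
  have hcont : Continuous fun t : ℝ => F t :=
    hd.continuousOn.comp_continuous (by fun_prop) hreal
  have h1 : Set.EqOn (fun t : ℝ => F t) 0 (Set.Ioi 0) :=
    Measure.eqOn_open_of_ae_eq (volume_absCont.ae_eq h0) isOpen_Ioi hcont.continuousOn
      continuousOn_const
  have hfreq : ∃ᶠ z in 𝓝[≠] (1 : ℂ), F z = 0 := by
    have ht : Tendsto (fun t : ℝ => (t : ℂ)) (𝓝[>] 1) (𝓝[≠] (1 : ℂ)) := by
      refine tendsto_nhdsWithin_iff.mpr ⟨?_, ?_⟩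
      · have : Tendsto (fun t : ℝ => (t : ℂ)) (𝓝 1) (𝓝 ((1 : ℝ) : ℂ)) :=
          Complex.continuous_ofReal.tendsto 1
        exact (by simpa using this : Tendsto _ _ (𝓝 (1 : ℂ))).mono_left nhdsWithin_le_nhds
      · filter_upwards [self_mem_nhdsWithin] with t ht
        have h : (1 : ℝ) < t := ht
        simpa using h.ne'
    refine ht.frequently (Eventually.frequently ?_)
    filter_upwards [self_mem_nhdsWithin] with t ht
    exact h1 (show (0 : ℝ) < t from lt_trans one_pos ht)
  have hz := (hd.analyticOnNhd hopen).eqOn_zero_of_preconnected_of_frequently_eq_zero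
    hconv.isPreconnected (by simpa using hreal 1) hfreq
  have e1 : F (s - Complex.I) = 0 := hz (by simp; linarith)
  have e2 : F (s + Complex.I) = 0 := hz (by simp; linarith)
  simp [diffExpr, e1, e2]

/-- The operator `diffOp` really has the graph above (a function in `𝓗[w]` is determined by its
restriction to `ℝ₊`). -/
theorem diffOp_graph : diffOp.graph = diffGraph := by
  refine Submodule.toLinearPMap_graph_eq _ ?_
  rintro ⟨f, h⟩ ⟨F, hF, h1, h2⟩ (hf : f = 0)
  subst hf
  change h = 0
  rw [Lp.eq_zero_iff_ae_eq_zero]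
  have h0 : (fun s : ℝ => F s) =ᵐ[measS] 0 := h1.symm.trans (Lp.coeFn_zero ℂ 2 measS)
  refine h2.trans (Filter.Eventually.of_forall fun s => ?_)
  exact diffExpr_eq_zero hF h0 s

end KontorovichLebedev

end

/-! The unitary operator is constructed without a Plancherel theorem, by matching two total families
with the same Gram matrix. Put $e_\tau(x)=xe^{-x\cosh\tau}$ and $\phi_\tau(s)=\pi\sin(\tau
s)/(\sinh\tau\,\sinh\pi s)$ for $\tau>0$. In the two Hilbert spaces the inner products of both
families equal $(\cosh\tau+\cosh\sigma)^{-2}$ (`inner_expX`, `inner_sinS`). Both families are total,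
by injectivity of the Laplace transform on $p>1$ and of the sine transform. Hence there is a unitary
$U$ with $Ue_\tau=\phi_\tau$ (`exists_unitary`).

This $U$ is the Kontorovich-Lebedev transform because $K_{is}(x)=\frac12\int_{\mathbb
R}e^{ist-x\cosh t}\,dt$ (`macdonaldK_eq_integral`), which gives $\int_0^\infty
K_{is}(x)e_\tau(x)\,dx/x=\phi_\tau(s)$. Since $|K_{is}|\le K_0$, Fubini and uniqueness of Laplace
transforms yield the formula for $U^{-1}f$ with $f$ integrable. Testing against indicator functions
extends the formulas, for $U$ and for $U^{-1}$, to all cases of absolute convergence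
(`ae_eq_integral_of_symm_indicator`).

For the operators, take the differences $c=x(e^{-px}-e^{-(p+1)x})$ with $p=\cosh\tau$. They lie in
the domain of $P$, and $Uc=\phi_\tau-\phi_\sigma$ with $\cosh\sigma=p+1$. As
$\sin(i\tau)/\sinh\tau=i$ does not depend on $\tau$, the poles at $\pm i$ cancel, so $Uc$ extends to
an element of $\mathcal H[w]$; as $\sinh\pi(z\pm i)=-\sinh\pi z$, the operator $\mathcal L$ acts on
the numerator only, and $\mathcal L Uc=UPc$ (`mem_diffGraph_of_apply`). For arbitrary $F\in\mathcal
H[w]$ a contour shift by $i$ gives $\langle Uc,\mathcal LF\rangle=\langle UPc,F\rangle$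
(`inner_apply_coreX_eq`).

The relations $\langle Pc,a\rangle=\langle c,b\rangle$ for all these $c$ force $b=Pa$
(`mem_mulGraph_iff_inner`), so the graph of $\mathcal L$ lies in that of the conjugate $UPU^{-1}$.
Conversely $P\ge0$: anything orthogonal to all $c+Pc$ satisfies $Pf=-f$ and is zero, so the $c$ are
dense in the graph norm. Thus $\overline{\mathcal L}=UPU^{-1}$, and closability and self-adjointness
follow.

Part (a) comes from the termwise recurrence of $I_\nu$, with a passage to the limit in $\nu$ that
covers the integers. -/

namespace KontorovichLebedev

/-! ### Injectivity of the Fourier, Laplace and sine transforms. -/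

/-- A real integrable density is determined by the characteristic function of an injective
observable. -/
theorem ae_eq_zero_of_integral_mul_cexp_real {μ : Measure ℝ} {X : ℝ → ℝ}
    (hX : MeasurableEmbedding X) {f : ℝ → ℝ} (hf : Integrable f μ)
    (h : ∀ w : ℝ, ∫ x, (f x : ℂ) * Complex.exp (w * X x * Complex.I) ∂μ = 0) :
    f =ᵐ[μ] 0 := by
  -- The positive and negative parts of `f` are densities of two finite measures. The hypothesis
  -- says that their images under `X` have the same characteristic function, and an embedding lets
  -- equality be pulled back.
  set μ₁ := μ.withDensity fun x => ENNReal.ofReal (f x)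
  set μ₂ := μ.withDensity fun x => ENNReal.ofReal (-f x)
  have hm1 : AEMeasurable (fun x => ENNReal.ofReal (f x)) μ := hf.1.aemeasurable.ennreal_ofReal
  have hm2 : AEMeasurable (fun x => ENNReal.ofReal (-f x)) μ :=
    hf.1.aemeasurable.neg.ennreal_ofReal
  have : IsFiniteMeasure μ₁ := isFiniteMeasure_withDensity_ofReal hf.2
  have : IsFiniteMeasure μ₂ := isFiniteMeasure_withDensity_ofReal hf.neg.2
  have hb : ∀ w : ℝ, ∀ g : ℝ → ℝ, Integrable g μ →
      Integrable (fun x => g x • Complex.exp (w * X x * Complex.I)) μ := by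
    intro w g hg
    have hXm := hX.measurable
    refine hg.norm.mono' (hg.1.smul (by fun_prop)) (Eventually.of_forall fun x => ?_)
    rw [norm_smul]
    have : (w * X x * Complex.I : ℂ) = ((w * X x : ℝ) : ℂ) * Complex.I := by push_cast; ring
    rw [this, Complex.norm_exp_ofReal_mul_I, mul_one]
  have hmap : μ₁.map X = μ₂.map X := by
    refine Measure.ext_of_charFun (funext fun w => ?_)
    have hXm := hX.measurable
    rw [charFun_apply_real, charFun_apply_real, integral_map hXm.aemeasurable (by fun_prop),
      integral_map hXm.aemeasurable (by fun_prop),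
      integral_withDensity_eq_integral_toReal_smul₀ hm1 (by simp),
      integral_withDensity_eq_integral_toReal_smul₀ hm2 (by simp), ← sub_eq_zero,
      ← integral_sub]
    · rw [← h w]
      refine integral_congr_ae (Eventually.of_forall fun x => ?_)
      simp only [ENNReal.toReal_ofReal', ← sub_smul]
      rw [Complex.real_smul]
      congr 2
      rcases le_total 0 (f x) with h0 | h0
      · rw [max_eq_left h0, max_eq_right (by linarith)]; ring
      · rw [max_eq_right h0, max_eq_left (by linarith)]; ring
    · simp only [ENNReal.toReal_ofReal']
      exact hb w _ hf.pos_part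
    · simp only [ENNReal.toReal_ofReal']
      exact hb w _ hf.neg_part
  have heq : μ₁ = μ₂ := by
    rw [← hX.comap_map μ₁, ← hX.comap_map μ₂, hmap]
  have hfin : ∫⁻ x, ENNReal.ofReal (f x) ∂μ ≠ ⊤ := by
    refine ((lintegral_mono fun x => ?_).trans_lt hf.2).ne
    rw [← ofReal_norm]
    exact ENNReal.ofReal_le_ofReal (le_abs_self _)
  filter_upwards [(withDensity_eq_iff hm1 hm2 hfin).mp heq] with x hx
  rcases le_total 0 (f x) with h0 | h0
  · rw [ENNReal.ofReal_of_nonpos (by linarith : -f x ≤ 0), ENNReal.ofReal_eq_zero] at hx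
    exact le_antisymm hx h0
  · rw [ENNReal.ofReal_of_nonpos h0, eq_comm, ENNReal.ofReal_eq_zero] at hx
    exact le_antisymm h0 (by simpa using hx)

/-- Conjugation replaces `w` by `-w`, so the transform of the conjugate of `f` vanishes too, and the
real case applies to the real and imaginary parts. -/
theorem ae_eq_zero_of_integral_mul_cexp {μ : Measure ℝ} {X : ℝ → ℝ}
    (hX : MeasurableEmbedding X) {f : ℝ → ℂ} (hf : Integrable f μ)
    (h : ∀ w : ℝ, ∫ x, f x * Complex.exp (w * X x * Complex.I) ∂μ = 0) :
    f =ᵐ[μ] 0 := by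
  have hXm := hX.measurable
  have hb : ∀ w : ℝ, ∀ g : ℝ → ℂ, Integrable g μ →
      Integrable (fun x => g x * Complex.exp (w * X x * Complex.I)) μ := by
    intro w g hg
    refine hg.norm.mono' (hg.1.mul (by fun_prop)) (Eventually.of_forall fun x => ?_)
    rw [norm_mul]
    have : (w * X x * Complex.I : ℂ) = ((w * X x : ℝ) : ℂ) * Complex.I := by push_cast; ring
    rw [this, Complex.norm_exp_ofReal_mul_I, mul_one]
  have hconj : Integrable (fun x => (starRingEnd ℂ) (f x)) μ :=
    (Complex.conjLIE.toContinuousLinearEquiv.toContinuousLinearMap).integrable_comp hf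
  have hc : ∀ w : ℝ, ∫ x, (starRingEnd ℂ) (f x) * Complex.exp (w * X x * Complex.I) ∂μ = 0 := by
    intro w
    have h1 := congrArg (starRingEnd ℂ) (h (-w))
    rw [map_zero, ← integral_conj] at h1
    rw [← h1]
    refine integral_congr_ae (Eventually.of_forall fun x => ?_)
    simp only [map_mul, ← Complex.exp_conj, Complex.conj_I, Complex.conj_ofReal]
    congr 2
    push_cast; ring
  have hre := ae_eq_zero_of_integral_mul_cexp_real hX hf.re (fun w => by
    have := integral_add (hb w _ hf) (hb w _ hconj)
    rw [h w, hc w, add_zero] at this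
    rw [← zero_div (2 : ℂ), ← this, ← integral_div]
    refine integral_congr_ae (Eventually.of_forall fun x => ?_)
    simp only [← add_mul, Complex.add_conj, RCLike.re_to_complex]
    push_cast; ring)
  have him := ae_eq_zero_of_integral_mul_cexp_real hX hf.im (fun w => by
    have := integral_sub (hb w _ hf) (hb w _ hconj)
    rw [h w, hc w, sub_zero] at this
    rw [← zero_div (2 * Complex.I), ← this, ← integral_div]
    refine integral_congr_ae (Eventually.of_forall fun x => ?_)
    simp only [← sub_mul, Complex.sub_conj, RCLike.im_to_complex]
    push_cast
    field_simp)
  filter_upwards [hre, him] with x h1 h2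
  exact Complex.ext h1 h2

/-- Injectivity of the Laplace transform on a half-line of parameters. -/
theorem ae_eq_zero_of_laplace {f : ℝ → ℂ}
    (hf : ∀ p : ℝ, 1 < p → IntegrableOn (fun x => f x * Real.exp (-(p * x))) (Set.Ioi 0))
    (h : ∀ p : ℝ, 1 < p → ∫ x in Set.Ioi 0, f x * Real.exp (-(p * x)) = 0) :
    f =ᵐ[volume.restrict (Set.Ioi 0)] 0 := by
  have hX : MeasurableEmbedding fun x : ℝ => Real.exp (-x) :=
    (Real.continuous_exp.comp continuous_neg).measurableEmbedding
      (Real.exp_injective.comp neg_injective)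
  have h2 : IntegrableOn (fun x => f x * Real.exp (-(2 * x))) (Set.Ioi 0) := hf 2 one_lt_two
  -- The observable is $e^{-x}$. Expanding $\exp(iwe^{-x})$ in powers against $f(x)e^{-2x}$ produces
  -- the Laplace transform at the points $2+n$, all of which vanish.
  have key := ae_eq_zero_of_integral_mul_cexp hX h2 (fun w => by
    set F : ℕ → ℝ → ℂ := fun n x => (w * Complex.I) ^ n / n.factorial *
      (f x * Real.exp (-((2 + n : ℝ) * x)))
    have hFn : ∀ n x, F n x = f x * Real.exp (-(2 * x)) *
        ((w * Real.exp (-x) * Complex.I) ^ n / n.factorial) := by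
      intro n x
      have : (Real.exp (-((2 + n : ℝ) * x)) : ℂ)
          = Real.exp (-(2 * x)) * (Real.exp (-x) : ℂ) ^ n := by
        rw [← Complex.ofReal_pow, ← Real.exp_nat_mul, ← Complex.ofReal_mul, ← Real.exp_add]
        congr 2; ring
      simp only [F, this]
      ring
    have hFi : ∀ n, Integrable (F n) (volume.restrict (Set.Ioi 0)) := fun n =>
      (hf (2 + n) (by have : (0 : ℝ) ≤ n := n.cast_nonneg
                      linarith)).const_mul _
    have hs : Summable fun n => ∫ x in Set.Ioi 0, ‖F n x‖ := by
      refine Summable.of_nonneg_of_le (fun n => integral_nonneg fun x => norm_nonneg _)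
        (fun n => ?_) ((Real.summable_pow_div_factorial |w|).mul_right
          (∫ x in Set.Ioi 0, ‖f x * Real.exp (-(2 * x))‖))
      rw [← integral_const_mul]
      refine setIntegral_mono_on (hFi n).norm (h2.norm.const_mul _) measurableSet_Ioi
        fun x (hx : 0 < x) => ?_
      rw [hFn, norm_mul, mul_comm]
      refine mul_le_mul_of_nonneg_right ?_ (norm_nonneg _)
      rw [norm_div, norm_pow, norm_mul, norm_mul, Complex.norm_I, mul_one, Complex.norm_real,
        Complex.norm_real, Complex.norm_natCast, Real.norm_eq_abs, Real.norm_eq_abs, Real.abs_exp]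
      gcongr
      exact mul_le_of_le_one_right (abs_nonneg _) (Real.exp_le_one_iff.mpr (by linarith))
    have := hasSum_integral_of_summable_integral_norm hFi hs
    have h0 : ∀ n, ∫ x in Set.Ioi 0, F n x = 0 := by
      intro n
      simp only [F]
      rw [integral_const_mul, h (2 + n) (by have : (0 : ℝ) ≤ n := n.cast_nonneg
                                            linarith), mul_zero]
    simp only [h0] at this
    rw [← this.unique hasSum_zero]
    refine integral_congr_ae (Eventually.of_forall fun x => ?_)
    simp only [hFn]
    rw [tsum_mul_left, Complex.exp_eq_exp_ℂ, NormedSpace.exp_eq_tsum_div])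
  filter_upwards [key] with x hx
  simpa [Complex.exp_ne_zero] using hx

/-- Injectivity of the sine transform. -/
theorem ae_eq_zero_of_sine {f : ℝ → ℂ} (hf : IntegrableOn f (Set.Ioi 0))
    (h : ∀ w : ℝ, 0 < w → ∫ x in Set.Ioi 0, f x * Real.sin (w * x) = 0) :
    f =ᵐ[volume.restrict (Set.Ioi 0)] 0 := by
  have h' : ∀ w : ℝ, ∫ x in Set.Ioi 0, f x * Real.sin (w * x) = 0 := by
    intro w
    rcases lt_trichotomy w 0 with hw | rfl | hw
    · have := h (-w) (by linarith)
      simp only [neg_mul, Real.sin_neg, Complex.ofReal_neg, mul_neg, integral_neg,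
        neg_eq_zero] at this
      exact this
    · simp
    · exact h w hw
  -- For the odd extension the Fourier integral equals $2i$ times the sine integral; the value at
  -- the single point 0 plays no role.
  set g : ℝ → ℂ := fun x => if 0 < x then f x else -f (-x)
  have e1 : Set.EqOn g f (Set.Ioi 0) := fun x (hx : 0 < x) => if_pos hx
  have e2 : Set.EqOn g (fun x => -f (-x)) (Set.Iic 0) := fun x (hx : x ≤ 0) =>
    if_neg (not_lt.mpr hx)
  have i1 : IntegrableOn g (Set.Ioi 0) := hf.congr_fun e1.symm measurableSet_Ioi
  have i2 : IntegrableOn g (Set.Iic 0) := by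
    refine IntegrableOn.congr_fun ?_ e2.symm measurableSet_Iic
    rw [integrableOn_Iic_iff_integrableOn_Iio]
    exact (IntegrableOn.comp_neg_Iio (c := 0) (by simpa using hf)).neg
  have ig : Integrable g := by
    rw [← integrableOn_univ, ← Set.Iic_union_Ioi (a := (0 : ℝ))]
    exact i2.union i1
  have key := ae_eq_zero_of_integral_mul_cexp MeasurableEmbedding.id ig (fun w => by
    have hi : Integrable (fun x => g x * Complex.exp (w * x * Complex.I)) := by
      refine ig.norm.mono' (ig.1.mul (by fun_prop)) (Eventually.of_forall fun x => ?_)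
      rw [norm_mul]
      have : (w * x * Complex.I : ℂ) = ((w * x : ℝ) : ℂ) * Complex.I := by push_cast; ring
      rw [this, Complex.norm_exp_ofReal_mul_I, mul_one]
    simp only [id]
    rw [← intervalIntegral.integral_Iic_add_Ioi (b := 0) hi.integrableOn hi.integrableOn,
      ← neg_zero, ← integral_comp_neg_Ioi, neg_zero, ← integral_add, ← mul_zero (2 * Complex.I),
      ← h' w, ← integral_const_mul]
    · refine setIntegral_congr_fun measurableSet_Ioi fun x (hx : 0 < x) => ?_
      have : g (-x) = - f x := by simp [g, hx.le]
      simp only [this, e1 hx]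
      rw [Complex.ofReal_sin, Complex.sin]
      push_cast
      have : (w * -x * Complex.I : ℂ) = - (w * x) * Complex.I := by ring
      rw [this]
      ring_nf
      simp only [Complex.I_sq]
      ring
    · have := hi.comp_neg.integrableOn (s := Set.Ioi 0)
      exact this
    · exact hi.integrableOn)
  filter_upwards [ae_restrict_of_ae key, ae_restrict_mem measurableSet_Ioi] with x hx hx0
  rw [← e1 hx0, hx]

/-! ### The weight $|\Gamma(is)|^{-2}$ and the two measures. -/

/-- The reflection formula, combined with $\Gamma(1-is)=-is\,\overline{\Gamma(is)}$. -/
theorem sq_norm_Gamma_I_mul {s : ℝ} (hs : 0 < s) :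
    ‖Complex.Gamma (Complex.I * s)‖ ^ 2 = Real.pi / (s * Real.sinh (Real.pi * s)) := by
  have hI : (Complex.I * s : ℂ) ≠ 0 := by simp [hs.ne']
  have hsh : 0 < Real.sinh (Real.pi * s) := Real.sinh_pos_iff.mpr (by positivity)
  have h1 := Complex.Gamma_mul_Gamma_one_sub (Complex.I * s)
  have h2 : Complex.Gamma (1 - Complex.I * s)
      = -(Complex.I * s) * (starRingEnd ℂ) (Complex.Gamma (Complex.I * s)) := by
    rw [← Complex.Gamma_conj]
    have := Complex.Gamma_add_one (-(Complex.I * s)) (neg_ne_zero.mpr hI)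
    rw [show (1 - Complex.I * s : ℂ) = -(Complex.I * s) + 1 by ring, this]
    congr 2
    simp
  have h3 : Complex.sin (Real.pi * (Complex.I * s)) = Real.sinh (Real.pi * s) * Complex.I := by
    rw [show (Real.pi * (Complex.I * s) : ℂ) = ((Real.pi * s : ℝ) : ℂ) * Complex.I by
      push_cast; ring, Complex.sin_mul_I, Complex.ofReal_sinh]
  rw [h2, h3, mul_left_comm, Complex.mul_conj, Complex.normSq_eq_norm_sq] at h1
  have hshC : (Real.sinh (Real.pi * s) : ℂ) ≠ 0 := by exact_mod_cast hsh.ne'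
  rw [eq_div_iff (mul_ne_zero hshC Complex.I_ne_zero)] at h1
  rw [eq_div_iff (by positivity)]
  have h4 : (((‖Complex.Gamma (Complex.I * s)‖ ^ 2 * (s * Real.sinh (Real.pi * s)) : ℝ)) : ℂ)
      = (Real.pi : ℝ) := by
    rw [← h1]
    push_cast
    linear_combination ((‖Complex.Gamma (Complex.I * s)‖ : ℂ) ^ 2 * s
      * Complex.sinh (Real.pi * s)) * Complex.I_sq
  exact_mod_cast h4

/-- The density of `measS`. -/
noncomputable def dens (s : ℝ) : ℝ := 2 / Real.pi ^ 2 * (s * Real.sinh (Real.pi * s))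

theorem dens_pos {s : ℝ} (hs : 0 < s) : 0 < dens s := by
  have hsh : 0 < Real.sinh (Real.pi * s) := Real.sinh_pos_iff.mpr (by positivity)
  unfold dens
  positivity

theorem continuous_dens : Continuous dens := by unfold dens; fun_prop

theorem measS_eq : measS = (volume.restrict (Set.Ioi 0)).withDensity
    (fun s => ENNReal.ofReal (dens s)) := by
  refine withDensity_congr_ae ?_
  filter_upwards [ae_restrict_mem measurableSet_Ioi] with s hs
  have hs' : 0 < s := hs
  have hsh : 0 < Real.sinh (Real.pi * s) := Real.sinh_pos_iff.mpr (by positivity)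
  rw [sq_norm_Gamma_I_mul hs, dens]
  congr 1
  field_simp

instance : SFinite measS := by unfold measS; infer_instance

theorem ae_measX_iff {P : ℝ → Prop} :
    (∀ᵐ x ∂measX, P x) ↔ ∀ᵐ x ∂volume.restrict (Set.Ioi 0), P x := by
  refine ⟨fun h => ?_, fun h => (withDensity_absolutelyContinuous _ _).ae_le h⟩
  refine (withDensity_absolutelyContinuous' ?_ ?_).ae_le h
  · fun_prop
  · filter_upwards [ae_restrict_mem measurableSet_Ioi] with s hs
    have : (0 : ℝ) < s := hs
    rw [Ne, ENNReal.ofReal_eq_zero, not_le]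
    positivity

theorem ae_measS_iff {P : ℝ → Prop} :
    (∀ᵐ x ∂measS, P x) ↔ ∀ᵐ x ∂volume.restrict (Set.Ioi 0), P x :=
  ⟨fun h => volume_absCont.ae_le h, fun h => (withDensity_absolutelyContinuous _ _).ae_le h⟩

theorem integral_measX (f : ℝ → ℂ) :
    ∫ x, f x ∂measX = ∫ x in Set.Ioi 0, ((1 / x : ℝ) : ℂ) * f x := by
  rw [measX, integral_withDensity_eq_integral_toReal_smul (by fun_prop) (by simp)]
  refine setIntegral_congr_fun measurableSet_Ioi fun x (hx : 0 < x) => ?_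
  rw [ENNReal.toReal_ofReal (by positivity), Complex.real_smul]

theorem integrable_measX_iff {f : ℝ → ℂ} :
    Integrable f measX ↔ IntegrableOn (fun x => ((1 / x : ℝ) : ℂ) * f x) (Set.Ioi 0) := by
  rw [measX, integrable_withDensity_iff_integrable_smul' (by fun_prop) (by simp), IntegrableOn]
  refine integrable_congr ?_
  filter_upwards [ae_restrict_mem measurableSet_Ioi] with x hx
  have : (0 : ℝ) < x := hx
  rw [ENNReal.toReal_ofReal (by positivity), Complex.real_smul]

theorem integral_measS (f : ℝ → ℂ) : ∫ s, f s ∂measS = ∫ s in Set.Ioi 0, (dens s : ℂ) * f s := by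
  rw [measS_eq, integral_withDensity_eq_integral_toReal_smul
    (by have := continuous_dens; fun_prop) (by simp)]
  refine setIntegral_congr_fun measurableSet_Ioi fun x (hx : 0 < x) => ?_
  rw [ENNReal.toReal_ofReal (dens_pos hx).le, Complex.real_smul]

theorem integrable_measS_iff {f : ℝ → ℂ} :
    Integrable f measS ↔ IntegrableOn (fun s => (dens s : ℂ) * f s) (Set.Ioi 0) := by
  rw [measS_eq, integrable_withDensity_iff_integrable_smul'
    (by have := continuous_dens; fun_prop) (by simp), IntegrableOn]
  refine integrable_congr ?_
  filter_upwards [ae_restrict_mem measurableSet_Ioi] with x hx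
  rw [ENNReal.toReal_ofReal (dens_pos hx).le, Complex.real_smul]

/-! ### Fourier and sine integrals of hyperbolic functions. -/

theorem half_mul_exp_half_le_sinh {x : ℝ} (hx : 0 ≤ x) :
    x / 2 * Real.exp (x / 2) ≤ Real.sinh x := by
  have h1 : Real.sinh x = 2 * Real.sinh (x / 2) * Real.cosh (x / 2) := by
    rw [← Real.sinh_two_mul]; congr 1; ring
  have h2 : x / 2 ≤ Real.sinh (x / 2) := Real.self_le_sinh_iff.mpr (by linarith)
  have h3 : Real.exp (x / 2) ≤ 2 * Real.cosh (x / 2) := by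
    rw [Real.cosh_eq]; linarith [Real.exp_pos (-(x / 2))]
  rw [h1, mul_comm 2, mul_assoc]
  gcongr

theorem exp_abs_le_two_cosh (x : ℝ) : Real.exp |x| ≤ 2 * Real.cosh x := by
  rw [← Real.cosh_abs, Real.cosh_eq]; linarith [Real.exp_pos (-|x|)]

theorem abs_le_cosh (t : ℝ) : |t| ≤ Real.cosh t := by
  rw [← Real.cosh_abs]
  exact (Real.self_le_sinh_iff.mpr (abs_nonneg t)).trans (Real.sinh_lt_cosh _).le

theorem integrable_exp_neg_mul_abs {c : ℝ} (hc : 0 < c) :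
    Integrable fun t : ℝ => Real.exp (-(c * |t|)) := by
  have h : IntegrableOn (fun t : ℝ => Real.exp (-c * t)) (Set.Ioi 0) :=
    exp_neg_integrableOn_Ioi 0 hc
  have h1 : IntegrableOn (fun t : ℝ => Real.exp (-(c * |t|))) (Set.Ioi 0) := by
    refine h.congr_fun (fun t (ht : 0 < t) => ?_) measurableSet_Ioi
    simp only [abs_of_pos ht, neg_mul]
  have h2 : IntegrableOn (fun t : ℝ => Real.exp (-(c * |t|))) (Set.Iic 0) := by
    rw [integrableOn_Iic_iff_integrableOn_Iio]
    have := IntegrableOn.comp_neg_Iio (c := (0 : ℝ)) (by simpa using h1)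
    simpa using this
  rw [← integrableOn_univ, ← Set.Iic_union_Ioi (a := (0 : ℝ))]
  exact h2.union h1

theorem integrable_inv_cosh_add {q : ℝ} (hq : 0 ≤ q) :
    Integrable fun t : ℝ => 1 / (Real.cosh t + q) := by
  refine ((integrable_exp_neg_mul_abs one_pos).const_mul 2).mono' ?_
    (Eventually.of_forall fun t => ?_)
  · refine Continuous.aestronglyMeasurable
      (Continuous.div continuous_const (by fun_prop) fun t => ?_)
    have := Real.cosh_pos t
    positivity
  · have h0 := Real.cosh_pos t
    rw [Real.norm_of_nonneg (by positivity), one_mul, Real.exp_neg, div_le_iff₀ (by positivity)]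
    have := exp_abs_le_two_cosh t
    have h2 := Real.exp_pos |t|
    have : 1 = 2 * (Real.exp |t|)⁻¹ * (Real.exp |t| / 2) := by field_simp
    calc (1 : ℝ) = 2 * (Real.exp |t|)⁻¹ * (Real.exp |t| / 2) := this
      _ ≤ _ := by gcongr; linarith

theorem integrable_exp_neg_mul_cosh {x : ℝ} (hx : 0 < x) :
    Integrable fun t : ℝ => Real.exp (-(x * Real.cosh t)) := by
  refine (integrable_exp_neg_mul_abs hx).mono' (by fun_prop) (Eventually.of_forall fun t => ?_)
  rw [Real.norm_of_nonneg (Real.exp_pos _).le]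
  gcongr
  exact abs_le_cosh t

theorem one_div_sq_cosh_half (t : ℝ) : 1 / Real.cosh (t / 2) ^ 2 = 2 * (1 / (Real.cosh t + 1)) := by
  have h := Real.cosh_pos (t / 2)
  have : Real.cosh t + 1 = 2 * Real.cosh (t / 2) ^ 2 := by
    have h1 := Real.cosh_two_mul (t / 2)
    rw [mul_div_cancel₀ t two_ne_zero] at h1
    have h2 := Real.cosh_sq (t / 2)
    linarith
  rw [this]; field_simp

theorem integrable_inv_sq_cosh : Integrable fun t : ℝ => 1 / Real.cosh (t / 2) ^ 2 := by
  simp only [one_div_sq_cosh_half]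
  exact (integrable_inv_cosh_add zero_le_one).const_mul 2

theorem integrable_cexp_mul_ofReal {f : ℝ → ℝ} (hf : Integrable f) (s : ℝ) :
    Integrable fun t : ℝ => Complex.exp ((s * t : ℝ) * Complex.I) * (f t : ℂ) := by
  refine hf.norm.mono' ?_ (Eventually.of_forall fun t => ?_)
  · have := hf.1
    exact (Continuous.aestronglyMeasurable (by fun_prop)).mul
      (Complex.continuous_ofReal.comp_aestronglyMeasurable this)
  · rw [norm_mul, Complex.norm_exp_ofReal_mul_I, one_mul, Complex.norm_real]

theorem sigmoid_mul_eq (t : ℝ) :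
    Real.sigmoid t * (1 - Real.sigmoid t) = 1 / 4 * (1 / Real.cosh (t / 2) ^ 2) := by
  rw [← Real.sigmoid_neg, Real.sigmoid_def, Real.sigmoid_def, neg_neg, Real.cosh_eq]
  have h1 : Real.exp t = Real.exp (t / 2) ^ 2 := by rw [← Real.exp_nat_mul]; congr 1; ring
  rw [Real.exp_neg, Real.exp_neg, h1]
  have := Real.exp_pos (t / 2)
  field_simp
  ring

theorem log_sigmoid_sub (t : ℝ) :
    Real.log (Real.sigmoid t) - Real.log (1 - Real.sigmoid t) = t := by
  rw [← Real.sigmoid_neg, ← Real.sigmoid_mul_rexp_neg,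
    Real.log_mul (Real.sigmoid_pos t).ne' (Real.exp_pos _).ne', Real.log_exp]
  ring

/-- The substitution $u=1/(1+e^{-t})$ turns $B(1+is,1-is)$ into this integral, since $\log
u-\log(1-u)=t$ and $du=dt/(4\cosh^2(t/2))$. The Beta value is $\Gamma(1+is)\Gamma(1-is)=\pi
s/\sinh\pi s$. -/
theorem integral_cexp_div_sq_cosh {s : ℝ} (hs : s ≠ 0) :
    ∫ t : ℝ, Complex.exp ((s * t : ℝ) * Complex.I) * ((1 / Real.cosh (t / 2) ^ 2 : ℝ) : ℂ)
      = ((4 * Real.pi * s / Real.sinh (Real.pi * s) : ℝ) : ℂ) := by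
  have hI : (Complex.I * s : ℂ) ≠ 0 := by simp [hs]
  have hB : Complex.betaIntegral (1 + Complex.I * s) (1 - Complex.I * s)
      = 1 / 4 * ∫ t : ℝ, Complex.exp ((s * t : ℝ) * Complex.I) *
        ((1 / Real.cosh (t / 2) ^ 2 : ℝ) : ℂ) := by
    rw [Complex.betaIntegral, intervalIntegral.integral_of_le zero_le_one,
      integral_Ioc_eq_integral_Ioo, ← Real.range_sigmoid, ← Set.image_univ,
      integral_image_eq_integral_abs_deriv_smul MeasurableSet.univ
        (fun x _ => (Real.hasDerivAt_sigmoid x).hasDerivWithinAt)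
        Real.sigmoid_injective.injOn, setIntegral_univ, ← integral_const_mul]
    refine integral_congr_ae (Eventually.of_forall fun t => ?_)
    have p1 := Real.sigmoid_pos t
    have p2 : 0 < 1 - Real.sigmoid t := by linarith [Real.sigmoid_lt_one t]
    simp only
    rw [abs_of_pos (mul_pos p1 p2), sigmoid_mul_eq, Complex.real_smul,
      ← Complex.ofReal_one, ← Complex.ofReal_sub,
      Complex.cpow_def_of_ne_zero (by exact_mod_cast p1.ne'),
      Complex.cpow_def_of_ne_zero (by exact_mod_cast p2.ne'), ← Complex.exp_add,
      ← Complex.ofReal_log p1.le, ← Complex.ofReal_log p2.le]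
    have : (Real.log (Real.sigmoid t) : ℂ) * ((1 : ℝ) + Complex.I * s - (1 : ℝ)) +
        (Real.log (1 - Real.sigmoid t) : ℂ) * ((1 : ℝ) - Complex.I * s - (1 : ℝ))
        = ((s * t : ℝ) : ℂ) * Complex.I := by
      conv_rhs => rw [← log_sigmoid_sub t]
      push_cast; ring
    rw [this]
    push_cast; ring
  have hG := Complex.Gamma_mul_Gamma_eq_betaIntegral (s := 1 + Complex.I * s)
    (t := 1 - Complex.I * s) (by simp) (by simp)
  have h2 : Complex.Gamma (1 + Complex.I * s + (1 - Complex.I * s)) = 1 := by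
    rw [show (1 + Complex.I * s + (1 - Complex.I * s) : ℂ) = (1 : ℕ) + 1 by push_cast; ring,
      Complex.Gamma_nat_eq_factorial]; simp
  have h3 : Complex.sin (Real.pi * (Complex.I * s)) = Real.sinh (Real.pi * s) * Complex.I := by
    rw [show (Real.pi * (Complex.I * s) : ℂ) = ((Real.pi * s : ℝ) : ℂ) * Complex.I by
      push_cast; ring, Complex.sin_mul_I, Complex.ofReal_sinh]
  have hsh : (Real.sinh (Real.pi * s) : ℂ) ≠ 0 := by
    have : Real.sinh (Real.pi * s) ≠ 0 := by
      rw [Ne, Real.sinh_eq_zero]; exact mul_ne_zero Real.pi_ne_zero hs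
    exact_mod_cast this
  rw [h2, one_mul, add_comm 1, Complex.Gamma_add_one _ hI, mul_assoc,
    Complex.Gamma_mul_Gamma_one_sub, h3, add_comm (Complex.I * (s:ℂ)) 1, hB] at hG
  have : ∀ z : ℂ, z = 4 * (1 / 4 * z) := fun z => by ring
  rw [this (∫ t : ℝ, _), ← hG]
  have hI' := Complex.I_ne_zero
  push_cast
  push_cast at hsh
  field_simp

theorem abs_div_abs_sinh_le (s : ℝ) :
    |s / Real.sinh (Real.pi * s)| ≤ 2 / Real.pi * Real.exp (-(Real.pi / 2 * |s|)) := by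
  rcases eq_or_ne s 0 with rfl | hs
  · simp; positivity
  have hp := Real.pi_pos
  have hs' := abs_pos.mpr hs
  have h1 : |Real.sinh (Real.pi * s)| = Real.sinh (Real.pi * |s|) := by
    rw [Real.abs_sinh, abs_mul, abs_of_pos hp]
  have h2 := half_mul_exp_half_le_sinh (x := Real.pi * |s|) (by positivity)
  rw [abs_div, h1, div_le_iff₀ (Real.sinh_pos_iff.mpr (by positivity)), Real.exp_neg]
  calc |s| = 2 / Real.pi * (Real.exp (Real.pi / 2 * |s|))⁻¹ *
        (Real.pi * |s| / 2 * Real.exp (Real.pi / 2 * |s|)) := by field_simp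
    _ ≤ _ := by
      gcongr
      rwa [show Real.pi * |s| / 2 = Real.pi / 2 * |s| by ring] at h2 ⊢

theorem integrable_div_sinh : Integrable fun s : ℝ => s / Real.sinh (Real.pi * s) :=
  ((integrable_exp_neg_mul_abs (c := Real.pi / 2) (by positivity)).const_mul (2 / Real.pi)).mono'
    (by
      have : Measurable fun s : ℝ => Real.sinh (Real.pi * s) := by fun_prop
      exact (measurable_id.div this).aestronglyMeasurable)
    (Eventually.of_forall abs_div_abs_sinh_le)

/-- Fourier inversion applied to `integral_cexp_div_sq_cosh`. -/
theorem integral_cexp_mul_div_sinh (a : ℝ) :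
    ∫ s : ℝ, Complex.exp ((a * s : ℝ) * Complex.I) * ((s / Real.sinh (Real.pi * s) : ℝ) : ℂ)
      = ((1 / (2 * Real.cosh (a / 2) ^ 2) : ℝ) : ℂ) := by
  set f : ℝ → ℂ := fun t => ((1 / Real.cosh (t / 2) ^ 2 : ℝ) : ℂ)
  have hp := Real.pi_pos
  have hfc : Continuous f := by
    refine Complex.continuous_ofReal.comp (continuous_const.div (by fun_prop) fun t => ?_)
    have := Real.cosh_pos (t / 2)
    positivity
  have hfi : Integrable f := integrable_inv_sq_cosh.ofReal
  have hF : ∀ w : ℝ, w ≠ 0 → FourierTransform.fourier f w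
      = ((8 * Real.pi * ((Real.pi * w) / Real.sinh (2 * Real.pi ^ 2 * w)) : ℝ) : ℂ) := by
    intro w hw
    have h1 := integral_cexp_div_sq_cosh (s := -2 * Real.pi * w) (by simp [hw, hp.ne'])
    rw [Real.fourier_real_eq_integral_exp_smul]
    have h2 : Real.sinh (Real.pi * (-2 * Real.pi * w)) = - Real.sinh (2 * Real.pi ^ 2 * w) := by
      rw [← Real.sinh_neg]; congr 1; ring
    rw [h2] at h1
    have h3 : 4 * Real.pi * (-2 * Real.pi * w) / -Real.sinh (2 * Real.pi ^ 2 * w)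
        = 8 * Real.pi * ((Real.pi * w) / Real.sinh (2 * Real.pi ^ 2 * w)) := by
      rw [div_neg]; ring
    rw [h3] at h1
    rw [← h1]
    refine integral_congr_ae (Eventually.of_forall fun t => ?_)
    simp only [smul_eq_mul, f]
    congr 4
    ring
  have hFae : FourierTransform.fourier f =ᵐ[volume] fun w : ℝ =>
      ((4 * ((2 * Real.pi * w) / Real.sinh (Real.pi * (2 * Real.pi * w))) * Real.pi: ℝ) : ℂ) := by
    -- At $w=0$ the quotient has the default value 0 instead of its limit, which matters only on a
    -- null set.
    have : ∀ᵐ w : ℝ, w ≠ 0 := Measure.ae_ne volume 0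
    filter_upwards [this] with w hw
    rw [hF w hw, show Real.pi * (2 * Real.pi * w) = 2 * Real.pi ^ 2 * w by ring]
    congr 1; ring
  have hFi : Integrable (FourierTransform.fourier f) := by
    refine Integrable.congr ?_ hFae.symm
    refine Integrable.ofReal ?_
    refine Integrable.mul_const (Integrable.const_mul ?_ _) _
    exact integrable_div_sinh.comp_mul_left' (R := 2 * Real.pi) (by positivity)
  have h := congrFun (hfc.fourierInv_fourier_eq hfi hFi) a
  rw [Real.fourierInv_eq'] at h
  have h4 : ∫ v : ℝ, Complex.exp (((2 * Real.pi * inner ℝ v a : ℝ) : ℂ) * Complex.I) •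
      FourierTransform.fourier f v = ∫ v : ℝ, (fun s : ℝ => (4 * Real.pi : ℂ) *
        (Complex.exp ((a * s : ℝ) * Complex.I) * ((s / Real.sinh (Real.pi * s) : ℝ) : ℂ)))
          (2 * Real.pi * v) := by
    refine integral_congr_ae ?_
    filter_upwards [hFae] with w hw
    rw [hw]
    simp only [smul_eq_mul, RCLike.inner_apply, conj_trivial]
    rw [show (2 * Real.pi * (a * w) : ℝ) = a * (2 * Real.pi * w) by ring]
    push_cast; ring
  rw [h4, Measure.integral_comp_mul_left (fun s : ℝ => (4 * Real.pi : ℂ) *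
        (Complex.exp ((a * s : ℝ) * Complex.I) * ((s / Real.sinh (Real.pi * s) : ℝ) : ℂ)))
    (2 * Real.pi), integral_const_mul, abs_of_pos (by positivity)] at h
  have h5 : ((1 / (2 * Real.cosh (a / 2) ^ 2) : ℝ) : ℂ) = 1 / 2 * f a := by
    simp only [f]; push_cast; field_simp
  have hpC : (Real.pi : ℂ) ≠ 0 := by exact_mod_cast hp.ne'
  rw [h5, ← h, Complex.real_smul]
  generalize (∫ s : ℝ, Complex.exp ((a * s : ℝ) * Complex.I) *
    ((s / Real.sinh (Real.pi * s) : ℝ) : ℂ)) = J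
  push_cast
  field_simp
  ring

theorem integral_mul_cos_div_sinh (a : ℝ) :
    ∫ s in Set.Ioi (0 : ℝ), s / Real.sinh (Real.pi * s) * Real.cos (a * s)
      = 1 / (4 * Real.cosh (a / 2) ^ 2) := by
  have h := congrArg Complex.re (integral_cexp_mul_div_sinh a)
  rw [Complex.ofReal_re, ← RCLike.re_eq_complex_re, ← integral_re
    (integrable_cexp_mul_ofReal integrable_div_sinh a)] at h
  have h1 : ∀ s : ℝ, RCLike.re (Complex.exp ((a * s : ℝ) * Complex.I) *
      ((s / Real.sinh (Real.pi * s) : ℝ) : ℂ))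
        = (fun s : ℝ => s / Real.sinh (Real.pi * s) * Real.cos (a * s)) |s| := by
    intro s
    rw [RCLike.re_eq_complex_re, Complex.re_mul_ofReal, Complex.exp_ofReal_mul_I_re, mul_comm]
    simp only
    rcases abs_choice s with h | h <;> rw [h]
    simp only [mul_neg, Real.cos_neg, Real.sinh_neg, neg_div_neg_eq]
  rw [integral_congr_ae (Eventually.of_forall h1), integral_comp_abs
    (f := fun s => s / Real.sinh (Real.pi * s) * Real.cos (a * s))] at h
  have h2 : 1 / (4 * Real.cosh (a / 2) ^ 2) = 1 / (2 * Real.cosh (a / 2) ^ 2) / 2 := by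
    rw [div_div]; congr 1; ring
  rw [h2, ← h, mul_div_cancel_left₀ _ two_ne_zero]

theorem abs_sin_div_sinh_le (a s : ℝ) : |Real.sin (a * s) / Real.sinh (Real.pi * s)| ≤
    |a| * |s / Real.sinh (Real.pi * s)| := by
  rw [abs_div, abs_div, ← mul_div_assoc, ← abs_mul]
  exact div_le_div_of_nonneg_right Real.abs_sin_le_abs (abs_nonneg _)

theorem integrable_sin_div_sinh (a : ℝ) :
    Integrable fun s : ℝ => Real.sin (a * s) / Real.sinh (Real.pi * s) := by
  refine (integrable_div_sinh.norm.const_mul |a|).mono' ?_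
    (Eventually.of_forall (abs_sin_div_sinh_le a))
  have : Measurable fun s : ℝ => Real.sinh (Real.pi * s) := by fun_prop
  exact ((by fun_prop : Measurable fun s : ℝ => Real.sin (a * s)).div this).aestronglyMeasurable

/-- Both sides vanish at $a=0$, and their derivatives in $a$ agree by `integral_mul_cos_div_sinh`.
-/
theorem integral_sin_div_sinh (a : ℝ) :
    ∫ s in Set.Ioi (0 : ℝ), Real.sin (a * s) / Real.sinh (Real.pi * s)
      = Real.tanh (a / 2) / 2 := by
  set F : ℝ → ℝ := fun a => (∫ s in Set.Ioi (0 : ℝ), Real.sin (a * s) / Real.sinh (Real.pi * s))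
    - Real.sinh (a / 2) / Real.cosh (a / 2) / 2
  have hF : ∀ a, HasDerivAt F 0 a := by
    intro a
    have h1 := (hasDerivAt_integral_of_dominated_loc_of_deriv_le
      (μ := volume.restrict (Set.Ioi (0 : ℝ)))
      (F := fun a s => Real.sin (a * s) / Real.sinh (Real.pi * s))
      (F' := fun a s => s / Real.sinh (Real.pi * s) * Real.cos (a * s))
      (x₀ := a) (s := Set.univ) (bound := fun s => |s / Real.sinh (Real.pi * s)|)
      Filter.univ_mem
      (Eventually.of_forall fun a => (integrable_sin_div_sinh a).1.restrict)
      (integrable_sin_div_sinh a).integrableOn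
      (integrable_div_sinh.1.restrict.mul (by fun_prop))
      (Eventually.of_forall fun s a _ => by
        rw [norm_mul]
        exact mul_le_of_le_one_right (abs_nonneg _) (Real.abs_cos_le_one _))
      integrable_div_sinh.abs.integrableOn
      (Eventually.of_forall fun s a _ => by
        have : HasDerivAt (fun a : ℝ => a * s) s a := by
          simpa using (hasDerivAt_id a).mul_const s
        refine (this.sin.div_const (Real.sinh (Real.pi * s))).congr_deriv ?_
        ring)).2
    rw [integral_mul_cos_div_sinh] at h1
    have hc := Real.cosh_pos (a / 2)
    have h2 : HasDerivAt (fun a : ℝ => a / 2) (1 / 2) a := (hasDerivAt_id a).div_const 2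
    have h3 := (h2.sinh.div h2.cosh hc.ne').div_const 2
    refine (h1.sub h3).congr_deriv ?_
    have := Real.cosh_sq (a / 2)
    field_simp
    linarith
  have hconst := is_const_of_deriv_eq_zero (fun a => (hF a).differentiableAt)
    (fun a => (hF a).deriv) a 0
  simp only [F] at hconst
  rw [Real.tanh_eq_sinh_div_cosh]
  simp at hconst
  linarith

theorem cosh_add_cosh (t τ : ℝ) : Real.cosh t + Real.cosh τ
    = 2 * (Real.cosh ((t + τ) / 2) * Real.cosh ((t - τ) / 2)) := by
  have h1 := Real.cosh_add ((t + τ) / 2) ((t - τ) / 2)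
  have h2 := Real.cosh_sub ((t + τ) / 2) ((t - τ) / 2)
  rw [show (t + τ) / 2 + (t - τ) / 2 = t by ring] at h1
  rw [show (t + τ) / 2 - (t - τ) / 2 = τ by ring] at h2
  linarith

theorem sinh_half_sub (t τ : ℝ) : Real.sinh ((t + τ) / 2) * Real.cosh ((t - τ) / 2)
    - Real.cosh ((t + τ) / 2) * Real.sinh ((t - τ) / 2) = Real.sinh τ := by
  rw [← Real.sinh_sub]; congr 1; ring

/-- With antiderivative $2\tanh((t+\sigma)/2)$, this exhibits $1/(\cosh t+\cosh\tau)$ as a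
superposition of translates of $1/\cosh^2(t/2)$, whose Fourier transform is known. -/
theorem integral_inv_sq_cosh_add (t τ : ℝ) :
    ∫ σ in (-τ)..τ, 1 / Real.cosh ((t + σ) / 2) ^ 2
      = 4 * (Real.sinh τ * (1 / (Real.cosh t + Real.cosh τ))) := by
  have h : ∀ σ ∈ Set.uIcc (-τ) τ, HasDerivAt
      (fun σ => 2 * (Real.sinh ((t + σ) / 2) / Real.cosh ((t + σ) / 2)))
      (1 / Real.cosh ((t + σ) / 2) ^ 2) σ := by
    intro σ _
    have hc := Real.cosh_pos ((t + σ) / 2)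
    have h2 : HasDerivAt (fun σ : ℝ => (t + σ) / 2) (1 / 2) σ :=
      ((hasDerivAt_id σ).const_add t).div_const 2
    refine ((h2.sinh.div h2.cosh hc.ne').const_mul 2).congr_deriv ?_
    have := Real.cosh_sq ((t + σ) / 2)
    field_simp
    linarith
  rw [intervalIntegral.integral_eq_sub_of_hasDerivAt h, cosh_add_cosh, ← sinh_half_sub t τ,
    ← sub_eq_add_neg]
  · have h1 := Real.cosh_pos ((t + τ) / 2)
    have h2 := Real.cosh_pos ((t - τ) / 2)
    field_simp
    ring
  · refine Continuous.intervalIntegrable ?_ _ _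
    refine continuous_const.div (by fun_prop) fun σ => ?_
    have := Real.cosh_pos ((t + σ) / 2)
    positivity

/-- A translate by $\sigma$ multiplies the transform of $1/\cosh^2(t/2)$ by $e^{-is\sigma}$;
integrating this factor over $[-\tau,\tau]$ gives $2\sin(\tau s)/s$. -/
theorem integral_cexp_div_cosh_add_cosh {s τ : ℝ} (hs : s ≠ 0) (hτ : 0 < τ) :
    ∫ t : ℝ, Complex.exp ((s * t : ℝ) * Complex.I) *
        ((1 / (Real.cosh t + Real.cosh τ) : ℝ) : ℂ)
      = ((2 * Real.pi * Real.sin (τ * s) / (Real.sinh τ * Real.sinh (Real.pi * s)) : ℝ) : ℂ) := by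
  set q : ℝ → ℝ := fun t => 1 / Real.cosh (t / 2) ^ 2
  have hqc : Continuous q := continuous_const.div (by fun_prop) fun t => by
    have := Real.cosh_pos (t / 2)
    positivity
  have hsτ : 0 < Real.sinh τ := Real.sinh_pos_iff.mpr hτ
  have hshift : ∀ σ : ℝ, ∫ t : ℝ, Complex.exp ((s * t : ℝ) * Complex.I) * (q (t + σ) : ℂ)
      = Complex.exp (-(s * Complex.I) * σ) *
        ((4 * Real.pi * s / Real.sinh (Real.pi * s) : ℝ) : ℂ) := by
    intro σ
    rw [← integral_cexp_div_sq_cosh hs, ← integral_const_mul,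
      ← integral_add_right_eq_self (fun t : ℝ => Complex.exp (-(s * Complex.I) * σ) *
        (Complex.exp ((s * t : ℝ) * Complex.I) * ((1 / Real.cosh (t / 2) ^ 2 : ℝ) : ℂ))) σ]
    refine integral_congr_ae (Eventually.of_forall fun t => ?_)
    simp only [q]
    rw [← mul_assoc, ← Complex.exp_add]
    congr 2
    push_cast; ring
  have hint : Integrable (Function.uncurry fun (t σ : ℝ) =>
      Complex.exp ((s * t : ℝ) * Complex.I) * (q (t + σ) : ℂ))
      ((volume : Measure ℝ).prod (volume.restrict (Set.Ioc (-τ) τ))) := by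
    refine (integrable_prod_iff' ?_).mpr ⟨Eventually.of_forall fun σ => ?_, ?_⟩
    · refine Continuous.aestronglyMeasurable ?_
      simp only [Function.uncurry_def]
      fun_prop
    · exact integrable_cexp_mul_ofReal (integrable_inv_sq_cosh.comp_add_right σ) s
    · have : ∀ σ : ℝ, ∫ t : ℝ, ‖Function.uncurry (fun (t σ : ℝ) =>
          Complex.exp ((s * t : ℝ) * Complex.I) * (q (t + σ) : ℂ)) (t, σ)‖ = ∫ t, |q t| := by
        intro σ
        rw [← integral_add_right_eq_self (fun t => |q t|) σ]
        refine integral_congr_ae (Eventually.of_forall fun t => ?_)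
        simp only [Function.uncurry]
        rw [norm_mul, Complex.norm_exp_ofReal_mul_I, one_mul, Complex.norm_real, Real.norm_eq_abs]
      simp only [this]
      exact integrable_const _
  have hswap := integral_integral_swap hint
  simp only [hshift] at hswap
  have hL : ∀ t : ℝ, ∫ σ in Set.Ioc (-τ) τ, Complex.exp ((s * t : ℝ) * Complex.I) * (q (t + σ) : ℂ)
      = (4 * Real.sinh τ : ℝ) * (Complex.exp ((s * t : ℝ) * Complex.I) *
        ((1 / (Real.cosh t + Real.cosh τ) : ℝ) : ℂ)) := by
    intro t
    rw [integral_const_mul, integral_complex_ofReal,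
      ← intervalIntegral.integral_of_le (by linarith), integral_inv_sq_cosh_add]
    push_cast; ring
  have hc0 : (-(s * Complex.I) : ℂ) ≠ 0 := by simp [hs]
  rw [integral_congr_ae (Eventually.of_forall hL), integral_const_mul, integral_mul_const,
    ← intervalIntegral.integral_of_le (by linarith), integral_exp_mul_complex hc0] at hswap
  have hsin : (Complex.exp (-(s * Complex.I) * τ) - Complex.exp (-(s * Complex.I) * (-τ : ℝ))) /
      -(s * Complex.I) = ((2 * Real.sin (τ * s) / s : ℝ) : ℂ) := by
    rw [Complex.ofReal_div, Complex.ofReal_mul, Complex.ofReal_sin, Complex.sin]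
    push_cast
    rw [show (-(s * Complex.I) * τ : ℂ) = -(τ * s) * Complex.I by ring,
      show (-(s * Complex.I) * -τ : ℂ) = (τ * s) * Complex.I by ring]
    have hsC : (s : ℂ) ≠ 0 := by exact_mod_cast hs
    have := Complex.I_ne_zero
    field_simp
    linear_combination (Complex.exp (τ * s * Complex.I) - Complex.exp (-(τ * s * Complex.I)))
      * Complex.I_sq
  rw [hsin, ← Complex.ofReal_mul] at hswap
  have h4 : ((4 * Real.sinh τ : ℝ) : ℂ) ≠ 0 := by
    have : 4 * Real.sinh τ ≠ 0 := by positivity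
    exact_mod_cast this
  refine mul_left_cancel₀ h4 (hswap.trans ?_)
  rw [← Complex.ofReal_mul]
  congr 1
  have h5 : Real.sinh (Real.pi * s) ≠ 0 := by
    rw [Ne, Real.sinh_eq_zero]; exact mul_ne_zero Real.pi_ne_zero hs
  field_simp

/-! ### The integral representation of the Macdonald function of imaginary order. -/

theorem cexp_eq_tsum (z : ℂ) : Complex.exp z = ∑' n : ℕ, z ^ n / n.factorial := by
  rw [Complex.exp_eq_exp_ℂ, NormedSpace.exp_eq_tsum_div]

theorem norm_cexp_mul_exp_neg_exp (y : ℝ) (b : ℂ) (t : ℝ) :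
    ‖Complex.exp (b * t) * (Real.exp (-(y * Real.exp t)) : ℂ)‖
      = Real.exp (b.re * t) * Real.exp (-(y * Real.exp t)) := by
  rw [norm_mul, Complex.norm_exp, Complex.norm_real, Real.norm_of_nonneg (Real.exp_pos _).le]
  congr 2
  simp

/-- $e^{-ye^t}$ is bounded by a multiple of $e^{-Nt}$ for every $N$; any $N>\mathrm{Re}\,b+1$
suffices. -/
theorem exists_norm_cexp_mul_exp_neg_exp_le {y : ℝ} (hy : 0 < y) (b : ℂ) :
    ∃ C : ℝ, ∀ t : ℝ, 0 ≤ t → ‖Complex.exp (b * t) * (Real.exp (-(y * Real.exp t)) : ℂ)‖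
      ≤ C * Real.exp (-t) := by
  obtain ⟨N, hN⟩ := exists_nat_gt (b.re + 1)
  refine ⟨N.factorial / y ^ N, fun t ht => ?_⟩
  have h1 := Real.pow_div_factorial_le_exp (y * Real.exp t) (by positivity) N
  have h2 : Real.exp (-(y * Real.exp t)) ≤ N.factorial / (y * Real.exp t) ^ N := by
    rw [Real.exp_neg, ← inv_div]
    exact inv_anti₀ (by positivity) h1
  rw [norm_cexp_mul_exp_neg_exp]
  calc _ ≤ Real.exp (b.re * t) * (N.factorial / (y * Real.exp t) ^ N) := by gcongr
    _ = N.factorial / y ^ N * Real.exp (b.re * t - N * t) := by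
      rw [mul_pow, ← Real.exp_nat_mul, Real.exp_sub]; field_simp
    _ ≤ _ := by
      gcongr
      nlinarith

theorem integrableOn_Ioi_cexp_mul_exp_neg_exp {y : ℝ} (hy : 0 < y) (b : ℂ) :
    IntegrableOn (fun t : ℝ => Complex.exp (b * t) * (Real.exp (-(y * Real.exp t)) : ℂ))
      (Set.Ioi 0) := by
  obtain ⟨C, hC⟩ := exists_norm_cexp_mul_exp_neg_exp_le hy b
  refine Integrable.mono' (g := fun t : ℝ => C * Real.exp (-t)) ?_
    (Continuous.aestronglyMeasurable (by fun_prop)) ?_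
  · have := (exp_neg_integrableOn_Ioi 0 one_pos).const_mul C
    simpa using this
  · filter_upwards [ae_restrict_mem measurableSet_Ioi] with t ht
    exact hC t (le_of_lt ht)

theorem integrableOn_Iic_cexp {b : ℂ} (hb : 0 < b.re) :
    IntegrableOn (fun t : ℝ => Complex.exp (b * t)) (Set.Iic 0) :=
  integrableOn_exp_mul_complex_Iic hb 0

theorem hasSum_integral_Iic {y : ℝ} (hy : 0 < y) {b : ℂ} (hb : 0 < b.re) :
    HasSum (fun k : ℕ => (-y : ℂ) ^ k / k.factorial * (1 / (b + k)))
      (∫ t in Set.Iic (0 : ℝ), Complex.exp (b * t) * (Real.exp (-(y * Real.exp t)) : ℂ)) := by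
  set F : ℕ → ℝ → ℂ := fun k t => (-y : ℂ) ^ k / k.factorial * Complex.exp ((b + k) * t)
  have hk : ∀ k : ℕ, 0 < (b + k).re := fun k => by
    have : (0 : ℝ) ≤ k := k.cast_nonneg
    simp; linarith
  have hFi : ∀ k, IntegrableOn (F k) (Set.Iic 0) := fun k =>
    (integrableOn_Iic_cexp (hk k)).const_mul _
  have hFn : ∀ k t, F k t = Complex.exp (b * t) *
      ((-y * Complex.exp t) ^ k / k.factorial) := by
    intro k t
    simp only [F]
    rw [add_mul, Complex.exp_add, mul_pow, ← Complex.exp_nat_mul]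
    ring
  have hs : Summable fun k => ∫ t in Set.Iic (0 : ℝ), ‖F k t‖ := by
    refine Summable.of_nonneg_of_le (fun n => integral_nonneg fun x => norm_nonneg _)
        (fun n => ?_) ((Real.summable_pow_div_factorial y).mul_right
          (∫ t in Set.Iic (0 : ℝ), ‖Complex.exp (b * t)‖))
    rw [← integral_const_mul]
    refine setIntegral_mono_on (hFi n).norm ((integrableOn_Iic_cexp hb).norm.const_mul _)
      measurableSet_Iic fun t (ht : t ≤ 0) => ?_
    rw [hFn, norm_mul, mul_comm]
    gcongr
    rw [norm_div, norm_pow, norm_mul, norm_neg, Complex.norm_real, Complex.norm_natCast,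
      Real.norm_of_nonneg hy.le, ← Complex.ofReal_exp, Complex.norm_real,
      Real.norm_of_nonneg (Real.exp_pos _).le]
    gcongr
    exact mul_le_of_le_one_right hy.le (Real.exp_le_one_iff.mpr ht)
  have h := hasSum_integral_of_summable_integral_norm hFi hs
  have e1 : (fun k : ℕ => (-y : ℂ) ^ k / k.factorial * (1 / (b + k)))
      = fun k => ∫ t in Set.Iic (0 : ℝ), F k t := by
    funext k
    simp only [F]
    rw [integral_const_mul, integral_exp_mul_complex_Iic (hk k)]
    simp
  have e2 : ∫ t in Set.Iic (0 : ℝ), Complex.exp (b * t) * (Real.exp (-(y * Real.exp t)) : ℂ)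
      = ∫ t in Set.Iic (0 : ℝ), ∑' k, F k t := by
    refine integral_congr_ae (Eventually.of_forall fun t => ?_)
    simp only [hFn]
    rw [tsum_mul_left, ← cexp_eq_tsum]
    push_cast
    rw [neg_mul]
  rw [e1, e2]
  exact h

theorem integral_cexp_mul_exp_neg_exp {y : ℝ} (hy : 0 < y) {b : ℂ} (hb : 0 < b.re) :
    ∫ t : ℝ, Complex.exp (b * t) * (Real.exp (-(y * Real.exp t)) : ℂ)
      = (y : ℂ) ^ (-b) * Complex.Gamma b := by
  have h := Complex.integral_cpow_mul_exp_neg_mul_Ioi (a := b) (r := y) hb (by simpa using hy)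
  rw [← Real.range_exp, ← Set.image_univ, integral_image_eq_integral_abs_deriv_smul
      MeasurableSet.univ (fun x _ => (Real.hasDerivAt_exp x).hasDerivWithinAt)
        Real.exp_injective.injOn, setIntegral_univ] at h
  rw [Complex.cpow_neg, ← Complex.inv_cpow _ _ (by rw [Complex.arg_ofReal_of_nonneg hy.le]; exact
    Real.pi_ne_zero.symm), ← one_div, ← h]
  refine integral_congr_ae (Eventually.of_forall fun t => ?_)
  simp only
  rw [abs_of_pos (Real.exp_pos t), Complex.real_smul, ← mul_assoc, ← Complex.ofReal_mul,
    ← Complex.ofReal_neg, ← Complex.ofReal_exp (-(y * _))]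
  congr 1
  rw [Complex.cpow_def_of_ne_zero (by exact_mod_cast (Real.exp_pos t).ne'),
    ← Complex.ofReal_log (Real.exp_pos t).le, Real.log_exp, Complex.ofReal_exp, ← Complex.exp_add]
  congr 1
  ring

/-- The upper incomplete integral `∫₀^∞ e^{bt - y e^t} dt`. -/
noncomputable def upperE (y : ℝ) (b : ℂ) : ℂ :=
  ∫ t in Set.Ioi (0 : ℝ), Complex.exp (b * t) * (Real.exp (-(y * Real.exp t)) : ℂ)

/-- The lower series `∑ (-y)^k / (k! (b + k))`. -/
noncomputable def lowerSeries (y : ℝ) (b : ℂ) : ℂ :=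
  ∑' k : ℕ, (-y : ℂ) ^ k / k.factorial * (1 / (b + k))

/-- Integration by parts: $e^{bt-ye^t}$ equals $e^{-y}$ at $t=0$ and tends to 0 at infinity. -/
theorem mul_upperE {y : ℝ} (hy : 0 < y) (b : ℂ) :
    b * upperE y b = y * upperE y (b + 1) - (Real.exp (-y) : ℂ) := by
  set f : ℝ → ℂ := fun t => Complex.exp (b * t) * (Real.exp (-(y * Real.exp t)) : ℂ)
  have hd : ∀ t : ℝ, HasDerivAt f (b * (Complex.exp (b * t) * (Real.exp (-(y * Real.exp t)) : ℂ))
      - y * (Complex.exp ((b + 1) * t) * (Real.exp (-(y * Real.exp t)) : ℂ))) t := by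
    intro t
    have h1 : HasDerivAt (fun t : ℝ => Complex.exp (b * t)) (Complex.exp (b * t) * b) t := by
      have h0 : HasDerivAt (fun t : ℝ => b * (t : ℂ)) b t := by
        simpa using (Complex.ofRealCLM.hasDerivAt (x := t)).const_mul b
      exact h0.cexp
    have h2 : HasDerivAt (fun t : ℝ => (Real.exp (-(y * Real.exp t)) : ℂ))
        ((Real.exp (-(y * Real.exp t)) * -(y * Real.exp t) : ℝ) : ℂ) t :=
      ((Real.hasDerivAt_exp t).const_mul y).neg.exp.ofReal_comp
    refine (h1.mul h2).congr_deriv ?_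
    rw [add_mul, Complex.exp_add]
    push_cast
    ring_nf
  have hi1 := (integrableOn_Ioi_cexp_mul_exp_neg_exp hy b).const_mul b
  have hi2 := (integrableOn_Ioi_cexp_mul_exp_neg_exp hy (b + 1)).const_mul (y : ℂ)
  have ht : Tendsto f atTop (𝓝 0) := by
    obtain ⟨C, hC⟩ := exists_norm_cexp_mul_exp_neg_exp_le hy b
    refine squeeze_zero_norm' (a := fun t => C * Real.exp (-t)) ?_ ?_
    · filter_upwards [eventually_ge_atTop 0] with t ht using hC t ht
    · simpa using (Real.tendsto_exp_neg_atTop_nhds_zero).const_mul C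
  have := integral_Ioi_of_hasDerivAt_of_tendsto' (a := 0) (fun t _ => hd t) (hi1.sub hi2) ht
  rw [integral_sub hi1 hi2, integral_const_mul, integral_const_mul] at this
  have h0 : f 0 = (Real.exp (-y) : ℂ) := by simp [f]
  rw [h0] at this
  simp only [upperE]
  linear_combination this

theorem summable_lowerSeries (y : ℝ) {b : ℂ} (hb : b.im ≠ 0) :
    Summable fun k : ℕ => (-y : ℂ) ^ k / k.factorial * (1 / (b + k)) := by
  refine Summable.of_norm_bounded ((Real.summable_pow_div_factorial |y|).mul_right (1 / |b.im|))
    fun k => ?_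
  rw [norm_mul, norm_div, norm_div, norm_pow, norm_neg, Complex.norm_real, Complex.norm_natCast,
    Real.norm_eq_abs, norm_one]
  have h1 : 0 < |b.im| := abs_pos.mpr hb
  have h2 : |b.im| ≤ ‖b + k‖ := by
    simpa using Complex.abs_im_le_norm (b + k)
  gcongr

theorem mul_lowerSeries (y : ℝ) {b : ℂ} (hb : b.im ≠ 0) :
    b * lowerSeries y b = (Real.exp (-y) : ℂ) + y * lowerSeries y (b + 1) := by
  have hne : ∀ k : ℕ, b + k ≠ 0 := fun k h => hb (by simpa using congrArg Complex.im h)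
  have h1 := (summable_lowerSeries y hb).mul_left b
  have hexp : (Real.exp (-y) : ℂ) = ∑' k : ℕ, (-y : ℂ) ^ k / k.factorial := by
    rw [← cexp_eq_tsum]; push_cast; rfl
  have hse : Summable fun k : ℕ => (-y : ℂ) ^ k / k.factorial :=
    NormedSpace.expSeries_div_summable (-y : ℂ)
  have h2 : Summable fun k : ℕ => -(k : ℂ) * ((-y : ℂ) ^ k / k.factorial * (1 / (b + k))) := by
    refine (h1.sub hse).congr fun k => ?_
    have := hne k
    field_simp
    ring
  have h3 : b * lowerSeries y b = (Real.exp (-y) : ℂ) +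
      ∑' k : ℕ, -(k : ℂ) * ((-y : ℂ) ^ k / k.factorial * (1 / (b + k))) := by
    rw [hexp, ← hse.tsum_add h2, lowerSeries, ← tsum_mul_left]
    refine tsum_congr fun k => ?_
    have := hne k
    field_simp
    ring
  rw [h3, h2.tsum_eq_zero_add, lowerSeries, ← tsum_mul_left]
  simp only [Nat.cast_zero, neg_zero, zero_mul, zero_add]
  congr 1
  refine tsum_congr fun k => ?_
  have h4 := hne (k + 1)
  have h5 : b + 1 + k ≠ 0 := by
    rw [add_right_comm, add_assoc]; exact_mod_cast h4
  have h6 : (k : ℂ) + 1 ≠ 0 := by exact_mod_cast k.succ_ne_zero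
  rw [Nat.factorial_succ, pow_succ]
  push_cast at h4 ⊢
  field_simp
  ring

/-- For $\mathrm{Re}\,b>0$ this is the Gamma integral split at $t=0$, the lower half being expanded
in powers of $y$. Both sides obey the same recurrence relating $b$ to $b+1$, which carries the
identity leftwards; $\mathrm{Im}\,b\ne0$ keeps away from the poles. -/
theorem upperE_eq {y : ℝ} (hy : 0 < y) {b : ℂ} (hb : b.im ≠ 0) :
    upperE y b = (y : ℂ) ^ (-b) * Complex.Gamma b - lowerSeries y b := by
  have main : ∀ n : ℕ, ∀ b : ℂ, b.im ≠ 0 → -(n : ℝ) < b.re →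
      upperE y b = (y : ℂ) ^ (-b) * Complex.Gamma b - lowerSeries y b := by
    intro n
    induction n with
    | zero =>
      intro b hb hre
      have hre' : 0 < b.re := by simpa using hre
      rw [← integral_cexp_mul_exp_neg_exp hy hre', lowerSeries,
        (hasSum_integral_Iic hy hre').tsum_eq, upperE, eq_sub_iff_add_eq']
      refine intervalIntegral.integral_Iic_add_Ioi ?_ (integrableOn_Ioi_cexp_mul_exp_neg_exp hy b)
      refine (integrableOn_Iic_cexp hre').norm.mono' (Continuous.aestronglyMeasurable (by fun_prop))
        (Eventually.of_forall fun t => ?_)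
      rw [norm_mul]
      refine mul_le_of_le_one_right (norm_nonneg _) ?_
      rw [Complex.norm_real, Real.norm_of_nonneg (Real.exp_pos _).le, Real.exp_le_one_iff]
      have := Real.exp_pos t
      nlinarith
    | succ n ih =>
      intro b hb hre
      have h0 : b ≠ 0 := fun h => hb (by simp [h])
      have h1 := ih (b + 1) (by simpa using hb) (by push_cast at hre; simp; linarith)
      refine mul_left_cancel₀ h0 ?_
      have hyC : (y : ℂ) ≠ 0 := by exact_mod_cast hy.ne'
      rw [mul_upperE hy, h1, mul_sub b, mul_lowerSeries y hb, Complex.Gamma_add_one b h0, neg_add,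
        Complex.cpow_add _ _ hyC, Complex.cpow_neg_one]
      field_simp
      ring
  obtain ⟨n, hn⟩ := exists_nat_gt (-b.re)
  exact main n b hb (by linarith)

theorem exp_neg_two_mul_cosh (y t : ℝ) : Real.exp (-(2 * y * Real.cosh t))
    = Real.exp (-(y * Real.exp t)) * Real.exp (-(y * Real.exp (-t))) := by
  rw [← Real.exp_add, Real.cosh_eq]; congr 1; ring

/-- Since $2y\cosh t=ye^t+ye^{-t}$, the factor $e^{-ye^{-t}}$ can be expanded in powers; on $t>0$
the $m$-th term is at most $y^m/m!$, so summation and integration commute. -/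
theorem hasSum_integral_Ioi_cexp_mul_cosh {y : ℝ} (hy : 0 < y) (a : ℂ) :
    HasSum (fun m : ℕ => (-y : ℂ) ^ m / m.factorial * upperE y (a - m))
      (∫ t in Set.Ioi (0 : ℝ), Complex.exp (a * t) * (Real.exp (-(2 * y * Real.cosh t)) : ℂ)) := by
  set g : ℝ → ℂ := fun t => Complex.exp (a * t) * (Real.exp (-(y * Real.exp t)) : ℂ)
  have hg : IntegrableOn g (Set.Ioi 0) := integrableOn_Ioi_cexp_mul_exp_neg_exp hy a
  set F : ℕ → ℝ → ℂ := fun m t => (-y : ℂ) ^ m / m.factorial *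
    (Complex.exp ((a - m) * t) * (Real.exp (-(y * Real.exp t)) : ℂ))
  have hFi : ∀ m, IntegrableOn (F m) (Set.Ioi 0) := fun m =>
    (integrableOn_Ioi_cexp_mul_exp_neg_exp hy (a - m)).const_mul _
  have hFn : ∀ m t, F m t = g t * ((-y * Complex.exp (-t)) ^ m / m.factorial) := by
    intro m t
    simp only [F, g]
    rw [sub_mul, Complex.exp_sub, mul_pow, ← Complex.exp_nat_mul, mul_neg, Complex.exp_neg]
    ring
  have hs : Summable fun m => ∫ t in Set.Ioi (0 : ℝ), ‖F m t‖ := by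
    refine Summable.of_nonneg_of_le (fun n => integral_nonneg fun x => norm_nonneg _)
        (fun n => ?_) ((Real.summable_pow_div_factorial y).mul_right
          (∫ t in Set.Ioi (0 : ℝ), ‖g t‖))
    rw [← integral_const_mul]
    refine setIntegral_mono_on (hFi n).norm (hg.norm.const_mul _)
      measurableSet_Ioi fun t (ht : 0 < t) => ?_
    rw [hFn, norm_mul, mul_comm]
    gcongr
    rw [norm_div, norm_pow, norm_mul, norm_neg, Complex.norm_real, Complex.norm_natCast,
      Real.norm_of_nonneg hy.le, ← Complex.ofReal_neg, ← Complex.ofReal_exp, Complex.norm_real,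
      Real.norm_of_nonneg (Real.exp_pos _).le]
    gcongr
    exact mul_le_of_le_one_right hy.le (Real.exp_le_one_iff.mpr (by linarith))
  have h := hasSum_integral_of_summable_integral_norm hFi hs
  have e1 : (fun m : ℕ => (-y : ℂ) ^ m / m.factorial * upperE y (a - m))
      = fun m => ∫ t in Set.Ioi (0 : ℝ), F m t := by
    funext k
    simp only [F]
    rw [integral_const_mul, upperE]
  have e2 : ∫ t in Set.Ioi (0 : ℝ), Complex.exp (a * t) * (Real.exp (-(2 * y * Real.cosh t)) : ℂ)
      = ∫ t in Set.Ioi (0 : ℝ), ∑' k, F k t := by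
    refine integral_congr_ae (Eventually.of_forall fun t => ?_)
    simp only [hFn]
    rw [tsum_mul_left, ← cexp_eq_tsum, exp_neg_two_mul_cosh]
    simp only [g]
    push_cast
    rw [neg_mul, mul_assoc]
  rw [e1, e2]
  exact h

theorem summable_double {y : ℝ} (hy : 0 < y) {a : ℂ} (ha : a.im ≠ 0) :
    Summable fun p : ℕ × ℕ => (-y : ℂ) ^ p.1 / p.1.factorial *
      ((-y : ℂ) ^ p.2 / p.2.factorial * (1 / (a - p.1 + p.2))) := by
  have hs := Real.summable_pow_div_factorial y
  refine Summable.of_norm_bounded ((hs.mul_of_nonneg (hs.mul_right (1 / |a.im|))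
    (fun k => by positivity) (fun k => by positivity))) fun p => ?_
  have h1 : 0 < |a.im| := abs_pos.mpr ha
  have h2 : |a.im| ≤ ‖a - p.1 + p.2‖ := by
    simpa using Complex.abs_im_le_norm (a - p.1 + p.2)
  simp only [norm_mul, norm_div, norm_pow, norm_neg, Complex.norm_real, Complex.norm_natCast,
    Real.norm_of_nonneg hy.le, norm_one]
  gcongr

/-- The series of Gamma functions in the expansion of the Macdonald function. -/
noncomputable def gammaSeries (y : ℝ) (a : ℂ) : ℂ :=
  ∑' m : ℕ, (-y : ℂ) ^ m / m.factorial * ((y : ℂ) ^ (-(a - m)) * Complex.Gamma (a - m))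

theorem integral_Ioi_cexp_mul_cosh {y : ℝ} (hy : 0 < y) {a : ℂ} (ha : a.im ≠ 0) :
    ∫ t in Set.Ioi (0 : ℝ), Complex.exp (a * t) * (Real.exp (-(2 * y * Real.cosh t)) : ℂ)
      = gammaSeries y a - ∑' p : ℕ × ℕ, (-y : ℂ) ^ p.1 / p.1.factorial *
      ((-y : ℂ) ^ p.2 / p.2.factorial * (1 / (a - p.1 + p.2))) := by
  have him : ∀ m : ℕ, (a - m).im ≠ 0 := fun m => by simpa using ha
  have h1 := hasSum_integral_Ioi_cexp_mul_cosh hy a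
  have h2 := summable_double hy ha
  have h3 : Summable fun m : ℕ => (-y : ℂ) ^ m / m.factorial * lowerSeries y (a - m) := by
    refine h2.prod.congr fun m => ?_
    rw [lowerSeries, ← tsum_mul_left]
  have h4 : Summable fun m : ℕ => (-y : ℂ) ^ m / m.factorial *
      ((y : ℂ) ^ (-(a - m)) * Complex.Gamma (a - m)) := by
    refine (h1.summable.add h3).congr fun m => ?_
    rw [upperE_eq hy (him m)]
    ring
  rw [← h1.tsum_eq, h2.tsum_prod, gammaSeries]
  simp only [tsum_mul_left]
  change _ = _ - ∑' m : ℕ, (-y : ℂ) ^ m / m.factorial * lowerSeries y (a - m)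
  rw [← h4.tsum_sub h3]
  refine tsum_congr fun m => ?_
  rw [upperE_eq hy (him m)]
  ring

theorem integrable_cexp_mul_cosh {y : ℝ} (hy : 0 < y) (s : ℝ) :
    Integrable fun t : ℝ => Complex.exp (Complex.I * s * t) *
      (Real.exp (-(2 * y * Real.cosh t)) : ℂ) := by
  refine (integrable_cexp_mul_ofReal (integrable_exp_neg_mul_cosh (x := 2 * y) (by positivity))
    s).congr (Eventually.of_forall fun t => ?_)
  simp only
  congr 2
  push_cast; ring

theorem integral_cexp_mul_cosh {y s : ℝ} (hy : 0 < y) (hs : s ≠ 0) :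
    ∫ t : ℝ, Complex.exp (Complex.I * s * t) * (Real.exp (-(2 * y * Real.cosh t)) : ℂ)
      = gammaSeries y (Complex.I * s) + gammaSeries y (-(Complex.I * s)) := by
  have hi := integrable_cexp_mul_cosh hy s
  have h1 := integral_Ioi_cexp_mul_cosh hy (a := Complex.I * s) (by simpa using hs)
  have h2 := integral_Ioi_cexp_mul_cosh hy (a := -(Complex.I * s)) (by simpa using hs)
  rw [← intervalIntegral.integral_Iic_add_Ioi (b := 0) hi.integrableOn hi.integrableOn, h1,
    ← neg_zero, ← integral_comp_neg_Ioi]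
  have h3 : ∫ t in Set.Ioi (0 : ℝ), Complex.exp (Complex.I * s * (-t : ℝ)) *
      (Real.exp (-(2 * y * Real.cosh (-t))) : ℂ) = ∫ t in Set.Ioi (0 : ℝ),
        Complex.exp (-(Complex.I * s) * t) * (Real.exp (-(2 * y * Real.cosh t)) : ℂ) := by
    refine integral_congr_ae (Eventually.of_forall fun t => ?_)
    simp only [Real.cosh_neg]
    congr 2
    push_cast; ring
  rw [h3, h2]
  -- Exchanging the two summation indices shows that the double series is odd in $a=is$, so the
  -- contributions of the two half-lines cancel and only the Gamma series remain.
  have h4 : ∑' p : ℕ × ℕ, (-y : ℂ) ^ p.1 / p.1.factorial *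
        ((-y : ℂ) ^ p.2 / p.2.factorial * (1 / (-(Complex.I * s) - p.1 + p.2)))
      = - ∑' p : ℕ × ℕ, (-y : ℂ) ^ p.1 / p.1.factorial *
        ((-y : ℂ) ^ p.2 / p.2.factorial * (1 / (Complex.I * s - p.1 + p.2))) := by
    rw [← tsum_neg, ← (Equiv.prodComm ℕ ℕ).tsum_eq]
    refine tsum_congr fun p => ?_
    simp only [Equiv.prodComm_apply, Prod.fst_swap, Prod.snd_swap]
    rw [show (-(Complex.I * s) - p.2 + p.1 : ℂ) = -(Complex.I * s - p.1 + p.2) by ring, div_neg]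
    ring
  rw [h4]
  ring

/-- The reflection formula at $a-m$ produces a sign $(-1)^m$, which cancels the one in $(-y)^m$. -/
theorem gammaSeries_eq {y : ℝ} (hy : 0 < y) {a : ℂ} (ha : a.im ≠ 0) :
    gammaSeries y a = Real.pi / Complex.sin (a * Real.pi) * besselI (-a) (2 * y : ℝ) := by
  rw [gammaSeries, besselI, ← tsum_mul_left]
  refine tsum_congr fun m => ?_
  have hyC : (y : ℂ) ≠ 0 := by exact_mod_cast hy.ne'
  have hG : Complex.Gamma (m + -a + 1) ≠ 0 := Complex.Gamma_ne_zero fun n h => ha (by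
    simpa using congrArg Complex.im h)
  have hrefl := Complex.Gamma_mul_Gamma_one_sub (a - m)
  rw [show (1 - (a - m) : ℂ) = m + -a + 1 by ring,
    show (Real.pi * (a - m) : ℂ) = a * Real.pi - m * Real.pi by ring,
    Complex.sin_antiperiodic.sub_nat_mul_eq] at hrefl
  have hG' : Complex.Gamma (a - m) = (-1) ^ m * (Real.pi / Complex.sin (a * Real.pi))
      / Complex.Gamma (m + -a + 1) := by
    rw [eq_div_iff hG, hrefl, div_mul_eq_div_div_swap, mul_comm ((-1 : ℂ) ^ m),
      div_eq_mul_inv _ ((-1 : ℂ) ^ m)]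
    congr 1
    rw [← inv_pow]; norm_num
  rw [hG', neg_pow, show (((2 * y : ℝ) : ℂ) / 2) = y by push_cast; field_simp,
    show (2 * m + -a : ℂ) = (-(a - m)) + m by ring, Complex.cpow_add _ _ hyC, Complex.cpow_natCast]
  have h1 : ((-1 : ℂ) ^ m) * (-1) ^ m = 1 := by rw [← mul_pow]; norm_num
  linear_combination ((y : ℂ) ^ m / m.factorial * (y : ℂ) ^ (-(a - m)) *
    (Real.pi / Complex.sin (a * Real.pi)) / Complex.Gamma (m + -a + 1)) * h1

theorem sin_I_mul_pi (s : ℝ) : Complex.sin (Complex.I * s * Real.pi)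
    = Real.sinh (Real.pi * s) * Complex.I := by
  rw [show (Complex.I * s * Real.pi : ℂ) = ((Real.pi * s : ℝ) : ℂ) * Complex.I by
      push_cast; ring, Complex.sin_mul_I, Complex.ofReal_sinh]

/-- The integral representation of the Macdonald function of imaginary order. -/
theorem macdonaldK_eq_integral {s x : ℝ} (hs : s ≠ 0) (hx : 0 < x) :
    macdonaldK (Complex.I * s) x = 1 / 2 * ∫ t : ℝ, Complex.exp ((s * t : ℝ) * Complex.I) *
      (Real.exp (-(x * Real.cosh t)) : ℂ) := by
  have hsin : Complex.sin (Complex.I * s * Real.pi) ≠ 0 := by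
    rw [sin_I_mul_pi]
    have : Real.sinh (Real.pi * s) ≠ 0 := by
      rw [Ne, Real.sinh_eq_zero]; exact mul_ne_zero Real.pi_ne_zero hs
    exact mul_ne_zero (by exact_mod_cast this) Complex.I_ne_zero
  have h := integral_cexp_mul_cosh (y := x / 2) (s := s) (by positivity) hs
  rw [gammaSeries_eq (by positivity) (by simpa using hs),
    gammaSeries_eq (by positivity) (by simpa using hs), mul_div_cancel₀ x two_ne_zero] at h
  rw [macdonaldK, if_neg hsin, macdonaldQuotient]
  have e : ∫ t : ℝ, Complex.exp ((s * t : ℝ) * Complex.I) * (Real.exp (-(x * Real.cosh t)) : ℂ)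
      = ∫ t : ℝ, Complex.exp (Complex.I * s * t) * (Real.exp (-(x * Real.cosh t)) : ℂ) := by
    refine integral_congr_ae (Eventually.of_forall fun t => ?_)
    simp only
    congr 2
    push_cast; ring
  rw [e, h, neg_neg, neg_mul, Complex.sin_neg]
  field_simp
  ring

/-! ### The Bessel functions as functions of the order, and the recurrence of part (a). -/

/-- Up to $m=N\ge R$ the arguments stay in a compact ball, on which the entire function $1/\Gamma$
is bounded. Beyond it $|m+\nu+1|\ge1$, so $|1/\Gamma(m+\nu+1)|$ does not increase with $m$. -/
theorem exists_norm_inv_Gamma_le (R : ℝ) :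
    ∃ C : ℝ, ∀ m : ℕ, ∀ ν : ℂ, ‖ν‖ ≤ R → ‖(Complex.Gamma (m + ν + 1))⁻¹‖ ≤ C := by
  obtain ⟨N, hN⟩ := exists_nat_ge R
  obtain ⟨C, hC⟩ := (isCompact_closedBall (0 : ℂ) (R + N + 1)).exists_bound_of_continuousOn
    Complex.differentiable_one_div_Gamma.continuous.continuousOn
  have small : ∀ m : ℕ, m ≤ N → ∀ ν : ℂ, ‖ν‖ ≤ R → ‖(Complex.Gamma (m + ν + 1))⁻¹‖ ≤ C := by
    intro m hm ν hν
    refine hC _ ?_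
    rw [mem_closedBall_zero_iff]
    have h1 : (m : ℝ) ≤ N := by exact_mod_cast hm
    calc ‖(m : ℂ) + ν + 1‖ ≤ ‖(m : ℂ)‖ + ‖ν‖ + ‖(1 : ℂ)‖ := norm_add₃_le
      _ ≤ R + N + 1 := by rw [Complex.norm_natCast, norm_one]; linarith
  refine ⟨C, fun m => ?_⟩
  rcases le_total m N with hm | hm
  · exact small m hm
  · induction m, hm using Nat.le_induction with
    | base => exact small N le_rfl
    | succ m hm ih =>
      intro ν hν
      have h1 : (N : ℝ) ≤ m := by exact_mod_cast hm
      have h2 : 1 ≤ ‖(m : ℂ) + ν + 1‖ := by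
        have := norm_sub_norm_le ((m : ℂ) + 1) (-ν)
        rw [norm_neg, sub_neg_eq_add] at this
        have h3 : ‖(m : ℂ) + 1‖ = m + 1 := by exact_mod_cast Complex.norm_natCast (m + 1)
        rw [h3, show (m : ℂ) + 1 + ν = m + ν + 1 by ring] at this
        linarith
      have h4 := Complex.one_div_Gamma_eq_self_mul_one_div_Gamma_add_one ((m : ℂ) + ν + 1)
      have h5 := ih ν hν
      rw [h4, norm_mul] at h5
      have h6 : (((m + 1 : ℕ) : ℂ) + ν + 1) = m + ν + 1 + 1 := by push_cast; ring
      rw [h6]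
      nlinarith [norm_nonneg (Complex.Gamma (m + ν + 1 + 1))⁻¹]

theorem exists_norm_besselI_term_le {z : ℂ} (hz : z ≠ 0) (R : ℝ) :
    ∃ u : ℕ → ℝ, Summable u ∧ ∀ m : ℕ, ∀ ν : ℂ, ‖ν‖ ≤ R →
      ‖(z / 2) ^ (2 * (m : ℂ) + ν) / ((m.factorial : ℂ) * Complex.Gamma ((m : ℂ) + ν + 1))‖
        ≤ u m := by
  have hz2 : z / 2 ≠ 0 := div_ne_zero hz two_ne_zero
  obtain ⟨C, hC⟩ := exists_norm_inv_Gamma_le R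
  obtain ⟨D, hD⟩ := (isCompact_closedBall (0 : ℂ) R).exists_bound_of_continuousOn
    (f := fun ν : ℂ => (z / 2) ^ ν) (Continuous.const_cpow continuous_id (Or.inl hz2)).continuousOn
  refine ⟨fun m => (‖z / 2‖ ^ 2) ^ m / m.factorial * (D * C),
    (Real.summable_pow_div_factorial _).mul_right _, fun m ν hν => ?_⟩
  have h1 := hD ν (mem_closedBall_zero_iff.mpr hν)
  have h2 := hC m ν hν
  have h3 : (z / 2) ^ (2 * (m : ℂ)) = ((z / 2) ^ 2) ^ m := by
    rw [← pow_mul]; exact_mod_cast Complex.cpow_natCast (z / 2) (2 * m)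
  rw [Complex.cpow_add _ _ hz2, h3, div_eq_mul_inv, mul_inv, norm_mul, norm_mul, norm_mul,
    norm_pow, norm_pow, norm_inv (m.factorial : ℂ), Complex.norm_natCast]
  have h4 : 0 ≤ D := (norm_nonneg _).trans h1
  calc _ = (‖z / 2‖ ^ 2) ^ m / m.factorial * (‖(z / 2) ^ ν‖ * ‖(Complex.Gamma (m + ν + 1))⁻¹‖) := by
        ring
    _ ≤ _ := mul_le_mul_of_nonneg_left (mul_le_mul h1 h2 (norm_nonneg _) h4) (by positivity)

theorem summable_besselI {z : ℂ} (hz : z ≠ 0) (ν : ℂ) : Summable fun m : ℕ =>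
    (z / 2) ^ (2 * (m : ℂ) + ν) / ((m.factorial : ℂ) * Complex.Gamma ((m : ℂ) + ν + 1)) := by
  obtain ⟨u, hu, h⟩ := exists_norm_besselI_term_le hz ‖ν‖
  exact Summable.of_norm_bounded hu fun m => h m ν le_rfl

theorem differentiable_besselI {z : ℂ} (hz : z ≠ 0) : Differentiable ℂ fun ν => besselI ν z := by
  have hz2 : z / 2 ≠ 0 := div_ne_zero hz two_ne_zero
  intro ν
  obtain ⟨u, hu, h⟩ := exists_norm_besselI_term_le hz (‖ν‖ + 1)
  have := Complex.differentiableOn_tsum_of_summable_norm (U := Metric.ball (0 : ℂ) (‖ν‖ + 1)) hu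
    (F := fun (m : ℕ) (ν : ℂ) =>
      (z / 2) ^ (2 * (m : ℂ) + ν) / ((m.factorial : ℂ) * Complex.Gamma ((m : ℂ) + ν + 1)))
    (fun m => ?_) Metric.isOpen_ball
    (fun m w hw => h m w (le_of_lt (mem_ball_zero_iff.mp hw)))
  · exact this.differentiableAt (Metric.isOpen_ball.mem_nhds (mem_ball_zero_iff.mpr (by linarith)))
  · refine Differentiable.differentiableOn ?_
    simp only [div_eq_mul_inv, mul_inv]
    refine Differentiable.mul ?_ ((differentiable_const _).mul ?_)
    · refine Differentiable.const_cpow (by fun_prop) (Or.inl ?_)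
      rwa [div_eq_mul_inv] at hz2
    · exact Complex.differentiable_one_div_Gamma.comp (f := fun ν : ℂ => (m : ℂ) + ν + 1)
        (by fun_prop)

/-- In $I_{\nu-1}$ write $1/\Gamma(m+\nu)=(m+\nu)/\Gamma(m+\nu+1)$. The summand $\nu$ gives
$\frac{2\nu}zI_\nu$; the factor $m$ removes the zeroth term, and shifting the index leaves
$I_{\nu+1}$. This holds at the poles as well, because the inverse of the default value 0 is 0. -/
theorem besselI_sub {z : ℂ} (hz : z ≠ 0) (ν : ℂ) :
    besselI (ν - 1) z - besselI (ν + 1) z = 2 * ν / z * besselI ν z := by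
  have hz2 : z / 2 ≠ 0 := div_ne_zero hz two_ne_zero
  have s1 := summable_besselI hz (ν - 1)
  have s2 := (summable_besselI hz ν).mul_left (2 * ν / z)
  have key : ∀ m : ℕ, (z / 2) ^ (2 * (m : ℂ) + (ν - 1)) /
      ((m.factorial : ℂ) * Complex.Gamma ((m : ℂ) + (ν - 1) + 1)) - 2 * ν / z *
      ((z / 2) ^ (2 * (m : ℂ) + ν) / ((m.factorial : ℂ) * Complex.Gamma ((m : ℂ) + ν + 1)))
      = m * ((z / 2) ^ (2 * (m : ℂ) + (ν - 1)) / m.factorial *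
        (Complex.Gamma ((m : ℂ) + ν + 1))⁻¹) := by
    intro m
    have h1 := Complex.one_div_Gamma_eq_self_mul_one_div_Gamma_add_one ((m : ℂ) + ν)
    have h2 : (z / 2) ^ (2 * (m : ℂ) + ν) = (z / 2) ^ (2 * (m : ℂ) + (ν - 1)) * (z / 2) := by
      rw [show (2 * (m : ℂ) + ν) = 2 * m + (ν - 1) + 1 by ring, Complex.cpow_add _ 1 hz2,
        Complex.cpow_one]
    rw [h2, show (m : ℂ) + (ν - 1) + 1 = m + ν by ring, div_eq_mul_inv, mul_inv, h1]
    field_simp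
    ring
  have h3 : besselI (ν - 1) z - 2 * ν / z * besselI ν z = besselI (ν + 1) z := by
    rw [besselI, besselI, besselI, ← tsum_mul_left, ← s1.tsum_sub s2]
    have s3 := s1.sub s2
    rw [tsum_congr key]
    rw [(s3.congr key).tsum_eq_zero_add]
    simp only [Nat.cast_zero, zero_mul, zero_add]
    refine tsum_congr fun m => ?_
    have h6 : (m : ℂ) + 1 ≠ 0 := by exact_mod_cast m.succ_ne_zero
    rw [Nat.factorial_succ]
    push_cast
    rw [show (2 * ((m : ℂ) + 1) + (ν - 1)) = 2 * m + (ν + 1) by ring,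
      show (m : ℂ) + 1 + ν + 1 = m + (ν + 1) + 1 by ring]
    field_simp
  linear_combination h3

/-- Two-step induction: the recurrence at order 0 gives $I_{-1}=I_1$, and the recurrences at $n+1$
and $-(n+1)$ climb from there. -/
theorem besselI_neg_nat {z : ℂ} (hz : z ≠ 0) (n : ℕ) : besselI (-n) z = besselI n z := by
  have main : ∀ n : ℕ, besselI (-n) z = besselI n z ∧
      besselI (-(n + 1 : ℕ)) z = besselI (n + 1 : ℕ) z := by
    intro n
    induction n with
    | zero =>
      refine ⟨by simp, ?_⟩
      have := besselI_sub hz 0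
      simp only [zero_sub, zero_add, mul_zero, zero_div, zero_mul] at this
      simp only [zero_add, Nat.cast_one]
      exact sub_eq_zero.mp this
    | succ n ih =>
      refine ⟨ih.2, ?_⟩
      have h1 := besselI_sub hz ((n : ℂ) + 1)
      have h2 := besselI_sub hz (-((n : ℂ) + 1))
      obtain ⟨i1, i2⟩ := ih
      push_cast at i2 ⊢
      rw [add_sub_cancel_right] at h1
      rw [show -((n : ℂ) + 1) + 1 = -n by ring, show -((n : ℂ) + 1) - 1 = -(n + 1 + 1) by ring,
        i1, i2] at h2
      linear_combination h2 + h1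
  exact (main n).1

theorem besselI_neg_int {z : ℂ} (hz : z ≠ 0) (n : ℤ) : besselI (-n) z = besselI n z := by
  obtain ⟨k, rfl | rfl⟩ := n.eq_nat_or_neg
  · exact_mod_cast besselI_neg_nat hz k
  · have := (besselI_neg_nat hz k).symm
    push_cast
    rwa [neg_neg]

/-- Numerator and denominator are entire in the order. At an integer both vanish and the denominator
has nonzero derivative, so the quotient of difference quotients converges; hence `limUnder` there is
a genuine limit. -/
theorem tendsto_macdonaldQuotient {z : ℂ} (hz : z ≠ 0) (ν : ℂ) :
    Tendsto (fun μ => macdonaldQuotient μ z) (𝓝[≠] ν) (𝓝 (macdonaldK ν z)) := by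
  have hd := differentiable_besselI hz
  have hN : Differentiable ℂ fun μ => (Real.pi / 2 : ℂ) * (besselI (-μ) z - besselI μ z) :=
    ((hd.comp differentiable_neg).sub hd).const_mul _
  have hS : ∀ μ : ℂ, HasDerivAt (fun μ : ℂ => Complex.sin (μ * Real.pi))
      (Complex.cos (μ * Real.pi) * Real.pi) μ := fun μ => by
    have h0 : HasDerivAt (fun μ : ℂ => μ * (Real.pi : ℂ)) Real.pi μ := by
      simpa using (hasDerivAt_id μ).mul_const (Real.pi : ℂ)
    exact h0.csin
  by_cases hsin : Complex.sin (ν * Real.pi) = 0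
  · rw [macdonaldK, if_pos hsin]
    refine tendsto_nhds_limUnder ?_
    obtain ⟨n, hn⟩ := Complex.sin_eq_zero_iff.mp hsin
    have hpi : (Real.pi : ℂ) ≠ 0 := by exact_mod_cast Real.pi_ne_zero
    have hνn : ν = n := mul_right_cancel₀ hpi hn
    have hN0 : (Real.pi / 2 : ℂ) * (besselI (-ν) z - besselI ν z) = 0 := by
      rw [hνn, besselI_neg_int hz, sub_self, mul_zero]
    have h1 := hasDerivAt_iff_tendsto_slope.mp (hN ν).hasDerivAt
    have h2 := hasDerivAt_iff_tendsto_slope.mp (hS ν)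
    have hcos : Complex.cos (ν * Real.pi) ≠ 0 := by
      intro h
      have := Complex.sin_sq_add_cos_sq (ν * Real.pi)
      rw [hsin, h] at this
      simp at this
    refine ⟨_, (h1.div h2 (mul_ne_zero hcos hpi)).congr' ?_⟩
    filter_upwards [self_mem_nhdsWithin] with μ hμ
    have hμ' : μ - ν ≠ 0 := sub_ne_zero.mpr hμ
    rw [Pi.div_apply, slope_def_field, slope_def_field, hN0, hsin, sub_zero, sub_zero,
      div_div_div_cancel_right₀ hμ', macdonaldQuotient]
  · rw [macdonaldK, if_neg hsin]
    refine Tendsto.mono_left ?_ nhdsWithin_le_nhds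
    exact (hN ν).continuousAt.div (hS ν).continuousAt hsin

/-- All three sines agree up to sign, so the identity is that of the numerators multiplied by
$1/\sin\nu\pi$; it stays true under division by zero at integers. -/
theorem macdonaldQuotient_sub {z : ℂ} (hz : z ≠ 0) (ν : ℂ) :
    macdonaldQuotient (ν - 1) z - macdonaldQuotient (ν + 1) z
      = -(2 * ν / z) * macdonaldQuotient ν z := by
  have h1 := besselI_sub hz ν
  have h2 := besselI_sub hz (-ν)
  have s1 : Complex.sin ((ν - 1) * Real.pi) = -Complex.sin (ν * Real.pi) := by
    rw [sub_mul, one_mul, Complex.sin_sub_pi]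
  have s2 : Complex.sin ((ν + 1) * Real.pi) = -Complex.sin (ν * Real.pi) := by
    rw [add_mul, one_mul, Complex.sin_add_pi]
  rw [macdonaldQuotient, macdonaldQuotient, macdonaldQuotient, s1, s2,
    show -(ν - 1) = -ν + 1 by ring, show -(ν + 1) = -ν - 1 by ring, div_neg, div_neg]
  have e : besselI (-ν - 1) z - besselI (-ν + 1) z + (besselI (ν - 1) z - besselI (ν + 1) z)
      = -(2 * ν / z) * (besselI (-ν) z - besselI ν z) := by
    rw [h1, h2]; ring
  linear_combination (Real.pi / 2 : ℂ) / Complex.sin (ν * Real.pi) * e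

/-- Letting $\mu\to\nu$ through punctured neighbourhoods treats integral and non-integral orders
alike. -/
theorem macdonaldK_sub {z : ℂ} (hz : z ≠ 0) (ν : ℂ) :
    macdonaldK (ν - 1) z - macdonaldK (ν + 1) z = -(2 * ν / z) * macdonaldK ν z := by
  have shift : ∀ c : ℂ, Tendsto (fun μ => μ + c) (𝓝[≠] ν) (𝓝[≠] (ν + c)) := fun c => by
    refine tendsto_nhdsWithin_iff.mpr ⟨?_, ?_⟩
    · exact ((continuous_id.add continuous_const).tendsto ν).mono_left nhdsWithin_le_nhds
    · filter_upwards [self_mem_nhdsWithin] with μ hμ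
      simpa using hμ
  have h1 := (tendsto_macdonaldQuotient hz (ν + -1)).comp (shift (-1))
  have h2 := (tendsto_macdonaldQuotient hz (ν + 1)).comp (shift 1)
  have h3 : Tendsto (fun μ : ℂ => -(2 * μ / z)) (𝓝[≠] ν) (𝓝 (-(2 * ν / z))) :=
    (Continuous.tendsto (by fun_prop) ν).mono_left nhdsWithin_le_nhds
  have h4 := h3.mul (tendsto_macdonaldQuotient hz ν)
  have h5 := tendsto_nhds_unique ((h1.sub h2).congr fun μ => macdonaldQuotient_sub hz μ) h4
  exact h5

/-! ### The families $xe^{-px}$ and $\pi\sin(\tau s)/(\sinh\tau\,\sinh\pi s)$ and their Gram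
matrices. -/

theorem memLp_measX {f : ℝ → ℂ} (hf : Measurable f)
    (h : IntegrableOn (fun x => 1 / x * ‖f x‖ ^ 2) (Set.Ioi 0)) : MemLp f 2 measX := by
  rw [memLp_two_iff_integrable_sq_norm hf.aestronglyMeasurable, measX,
    integrable_withDensity_iff_integrable_smul' (by fun_prop) (by simp)]
  refine h.congr ?_
  filter_upwards [ae_restrict_mem measurableSet_Ioi] with x hx
  have : (0 : ℝ) < x := hx
  rw [ENNReal.toReal_ofReal (by positivity), smul_eq_mul]

theorem memLp_measS {f : ℝ → ℂ} (hf : Measurable f)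
    (h : IntegrableOn (fun s => dens s * ‖f s‖ ^ 2) (Set.Ioi 0)) : MemLp f 2 measS := by
  rw [memLp_two_iff_integrable_sq_norm hf.aestronglyMeasurable, measS_eq,
    integrable_withDensity_iff_integrable_smul' (by have := continuous_dens; fun_prop) (by simp)]
  refine h.congr ?_
  filter_upwards [ae_restrict_mem measurableSet_Ioi] with x hx
  rw [ENNReal.toReal_ofReal (dens_pos hx).le, smul_eq_mul]

theorem inner_toLp_left {μ : Measure ℝ} {f : ℝ → ℂ} (hf : MemLp f 2 μ) (g : Lp ℂ 2 μ) :
    inner ℂ (hf.toLp f) g = ∫ x, (starRingEnd ℂ) (f x) * g x ∂μ := by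
  rw [L2.inner_def]
  refine integral_congr_ae ?_
  filter_upwards [hf.coeFn_toLp] with x hx
  rw [hx, RCLike.inner_apply, mul_comm]

theorem integrable_conj_mul {μ : Measure ℝ} {f : ℝ → ℂ} (hf : MemLp f 2 μ) (g : Lp ℂ 2 μ) :
    Integrable (fun x => (starRingEnd ℂ) (f x) * g x) μ := by
  refine (L2.integrable_inner (𝕜 := ℂ) (hf.toLp f) g).congr ?_
  filter_upwards [hf.coeFn_toLp] with x hx
  rw [hx, RCLike.inner_apply, mul_comm]

theorem inner_toLp_toLp {μ : Measure ℝ} {f g : ℝ → ℂ} (hf : MemLp f 2 μ) (hg : MemLp g 2 μ) :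
    inner ℂ (hf.toLp f) (hg.toLp g) = ∫ x, (starRingEnd ℂ) (f x) * g x ∂μ := by
  rw [inner_toLp_left]
  refine integral_congr_ae ?_
  filter_upwards [hg.coeFn_toLp] with x hx
  rw [hx]

/-- The functions `x e^{-px}`. -/
noncomputable def expX (p x : ℝ) : ℂ := ((x * Real.exp (-(p * x)) : ℝ) : ℂ)

/-- The functions `π sin (τ s) / (sinh τ sinh (π s))`, the images of `expX (cosh τ)`. -/
noncomputable def sinS (τ s : ℝ) : ℂ :=
  ((Real.pi * Real.sin (τ * s) / (Real.sinh τ * Real.sinh (Real.pi * s)) : ℝ) : ℂ)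

theorem integral_mul_exp {r : ℝ} (hr : 0 < r) :
    ∫ x in Set.Ioi (0 : ℝ), x * Real.exp (-(r * x)) = 1 / r ^ 2 := by
  have := Real.integral_rpow_mul_exp_neg_mul_Ioi (a := 2) (r := r) two_pos hr
  rw [show Real.Gamma 2 = 1 by simp] at this
  norm_num at this
  rw [this]; simp

theorem integrableOn_mul_exp {r : ℝ} (hr : 0 < r) :
    IntegrableOn (fun x : ℝ => x * Real.exp (-(r * x))) (Set.Ioi 0) :=
  not_imp_comm.mp integral_undef (by rw [integral_mul_exp hr]; positivity)

theorem memLp_expX {p : ℝ} (hp : 0 < p) : MemLp (expX p) 2 measX := by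
  refine memLp_measX (by unfold expX; fun_prop) ?_
  refine (integrableOn_mul_exp (r := 2 * p) (by positivity)).congr_fun (fun x hx => ?_)
    measurableSet_Ioi
  have hx' : 0 < x := hx
  simp only [expX, Complex.norm_real, Real.norm_eq_abs, sq_abs]
  rw [mul_pow, ← Real.exp_nat_mul]
  field_simp
  congr 1; push_cast; ring

theorem inner_expX {p q : ℝ} (hp : 0 < p) (hq : 0 < q) :
    inner ℂ ((memLp_expX hp).toLp _) ((memLp_expX hq).toLp _) = ((1 / (p + q) ^ 2 : ℝ) : ℂ) := by
  rw [inner_toLp_toLp, integral_measX, ← integral_mul_exp (r := p + q) (by positivity),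
    ← integral_complex_ofReal]
  refine setIntegral_congr_fun measurableSet_Ioi fun x hx => ?_
  have hx' : 0 < x := hx
  simp only [expX, Complex.conj_ofReal]
  rw [← Complex.ofReal_mul, ← Complex.ofReal_mul]
  congr 1
  rw [show -((p + q) * x) = -(p * x) + -(q * x) by ring, Real.exp_add]
  field_simp

theorem inner_expX_left {p : ℝ} (hp : 0 < p) (f : L2X) :
    inner ℂ ((memLp_expX hp).toLp _) f = ∫ x in Set.Ioi 0, f x * Real.exp (-(p * x)) := by
  rw [inner_toLp_left, integral_measX]
  refine setIntegral_congr_fun measurableSet_Ioi fun x hx => ?_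
  have hx' : (x : ℂ) ≠ 0 := by exact_mod_cast (ne_of_gt hx)
  simp only [expX, Complex.conj_ofReal]
  push_cast
  field_simp

theorem integrableOn_L2X_mul_exp {p : ℝ} (hp : 0 < p) (f : L2X) :
    IntegrableOn (fun x => f x * Real.exp (-(p * x))) (Set.Ioi 0) := by
  refine (integrable_measX_iff.mp (integrable_conj_mul (memLp_expX hp) f)).congr_fun
    (fun x hx => ?_) measurableSet_Ioi
  have hx' : (x : ℂ) ≠ 0 := by exact_mod_cast (ne_of_gt hx)
  simp only [expX, Complex.conj_ofReal]
  push_cast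
  field_simp

theorem sinh_pi_pos {s : ℝ} (hs : 0 < s) : 0 < Real.sinh (Real.pi * s) :=
  Real.sinh_pos_iff.mpr (mul_pos Real.pi_pos hs)

theorem measurable_sinS (τ : ℝ) : Measurable (sinS τ) := by
  have : Measurable fun s : ℝ => Real.sinh τ * Real.sinh (Real.pi * s) := by fun_prop
  exact Complex.measurable_ofReal.comp ((by fun_prop : Measurable fun s : ℝ =>
    Real.pi * Real.sin (τ * s)).div this)

theorem memLp_sinS {τ : ℝ} (hτ : 0 < τ) : MemLp (sinS τ) 2 measS := by
  refine memLp_measS (measurable_sinS τ) ?_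
  have hsτ := Real.sinh_pos_iff.mpr hτ
  refine Integrable.mono' ((integrable_div_sinh.integrableOn (s := Set.Ioi 0)).const_mul
    (2 / Real.sinh τ ^ 2)) ?_ ?_
  · have := measurable_sinS τ
    have := continuous_dens
    fun_prop
  · filter_upwards [ae_restrict_mem measurableSet_Ioi] with s hs
    have hs' : 0 < s := hs
    have hsh := sinh_pi_pos hs
    have h1 : Real.sin (τ * s) ^ 2 ≤ 1 := Real.sin_sq_le_one _
    rw [Real.norm_of_nonneg (mul_nonneg (dens_pos hs).le (by positivity)), sinS,
      Complex.norm_real, Real.norm_eq_abs, sq_abs, dens]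
    calc _ = 2 / Real.sinh τ ^ 2 * (s / Real.sinh (Real.pi * s)) * Real.sin (τ * s) ^ 2 := by
          field_simp
      _ ≤ _ := mul_le_of_le_one_right (by positivity) h1

theorem inner_sinS_left {τ : ℝ} (hτ : 0 < τ) (f : L2S) :
    inner ℂ ((memLp_sinS hτ).toLp _) f = ((2 / (Real.pi * Real.sinh τ) : ℝ) : ℂ) *
      ∫ s in Set.Ioi 0, s * f s * Real.sin (τ * s) := by
  have hsτ := Real.sinh_pos_iff.mpr hτ
  rw [inner_toLp_left, integral_measS, ← integral_const_mul]
  refine setIntegral_congr_fun measurableSet_Ioi fun s hs => ?_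
  have hs' : (s : ℂ) ≠ 0 := by exact_mod_cast (ne_of_gt hs)
  have hsh : (Real.sinh (Real.pi * s) : ℂ) ≠ 0 := by exact_mod_cast (sinh_pi_pos hs).ne'
  have hpi : (Real.pi : ℂ) ≠ 0 := by exact_mod_cast Real.pi_ne_zero
  simp only [sinS, Complex.conj_ofReal, dens]
  push_cast at hsh ⊢
  field_simp

/-- The function $1/\sinh\pi s$ is square integrable for the weight, and weight times $1/\sinh\pi s$
is a multiple of $s$; the product of two $L^2$ functions is integrable. This makes the sine
transform of $sf(s)$ available. -/
theorem integrableOn_mul_L2S (f : L2S) : IntegrableOn (fun s : ℝ => s * f s) (Set.Ioi 0) := by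
  have hm : Measurable fun s : ℝ => Real.sinh (Real.pi * s) := by fun_prop
  have hmem : MemLp (fun s : ℝ => ((1 / Real.sinh (Real.pi * s) : ℝ) : ℂ)) 2 measS := by
    refine memLp_measS (Complex.measurable_ofReal.comp (measurable_const.div hm)) ?_
    refine IntegrableOn.congr_fun ((integrable_div_sinh.integrableOn (s := Set.Ioi 0)).const_mul
      (2 / Real.pi ^ 2)) (fun s hs => ?_) measurableSet_Ioi
    have hsh := sinh_pi_pos hs
    simp only [dens, Complex.norm_real, Real.norm_eq_abs, sq_abs]
    field_simp
  refine IntegrableOn.congr_fun ((integrable_measS_iff.mp (integrable_conj_mul hmem f)).const_mul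
    ((Real.pi ^ 2 / 2 : ℝ) : ℂ)) (fun s hs => ?_) measurableSet_Ioi
  have hsh : (Real.sinh (Real.pi * s) : ℂ) ≠ 0 := by exact_mod_cast (sinh_pi_pos hs).ne'
  have hpi : (Real.pi : ℂ) ≠ 0 := by exact_mod_cast Real.pi_ne_zero
  simp only [Complex.conj_ofReal, dens]
  push_cast at hsh ⊢
  field_simp

/-- The product of sines is a difference of cosines, each integrated by `integral_mul_cos_div_sinh`.
The value coincides with `inner_expX` at $p=\cosh\tau$, $q=\cosh\sigma$. -/
theorem inner_sinS {τ σ : ℝ} (hτ : 0 < τ) (hσ : 0 < σ) :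
    inner ℂ ((memLp_sinS hτ).toLp _) ((memLp_sinS hσ).toLp _)
      = ((1 / (Real.cosh τ + Real.cosh σ) ^ 2 : ℝ) : ℂ) := by
  have hsτ := Real.sinh_pos_iff.mpr hτ
  have hsσ := Real.sinh_pos_iff.mpr hσ
  have hint : ∀ a : ℝ, IntegrableOn (fun s : ℝ => s / Real.sinh (Real.pi * s) * Real.cos (a * s))
      (Set.Ioi 0) := fun a => by
    refine (integrable_div_sinh.norm.mono' (integrable_div_sinh.1.mul (by fun_prop))
      (Eventually.of_forall fun s => ?_)).integrableOn
    exact (norm_mul _ _).trans_le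
      (mul_le_of_le_one_right (norm_nonneg _) (Real.abs_cos_le_one _))
  have h1 : inner ℂ ((memLp_sinS hτ).toLp _) ((memLp_sinS hσ).toLp _)
      = ((∫ s in Set.Ioi (0 : ℝ), 1 / (Real.sinh τ * Real.sinh σ) *
        (s / Real.sinh (Real.pi * s) * Real.cos ((τ - σ) * s)
          - s / Real.sinh (Real.pi * s) * Real.cos ((τ + σ) * s)) : ℝ) : ℂ) := by
    rw [inner_toLp_toLp, integral_measS, ← integral_complex_ofReal]
    refine setIntegral_congr_fun measurableSet_Ioi fun s hs => ?_
    have hs' : 0 < s := hs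
    have hsh := sinh_pi_pos hs
    simp only [sinS, Complex.conj_ofReal]
    rw [← Complex.ofReal_mul, ← Complex.ofReal_mul]
    congr 1
    rw [sub_mul, add_mul, Real.cos_sub, Real.cos_add, dens]
    field_simp
    ring
  rw [h1, integral_const_mul, integral_sub (hint _) (hint _), integral_mul_cos_div_sinh,
    integral_mul_cos_div_sinh, cosh_add_cosh]
  congr 1
  have e := Real.cosh_pos ((τ + σ) / 2)
  have e' := Real.cosh_pos ((τ - σ) / 2)
  have h2 : Real.cosh ((τ + σ) / 2) ^ 2 - Real.cosh ((τ - σ) / 2) ^ 2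
      = Real.sinh τ * Real.sinh σ := by
    have a1 := Real.sinh_add ((τ + σ) / 2) ((τ - σ) / 2)
    have a2 := Real.sinh_sub ((τ + σ) / 2) ((τ - σ) / 2)
    rw [show (τ + σ) / 2 + (τ - σ) / 2 = τ by ring] at a1
    rw [show (τ + σ) / 2 - (τ - σ) / 2 = σ by ring] at a2
    rw [a1, a2]
    have := Real.cosh_sq ((τ + σ) / 2)
    have := Real.cosh_sq ((τ - σ) / 2)
    linear_combination (Real.cosh ((τ - σ) / 2) ^ 2) * ‹Real.cosh ((τ + σ) / 2) ^ 2 = _› -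
      Real.cosh ((τ + σ) / 2) ^ 2 * ‹Real.cosh ((τ - σ) / 2) ^ 2 = _›
  rw [← h2]
  have h3 : Real.cosh ((τ + σ) / 2) ^ 2 - Real.cosh ((τ - σ) / 2) ^ 2 ≠ 0 := by
    rw [h2]; positivity
  field_simp
  ring

/-! ### Totality of the two families and the unitary operator. -/

theorem L2X_eq_zero {f : L2X} (h : ∀ τ : ℝ, 0 < τ →
    inner ℂ ((memLp_expX (Real.cosh_pos τ)).toLp _) f = 0) : f = 0 := by
  rw [Lp.eq_zero_iff_ae_eq_zero]
  refine ae_measX_iff.mpr ?_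
  refine ae_eq_zero_of_laplace (fun p hp => integrableOn_L2X_mul_exp (by linarith) f)
    fun p hp => ?_
  have := h _ (Real.arcosh_pos hp)
  rwa [inner_expX_left (Real.cosh_pos _), Real.cosh_arcosh hp.le] at this

theorem L2S_eq_zero {f : L2S} (h : ∀ τ (hτ : 0 < τ),
    inner ℂ ((memLp_sinS hτ).toLp _) f = 0) : f = 0 := by
  rw [Lp.eq_zero_iff_ae_eq_zero]
  refine ae_measS_iff.mpr ?_
  have := ae_eq_zero_of_sine (integrableOn_mul_L2S f) fun τ hτ => by
    have h1 := h τ hτ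
    have hsτ := Real.sinh_pos_iff.mpr hτ
    rw [inner_sinS_left hτ] at h1
    refine (mul_eq_zero.mp h1).resolve_left ?_
    have : 2 / (Real.pi * Real.sinh τ) ≠ 0 := by positivity
    exact_mod_cast this
  filter_upwards [this, ae_restrict_mem measurableSet_Ioi] with s hs hs0
  have : (s : ℂ) ≠ 0 := by exact_mod_cast (ne_of_gt hs0)
  simpa [this] using hs

theorem norm_linearCombination_eq {ι E F : Type*} [NormedAddCommGroup E] [InnerProductSpace ℂ E]
    [NormedAddCommGroup F] [InnerProductSpace ℂ F] {v : ι → E} {w : ι → F}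
    (h : ∀ i j, inner ℂ (v i) (v j) = inner ℂ (w i) (w j)) (c : ι →₀ ℂ) :
    ‖Finsupp.linearCombination ℂ v c‖ = ‖Finsupp.linearCombination ℂ w c‖ := by
  have : inner ℂ (Finsupp.linearCombination ℂ v c) (Finsupp.linearCombination ℂ v c)
      = inner ℂ (Finsupp.linearCombination ℂ w c) (Finsupp.linearCombination ℂ w c) := by
    simp only [Finsupp.linearCombination_apply, Finsupp.sum, sum_inner, inner_sum,
      inner_smul_left, inner_smul_right, h]
  rw [@norm_eq_sqrt_re_inner ℂ, @norm_eq_sqrt_re_inner ℂ, this]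

theorem denseRange_linearCombination {ι E : Type*} [NormedAddCommGroup E] [InnerProductSpace ℂ E]
    [CompleteSpace E] {v : ι → E} (h : ∀ f : E, (∀ i, inner ℂ (v i) f = 0) → f = 0) :
    DenseRange (Finsupp.linearCombination ℂ v) := by
  have h1 : (Submodule.span ℂ (Set.range v)).topologicalClosure = ⊤ := by
    rw [Submodule.topologicalClosure_eq_top_iff, Submodule.eq_bot_iff]
    intro f hf
    refine h f fun i => ?_
    exact (Submodule.mem_orthogonal _ _).mp hf _ (Submodule.subset_span ⟨i, rfl⟩)
  rw [← Submodule.dense_iff_topologicalClosure_eq_top, ← Finsupp.range_linearCombination] at h1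
  exact h1

/-- Two total families with the same Gram matrix are unitarily equivalent. -/
theorem exists_linearIsometryEquiv {ι E F : Type*} [NormedAddCommGroup E] [InnerProductSpace ℂ E]
    [NormedAddCommGroup F] [InnerProductSpace ℂ F] [CompleteSpace E] [CompleteSpace F]
    {v : ι → E} {w : ι → F} (h : ∀ i j, inner ℂ (v i) (v j) = inner ℂ (w i) (w j))
    (hv : ∀ f : E, (∀ i, inner ℂ (v i) f = 0) → f = 0)
    (hw : ∀ f : F, (∀ i, inner ℂ (w i) f = 0) → f = 0) :
    ∃ U : E ≃ₗᵢ[ℂ] F, ∀ i, U (v i) = w i := by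
  refine ⟨(LinearEquiv.refl ℂ (ι →₀ ℂ)).extendOfIsometry (Finsupp.linearCombination ℂ v)
    (Finsupp.linearCombination ℂ w) (denseRange_linearCombination hv)
    (denseRange_linearCombination hw) (fun c => (norm_linearCombination_eq h c).symm), fun i => ?_⟩
  have := LinearEquiv.extendOfIsometry_eq (LinearEquiv.refl ℂ (ι →₀ ℂ))
    (Finsupp.linearCombination ℂ v) (Finsupp.linearCombination ℂ w)
    (denseRange_linearCombination hv) (denseRange_linearCombination hw)
    (fun c => (norm_linearCombination_eq h c).symm) (Finsupp.single i 1)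
  simpa using this

/-- Equality of the Gram matrices makes the correspondence isometric on linear combinations, and
totality on both sides makes its extension surjective. Later facts about the operator use only its
values on this family. -/
theorem exists_unitary : ∃ U : L2X ≃ₗᵢ[ℂ] L2S, ∀ τ (hτ : 0 < τ),
    U ((memLp_expX (Real.cosh_pos τ)).toLp _) = (memLp_sinS hτ).toLp _ := by
  obtain ⟨U, hU⟩ := exists_linearIsometryEquiv (ι := {τ : ℝ // 0 < τ})
    (v := fun τ => (memLp_expX (Real.cosh_pos τ.1)).toLp _)
    (w := fun τ => (memLp_sinS τ.2).toLp _)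
    (fun i j => by rw [inner_expX (Real.cosh_pos _) (Real.cosh_pos _), inner_sinS i.2 j.2])
    (fun f hf => L2X_eq_zero fun τ hτ => hf ⟨τ, hτ⟩)
    (fun f hf => L2S_eq_zero fun τ hτ => hf ⟨τ, hτ⟩)
  exact ⟨U, fun τ hτ => hU ⟨τ, hτ⟩⟩

/-! ### The unitary operator and its inverse as integral operators. -/

/-- If the inverse of a unitary operator acts on indicator functions as an integral operator, then
the operator itself is the adjoint integral operator wherever the integral converges. -/
theorem ae_eq_integral_of_symm_indicator {μ ν : Measure ℝ} [SigmaFinite μ] [SigmaFinite ν]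
    {k : ℝ → ℝ → ℂ} (hk : AEStronglyMeasurable (Function.uncurry k) (ν.prod μ))
    (V : Lp ℂ 2 μ ≃ₗᵢ[ℂ] Lp ℂ 2 ν) {A : ℕ → Set ℝ} (hA : ∀ n, MeasurableSet (A n))
    (hAm : Monotone A) (hAu : ∀ᵐ s ∂ν, ∃ n, s ∈ A n)
    (hbase : ∀ (n : ℕ) (E : Set ℝ) (hE : MeasurableSet E) (hν : ν E ≠ ⊤), E ⊆ A n →
      V.symm (indicatorConstLp 2 hE hν (1 : ℂ)) =ᵐ[μ]
        fun x => ∫ s in E, (starRingEnd ℂ) (k s x) ∂ν)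
    (g : Lp ℂ 2 μ) (hg : ∀ᵐ s ∂ν, Integrable (fun x => k s x * g x) μ) :
    V g =ᵐ[ν] fun s => ∫ x, k s x * g x ∂μ := by
  have hkg : AEStronglyMeasurable (fun p : ℝ × ℝ => k p.1 p.2 * g p.2) (ν.prod μ) :=
    hk.mul (Lp.aestronglyMeasurable g).comp_snd
  have hM : AEStronglyMeasurable (fun s => ∫ x, ‖k s x * g x‖ ∂μ) ν :=
    hkg.norm.integral_prod_right'
  -- On `S n` the $L^1$ norm of $k(s,\cdot)g$ is at most $n$, so Fubini applies over subsets of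
  -- finite measure; a strongly measurable representative of the norm makes `S n` measurable.
  set S : ℕ → Set ℝ := fun n => A n ∩ {s | hM.mk _ s ≤ n}
  have hS : ∀ n, MeasurableSet (S n) := fun n =>
    (hA n).inter (measurableSet_le hM.stronglyMeasurable_mk.measurable measurable_const)
  have main : ∀ n, ∀ E, MeasurableSet E → ν E ≠ ⊤ → E ⊆ S n →
      IntegrableOn (fun s => ∫ x, k s x * g x ∂μ) E ν ∧
      ∫ s in E, V g s ∂ν = ∫ s in E, ∫ x, k s x * g x ∂μ ∂ν := by
    intro n E hE hν hEn
    have hEA : E ⊆ A n := hEn.trans Set.inter_subset_left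
    have hfin : IsFiniteMeasure (ν.restrict E) := ⟨by
      rw [Measure.restrict_apply_univ]; exact hν.lt_top⟩
    have hkE : AEStronglyMeasurable (fun p : ℝ × ℝ => k p.1 p.2 * g p.2)
        ((ν.restrict E).prod μ) := by
      rw [show (ν.restrict E).prod μ = (ν.prod μ).restrict (E ×ˢ Set.univ) by
        rw [← Measure.prod_restrict, Measure.restrict_univ]]
      exact hkg.restrict
    have hint : Integrable (fun p : ℝ × ℝ => k p.1 p.2 * g p.2) ((ν.restrict E).prod μ) := by
      refine (integrable_prod_iff hkE).mpr ⟨ae_restrict_of_ae hg, ?_⟩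
      refine Integrable.mono' (integrable_const (n : ℝ)) hM.restrict ?_
      filter_upwards [ae_restrict_of_ae hM.ae_eq_mk, ae_restrict_mem hE] with s hs hsE
      rw [Real.norm_of_nonneg (integral_nonneg fun x => norm_nonneg _), hs]
      exact (hEn hsE).2
    refine ⟨hint.integral_prod_left, ?_⟩
    rw [integral_integral_swap hint]
    -- The integral of $Vg$ over $E$ is $\langle 1_E,Vg\rangle=\langle V^{-1}1_E,g\rangle$, where
    -- the kernel formula for $V^{-1}1_E$ is available.
    have h1 : inner ℂ (indicatorConstLp 2 hE hν (1 : ℂ)) (V g)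
        = inner ℂ (V.symm (indicatorConstLp 2 hE hν (1 : ℂ))) g := by
      rw [← V.inner_map_map, V.apply_symm_apply]
    rw [L2.inner_indicatorConstLp_one] at h1
    rw [h1, L2.inner_def]
    refine integral_congr_ae ?_
    filter_upwards [hbase n E hE hν hEA] with x hx
    rw [hx, RCLike.inner_apply, ← integral_conj, mul_comm, integral_mul_const]
    simp only [Complex.conj_conj]
  have hn : ∀ n, ∀ᵐ s ∂ν, s ∈ S n → V g s = ∫ x, k s x * g x ∂μ := by
    intro n
    rw [← ae_restrict_iff' (hS n)]
    refine ae_eq_of_forall_setIntegral_eq_of_sigmaFinite ?_ ?_ ?_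
    · intro E hE hν
      rw [IntegrableOn, Measure.restrict_restrict hE]
      rw [Measure.restrict_apply hE] at hν
      exact integrableOn_Lp_of_measure_ne_top _ fact_one_le_two_ennreal.elim hν.ne
    · intro E hE hν
      rw [IntegrableOn, Measure.restrict_restrict hE]
      rw [Measure.restrict_apply hE] at hν
      exact (main n _ (hE.inter (hS n)) hν.ne Set.inter_subset_right).1
    · intro E hE hν
      rw [Measure.restrict_restrict hE]
      rw [Measure.restrict_apply hE] at hν
      exact (main n _ (hE.inter (hS n)) hν.ne Set.inter_subset_right).2
  filter_upwards [ae_all_iff.mpr hn, hAu] with s hs ⟨m, hm⟩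
  obtain ⟨l, hl⟩ := exists_nat_ge (hM.mk _ s)
  refine hs (max m l) ⟨hAm (le_max_left _ _) hm, hl.trans ?_⟩
  exact_mod_cast le_max_right m l

instance : SigmaFinite measX := by unfold measX; infer_instance

instance : SigmaFinite measS := by unfold measS; infer_instance

/-- The integral representation of the Macdonald function as a function on the plane. -/
noncomputable def kerK (s x : ℝ) : ℂ :=
  1 / 2 * ∫ t : ℝ, Complex.exp ((s * t : ℝ) * Complex.I) * (Real.exp (-(x * Real.cosh t)) : ℂ)

/-- The majorant `K₀` of the kernel. -/
noncomputable def kerBound (x : ℝ) : ℝ := 1 / 2 * ∫ t : ℝ, Real.exp (-(x * Real.cosh t))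

theorem stronglyMeasurable_kerK : StronglyMeasurable (Function.uncurry kerK) := by
  have h : StronglyMeasurable fun p : (ℝ × ℝ) × ℝ =>
      Complex.exp ((p.1.1 * p.2 : ℝ) * Complex.I) * (Real.exp (-(p.1.2 * Real.cosh p.2)) : ℂ) :=
    Continuous.stronglyMeasurable (by fun_prop)
  exact (h.integral_prod_right' (ν := volume)).const_mul (1 / 2)

/-- The substitution $t\mapsto-t$ shows that the kernel is real, so the adjoint integral operator
has the same kernel. -/
theorem conj_kerK (s x : ℝ) : (starRingEnd ℂ) (kerK s x) = kerK s x := by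
  rw [kerK, map_mul, ← integral_conj, ← integral_neg_eq_self]
  congr 1
  · rw [show (1 / 2 : ℂ) = ((1 / 2 : ℝ) : ℂ) by push_cast; rfl, Complex.conj_ofReal]
  · refine integral_congr_ae (Eventually.of_forall fun t => ?_)
    simp only [map_mul, ← Complex.exp_conj, Complex.conj_I, Complex.conj_ofReal, Real.cosh_neg]
    congr 2
    push_cast; ring

theorem norm_kerK_le (s x : ℝ) : ‖kerK s x‖ ≤ kerBound x := by
  rw [kerK, kerBound, norm_mul, show ‖(1 / 2 : ℂ)‖ = 1 / 2 by norm_num]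
  gcongr
  refine (norm_integral_le_integral_norm _).trans (le_of_eq ?_)
  refine integral_congr_ae (Eventually.of_forall fun t => ?_)
  simp only
  rw [norm_mul, Complex.norm_exp_ofReal_mul_I, one_mul, Complex.norm_real,
    Real.norm_of_nonneg (Real.exp_pos _).le]

theorem kerBound_anti {x y : ℝ} (hx : 0 < x) (hxy : x ≤ y) : kerBound y ≤ kerBound x := by
  unfold kerBound
  gcongr 1 / 2 * ?_
  refine integral_mono (integrable_exp_neg_mul_cosh (hx.trans_le hxy))
    (integrable_exp_neg_mul_cosh hx) fun t => ?_
  simp only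
  have := Real.cosh_pos t
  gcongr

theorem integral_exp_neg_mul_Ioi {r : ℝ} (hr : 0 < r) :
    ∫ x in Set.Ioi (0 : ℝ), Real.exp (-(x * r)) = 1 / r := by
  have := integral_exp_mul_Ioi (a := -r) (by linarith) 0
  simp only [mul_zero, Real.exp_zero, neg_div_neg_eq] at this
  rw [← this]
  refine integral_congr_ae (Eventually.of_forall fun t => ?_)
  simp only
  congr 1; ring

theorem integrableOn_exp_neg_mul_Ioi {r : ℝ} (hr : 0 < r) :
    IntegrableOn (fun x : ℝ => Real.exp (-(x * r))) (Set.Ioi 0) :=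
  not_imp_comm.mp integral_undef (by rw [integral_exp_neg_mul_Ioi hr]; positivity)

theorem integrable_exp_neg_mul_cosh_add {p : ℝ} (hp : 0 < p) :
    Integrable (fun q : ℝ × ℝ => Real.exp (-(q.1 * (Real.cosh q.2 + p))))
      ((volume.restrict (Set.Ioi 0)).prod volume) := by
  have hpos : ∀ t, 0 < Real.cosh t + p := fun t => add_pos (Real.cosh_pos t) hp
  refine (integrable_prod_iff' (Continuous.aestronglyMeasurable (by fun_prop))).mpr
    ⟨Eventually.of_forall fun t => integrableOn_exp_neg_mul_Ioi (hpos t), ?_⟩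
  refine (integrable_inv_cosh_add hp.le).congr (Eventually.of_forall fun t => ?_)
  simp only
  rw [← integral_exp_neg_mul_Ioi (hpos t)]
  refine integral_congr_ae (Eventually.of_forall fun x => ?_)
  simp only
  rw [Real.norm_of_nonneg (Real.exp_pos _).le]

theorem exp_neg_mul_add (x c p : ℝ) : Real.exp (-(x * (c + p)))
    = Real.exp (-(x * c)) * Real.exp (-(p * x)) := by
  rw [← Real.exp_add]; congr 1; ring

theorem integrableOn_kerBound_mul_exp {p : ℝ} (hp : 0 < p) :
    IntegrableOn (fun x => kerBound x * Real.exp (-(p * x))) (Set.Ioi 0) := by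
  refine ((integrable_exp_neg_mul_cosh_add hp).integral_prod_left.const_mul (1 / 2)).congr
    (Eventually.of_forall fun x => ?_)
  simp only [exp_neg_mul_add]
  rw [integral_mul_const, kerBound]
  ring

/-- Integrating in $x$ under the $t$-integral leaves $1/(\cosh t+\cosh\tau)$, whose Fourier
transform is known. This is the transform of $xe^{-x\cosh\tau}$ for $dx/x$, and it ties the kernel
to the abstract unitary operator. -/
theorem integral_kerK_mul_exp {s τ : ℝ} (hs : 0 < s) (hτ : 0 < τ) :
    ∫ x in Set.Ioi 0, kerK s x * Real.exp (-(Real.cosh τ * x)) = sinS τ s := by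
  have hp := Real.cosh_pos τ
  have hint : Integrable (Function.uncurry fun (x t : ℝ) => Complex.exp ((s * t : ℝ) * Complex.I) *
      (Real.exp (-(x * (Real.cosh t + Real.cosh τ))) : ℂ))
      ((volume.restrict (Set.Ioi 0)).prod volume) := by
    refine (integrable_exp_neg_mul_cosh_add hp).mono'
      (Continuous.aestronglyMeasurable (by simp only [Function.uncurry_def]; fun_prop))
      (Eventually.of_forall fun q => ?_)
    simp only [Function.uncurry]
    rw [norm_mul, Complex.norm_exp_ofReal_mul_I, one_mul, Complex.norm_real,
      Real.norm_of_nonneg (Real.exp_pos _).le]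
  have h1 : ∀ x : ℝ, kerK s x * Real.exp (-(Real.cosh τ * x)) = 1 / 2 *
      ∫ t : ℝ, Complex.exp ((s * t : ℝ) * Complex.I) *
        (Real.exp (-(x * (Real.cosh t + Real.cosh τ))) : ℂ) := by
    intro x
    rw [kerK, mul_assoc, ← integral_mul_const]
    congr 1
    refine integral_congr_ae (Eventually.of_forall fun t => ?_)
    simp only [exp_neg_mul_add]
    push_cast; ring
  simp only [h1]
  rw [integral_const_mul, integral_integral_swap hint]
  have h2 : ∀ t : ℝ, ∫ x in Set.Ioi (0 : ℝ), Complex.exp ((s * t : ℝ) * Complex.I) *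
        (Real.exp (-(x * (Real.cosh t + Real.cosh τ))) : ℂ)
      = Complex.exp ((s * t : ℝ) * Complex.I) *
        ((1 / (Real.cosh t + Real.cosh τ) : ℝ) : ℂ) := by
    intro t
    rw [integral_const_mul, integral_complex_ofReal,
      integral_exp_neg_mul_Ioi (add_pos (Real.cosh_pos t) hp)]
  simp only [h2]
  rw [integral_cexp_div_cosh_add_cosh hs.ne' hτ, sinS]
  push_cast
  ring

/-- Both sides have the same Laplace transform at each $p=\cosh\tau>1$, namely
$\langle\phi_\tau,f\rangle$: for $U^{-1}f$ by unitarity, for the integral by Fubini with the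
majorant $|f(s)|K_0(x)e^{-px}$. -/
theorem symm_apply_ae_eq {U : L2X ≃ₗᵢ[ℂ] L2S} (hU : ∀ τ (hτ : 0 < τ),
    U ((memLp_expX (Real.cosh_pos τ)).toLp _) = (memLp_sinS hτ).toLp _)
    (f : L2S) (hf : Integrable f measS) :
    U.symm f =ᵐ[measX] fun x => ∫ s, kerK s x * f s ∂measS := by
  have hint : ∀ p : ℝ, 0 < p → Integrable (Function.uncurry fun (s x : ℝ) =>
      kerK s x * f s * Real.exp (-(p * x))) (measS.prod (volume.restrict (Set.Ioi 0))) := by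
    intro p hp
    have h1 := hf.norm.mul_prod (integrableOn_kerBound_mul_exp hp)
    refine h1.mono' ?_ (Eventually.of_forall fun q => ?_)
    · have h2 : AEStronglyMeasurable (fun q : ℝ × ℝ => f q.1)
          (measS.prod (volume.restrict (Set.Ioi 0))) := hf.1.comp_fst
      exact (stronglyMeasurable_kerK.aestronglyMeasurable.mul h2).mul
        (Continuous.aestronglyMeasurable (by fun_prop))
    · simp only [Function.uncurry]
      rw [norm_mul, norm_mul, Complex.norm_real, Real.norm_of_nonneg (Real.exp_pos _).le]
      have := norm_kerK_le q.1 q.2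
      calc _ = ‖kerK q.1 q.2‖ * (‖f q.1‖ * Real.exp (-(p * q.2))) := by ring
        _ ≤ kerBound q.2 * (‖f q.1‖ * Real.exp (-(p * q.2))) := by gcongr
        _ = _ := by ring
  have hpt : ∀ p x : ℝ, (∫ s, kerK s x * f s ∂measS) * (Real.exp (-(p * x)) : ℂ)
      = ∫ s, kerK s x * f s * Real.exp (-(p * x)) ∂measS := fun p x =>
    (integral_mul_const _ _).symm
  have hL := ae_eq_zero_of_laplace
    (f := fun x => U.symm f x - ∫ s, kerK s x * f s ∂measS) (fun p hp => ?_) (fun p hp => ?_)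
  · refine ae_measX_iff.mpr ?_
    filter_upwards [hL] with x hx
    exact sub_eq_zero.mp hx
  · have hp0 : 0 < p := by linarith
    simp only [sub_mul, hpt]
    exact (integrableOn_L2X_mul_exp hp0 _).sub (hint p hp0).integral_prod_right
  · have hp0 : 0 < p := by linarith
    have h1 := (hint p hp0).integral_prod_right
    simp only [Function.uncurry] at h1
    simp only [sub_mul, hpt]
    rw [integral_sub (integrableOn_L2X_mul_exp hp0 _) h1, sub_eq_zero]
    have hτ := Real.arcosh_pos hp
    have h2 : inner ℂ ((memLp_expX (Real.cosh_pos (Real.arcosh p))).toLp _) (U.symm f)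
        = inner ℂ ((memLp_sinS hτ).toLp _) f := by
      rw [← hU _ hτ, ← U.inner_map_map, U.apply_symm_apply]
    rw [inner_expX_left (Real.cosh_pos _), Real.cosh_arcosh hp.le, inner_toLp_left] at h2
    rw [h2, ← integral_integral_swap (hint p hp0)]
    refine integral_congr_ae (ae_measS_iff.mpr ?_)
    filter_upwards [ae_restrict_mem measurableSet_Ioi] with s hs
    rw [← integral_kerK_mul_exp hs hτ, Real.cosh_arcosh hp.le, ← integral_conj,
      ← integral_mul_const]
    refine integral_congr_ae (Eventually.of_forall fun x => ?_)
    simp only [map_mul, conj_kerK, Complex.conj_ofReal]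
    ring

theorem macdonaldK_eq_kerK {s x : ℝ} (hs : 0 < s) (hx : 0 < x) :
    macdonaldK (Complex.I * s) x = kerK s x := macdonaldK_eq_integral hs.ne' hx

theorem ae_measX_pos : ∀ᵐ x ∂measX, 0 < x :=
  ae_measX_iff.mpr (ae_restrict_mem measurableSet_Ioi)

theorem ae_measS_pos : ∀ᵐ x ∂measS, 0 < x :=
  ae_measS_iff.mpr (ae_restrict_mem measurableSet_Ioi)

theorem integral_mul_indicatorConstLp {μ : Measure ℝ} {E : Set ℝ} (hE : MeasurableSet E)
    (hμ : μ E ≠ ⊤) (k : ℝ → ℂ) :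
    ∫ x, k x * indicatorConstLp 2 hE hμ (1 : ℂ) x ∂μ = ∫ x in E, k x ∂μ := by
  rw [← integral_indicator hE]
  refine integral_congr_ae ?_
  filter_upwards [indicatorConstLp_coeFn (p := 2) (hs := hE) (hμs := hμ) (c := (1 : ℂ))] with x hx
  rw [hx]
  by_cases h : x ∈ E <;> simp [h]

variable {U : L2X ≃ₗᵢ[ℂ] L2S}

theorem apply_ae_eq_kerK (hU : ∀ τ (hτ : 0 < τ),
    U ((memLp_expX (Real.cosh_pos τ)).toLp _) = (memLp_sinS hτ).toLp _)
    (g : L2X) (hg : ∀ᵐ s ∂measS, Integrable (fun x => kerK s x * g x) measX) :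
    U g =ᵐ[measS] fun s => ∫ x, kerK s x * g x ∂measX := by
  refine ae_eq_integral_of_symm_indicator stronglyMeasurable_kerK.aestronglyMeasurable U
    (A := fun _ => Set.univ) (fun _ => MeasurableSet.univ) (fun _ _ _ => le_rfl)
    (Eventually.of_forall fun s => ⟨0, trivial⟩) (fun n E hE hν _ => ?_) g hg
  refine (symm_apply_ae_eq hU _ (integrable_indicatorConstLp hE hν _)).trans
    (Eventually.of_forall fun x => ?_)
  simp only [conj_kerK]
  exact integral_mul_indicatorConstLp hE hν fun s => kerK s x

theorem symm_apply_ae_eq_kerK (hU : ∀ τ (hτ : 0 < τ),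
    U ((memLp_expX (Real.cosh_pos τ)).toLp _) = (memLp_sinS hτ).toLp _)
    (f : L2S) (hf : ∀ᵐ x ∂measX, Integrable (fun s => kerK s x * f s) measS) :
    U.symm f =ᵐ[measX] fun x => ∫ s, kerK s x * f s ∂measS := by
  refine ae_eq_integral_of_symm_indicator (k := fun x s => kerK s x)
    (stronglyMeasurable_kerK.comp_measurable measurable_swap).aestronglyMeasurable U.symm
    -- On $[1/(n+1),\infty)$ the majorant $K_0$ is bounded, so kernel times indicator is integrable
    -- on sets of finite measure and the formula already proved for `U` applies to these indicators.
    (A := fun n : ℕ => Set.Ici (1 / ((n : ℝ) + 1))) (fun _ => measurableSet_Ici)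
    (fun m n hmn => Set.Ici_subset_Ici.mpr ?_) ?_ (fun n E hE hν hEn => ?_) f hf
  · have : (m : ℝ) ≤ n := by exact_mod_cast hmn
    gcongr
  · filter_upwards [ae_measX_pos] with x hx
    obtain ⟨n, hn⟩ := exists_nat_one_div_lt hx
    exact ⟨n, hn.le⟩
  · have hfin : IsFiniteMeasure (measX.restrict E) := ⟨by
      rw [Measure.restrict_apply_univ]; exact hν.lt_top⟩
    rw [LinearIsometryEquiv.symm_symm]
    refine (apply_ae_eq_kerK hU _ (Eventually.of_forall fun s => ?_)).trans
      (Eventually.of_forall fun s => ?_)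
    · have h1 : IntegrableOn (fun x => kerK s x) E measX := by
        refine Integrable.mono' (integrable_const (kerBound (1 / ((n : ℝ) + 1))))
          (stronglyMeasurable_kerK.comp_measurable measurable_prodMk_left).aestronglyMeasurable ?_
        filter_upwards [ae_restrict_mem hE] with x hx
        exact (norm_kerK_le s x).trans (kerBound_anti (by positivity) (hEn hx))
      refine (h1.integrable_indicator hE).congr ?_
      filter_upwards [indicatorConstLp_coeFn (p := 2) (hs := hE) (hμs := hν) (c := (1 : ℂ))]
        with x hx
      rw [hx]
      by_cases h : x ∈ E <;> simp [h]
    · simp only [conj_kerK]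
      exact integral_mul_indicatorConstLp hE hν fun x => kerK s x

theorem apply_ae_eq_macdonaldK (hU : ∀ τ (hτ : 0 < τ),
    U ((memLp_expX (Real.cosh_pos τ)).toLp _) = (memLp_sinS hτ).toLp _) (g : L2X)
    (hg : ∀ᵐ s : ℝ ∂measS, Integrable (fun x : ℝ => macdonaldK (Complex.I * s) x * g x) measX) :
    U g =ᵐ[measS] fun s : ℝ => ∫ x : ℝ, macdonaldK (Complex.I * s) x * g x ∂measX := by
  have hK : ∀ s : ℝ, 0 < s → (fun x : ℝ => macdonaldK (Complex.I * s) x * g x) =ᵐ[measX]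
      fun x => kerK s x * g x := fun s hs => by
    filter_upwards [ae_measX_pos] with x hx
    rw [macdonaldK_eq_kerK hs hx]
  refine (apply_ae_eq_kerK hU g ?_).trans ?_
  · filter_upwards [hg, ae_measS_pos] with s hs hs0
    exact hs.congr (hK s hs0)
  · filter_upwards [ae_measS_pos] with s hs0
    exact (integral_congr_ae (hK s hs0)).symm

theorem symm_apply_ae_eq_macdonaldK (hU : ∀ τ (hτ : 0 < τ),
    U ((memLp_expX (Real.cosh_pos τ)).toLp _) = (memLp_sinS hτ).toLp _) (f : L2S)
    (hf : ∀ᵐ x : ℝ ∂measX, Integrable (fun s : ℝ => f s * macdonaldK (Complex.I * s) x) measS) :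
    U.symm f =ᵐ[measX] fun x : ℝ => ∫ s : ℝ, f s * macdonaldK (Complex.I * s) x ∂measS := by
  have hK : ∀ x : ℝ, 0 < x → (fun s : ℝ => f s * macdonaldK (Complex.I * s) x) =ᵐ[measS]
      fun s => kerK s x * f s := fun x hx => by
    filter_upwards [ae_measS_pos] with s hs
    rw [macdonaldK_eq_kerK hs hx, mul_comm]
  refine (symm_apply_ae_eq_kerK hU f ?_).trans ?_
  · filter_upwards [hf, ae_measX_pos] with x hx hx0
    exact hx.congr (hK x hx0)
  · filter_upwards [ae_measX_pos] with x hx0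
    exact (integral_congr_ae (hK x hx0)).symm

/-! ### A core of the multiplication operator and its image. -/

theorem arcosh_cosh_add_one_pos (τ : ℝ) : 0 < Real.arcosh (Real.cosh τ + 1) :=
  Real.arcosh_pos (by linarith [Real.one_le_cosh τ])

theorem cosh_arcosh_cosh_add_one (τ : ℝ) :
    Real.cosh (Real.arcosh (Real.cosh τ + 1)) = Real.cosh τ + 1 :=
  Real.cosh_arcosh (by linarith [Real.one_le_cosh τ])

/-- The functions `x (e^{-px} - e^{-(p+1)x})`, which span a core of `mulOp`. -/
noncomputable def coreX (p x : ℝ) : ℂ := expX p x - expX (p + 1) x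

/-- The images `2 (e^{-px} - e^{-(p+1)x})` of the functions `coreX p` under `mulOp`. -/
noncomputable def mulCoreX (p x : ℝ) : ℂ :=
  ((2 * (Real.exp (-(p * x)) - Real.exp (-((p + 1) * x))) : ℝ) : ℂ)

theorem memLp_coreX {p : ℝ} (hp : 0 < p) : MemLp (coreX p) 2 measX :=
  (memLp_expX hp).sub (memLp_expX (by linarith))

theorem mulCoreX_eq {p x : ℝ} (hx : 0 < x) : mulCoreX p x = ((2 / x : ℝ) : ℂ) * coreX p x := by
  rw [mulCoreX, coreX, expX, expX, ← Complex.ofReal_sub, ← Complex.ofReal_mul]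
  congr 1
  field_simp

theorem norm_mulCoreX_le {p x : ℝ} (hx : 0 < x) : ‖mulCoreX p x‖ ≤ 2 * ‖expX p x‖ := by
  rw [mulCoreX, expX, Complex.norm_real, Complex.norm_real,
    Real.norm_of_nonneg (by positivity : 0 ≤ x * Real.exp (-(p * x)))]
  have h1 : Real.exp (-((p + 1) * x)) = Real.exp (-(p * x)) * Real.exp (-x) := by
    rw [← Real.exp_add]; congr 1; ring
  have h2 : 1 - Real.exp (-x) ≤ x := by linarith [Real.add_one_le_exp (-x)]
  have h3 : 0 ≤ 1 - Real.exp (-x) := by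
    linarith [Real.exp_le_one_iff.mpr (by linarith : -x ≤ 0)]
  have h4 := Real.exp_pos (-(p * x))
  rw [h1, show 2 * (Real.exp (-(p * x)) - Real.exp (-(p * x)) * Real.exp (-x))
    = 2 * (Real.exp (-(p * x)) * (1 - Real.exp (-x))) by ring, Real.norm_of_nonneg (by positivity),
    mul_comm x]
  gcongr

/-- A single $e^{-px}$ is not square integrable for $dx/x$ at 0. The difference vanishes there to
first order, which is why the core is made of differences. -/
theorem memLp_mulCoreX {p : ℝ} (hp : 0 < p) : MemLp (mulCoreX p) 2 measX := by
  refine ((memLp_expX hp).const_smul (2 : ℂ)).mono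
    (Measurable.aestronglyMeasurable (by unfold mulCoreX; fun_prop)) ?_
  filter_upwards [ae_measX_pos] with x hx
  rw [Pi.smul_apply, norm_smul]
  simpa using norm_mulCoreX_le hx

theorem inner_expX_mulCoreX {p q : ℝ} (hp : 0 < p) (hq : 0 < q) :
    inner ℂ ((memLp_expX hq).toLp _) ((memLp_mulCoreX hp).toLp _)
      = ((2 / (q + p) - 2 / (q + (p + 1)) : ℝ) : ℂ) := by
  rw [inner_toLp_toLp, integral_measX]
  have i1 := integrableOn_exp_neg_mul_Ioi (r := q + p) (by positivity)
  have i2 := integrableOn_exp_neg_mul_Ioi (r := q + (p + 1)) (by positivity)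
  have h : ((2 / (q + p) - 2 / (q + (p + 1)) : ℝ) : ℂ) = ((∫ x in Set.Ioi (0 : ℝ),
      2 * (Real.exp (-(x * (q + p))) - Real.exp (-(x * (q + (p + 1))))) : ℝ) : ℂ) := by
    rw [integral_const_mul, integral_sub i1 i2, integral_exp_neg_mul_Ioi (by positivity),
      integral_exp_neg_mul_Ioi (by positivity)]
    congr 1; ring
  rw [h, ← integral_complex_ofReal]
  refine setIntegral_congr_fun measurableSet_Ioi fun x hx => ?_
  have hx' : 0 < x := hx
  simp only [expX, mulCoreX, Complex.conj_ofReal, exp_neg_mul_add]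
  rw [← Complex.ofReal_mul, ← Complex.ofReal_mul]
  congr 1
  rw [mul_comm x q]
  field_simp

/-- The images of the functions `mulCoreX`. -/
noncomputable def cosS (τ σ s : ℝ) : ℂ :=
  ((2 * Real.pi * (Real.cos (τ * s) - Real.cos (σ * s)) / (s * Real.sinh (Real.pi * s)) : ℝ) : ℂ)

theorem memLp_cosS (τ σ : ℝ) : MemLp (cosS τ σ) 2 measS := by
  have hmeas : Measurable (cosS τ σ) := by
    have : Measurable fun s : ℝ => s * Real.sinh (Real.pi * s) := by fun_prop
    exact Complex.measurable_ofReal.comp ((by fun_prop : Measurable fun s : ℝ =>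
      2 * Real.pi * (Real.cos (τ * s) - Real.cos (σ * s))).div this)
  refine memLp_measS hmeas ?_
  refine Integrable.mono' ((integrable_div_sinh.integrableOn (s := Set.Ioi 0)).const_mul
    (8 * (τ - σ) ^ 2)) ?_ ?_
  · have := continuous_dens
    fun_prop
  · filter_upwards [ae_restrict_mem measurableSet_Ioi] with s hs
    have hs' : 0 < s := hs
    have hsh := sinh_pi_pos hs
    have h1 : (Real.cos (τ * s) - Real.cos (σ * s)) ^ 2 ≤ ((τ - σ) * s) ^ 2 := by
      rw [sq_le_sq, sub_mul]
      have := Real.lipschitzWith_cos.dist_le_mul (τ * s) (σ * s)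
      simpa [Real.dist_eq] using this
    rw [Real.norm_of_nonneg (mul_nonneg (dens_pos hs).le (by positivity)), cosS,
      Complex.norm_real, Real.norm_eq_abs, sq_abs, dens]
    calc _ = 8 / (s * Real.sinh (Real.pi * s)) * (Real.cos (τ * s) - Real.cos (σ * s)) ^ 2 := by
          field_simp; ring
      _ ≤ 8 / (s * Real.sinh (Real.pi * s)) * ((τ - σ) * s) ^ 2 := by gcongr
      _ = _ := by field_simp

/-- Reduces the inner products of `sinS` with `cosS` to `integral_sin_div_sinh`. -/
theorem cos_mul_sin_div_sinh (τ σ s : ℝ) :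
    Real.cos (τ * s) * Real.sin (σ * s) / Real.sinh (Real.pi * s)
      = 1 / 2 * (Real.sin ((σ + τ) * s) / Real.sinh (Real.pi * s)
        + Real.sin ((σ - τ) * s) / Real.sinh (Real.pi * s)) := by
  rw [add_mul, sub_mul, Real.sin_add, Real.sin_sub]; ring

theorem integrable_cos_mul_sin_div_sinh (τ σ : ℝ) :
    Integrable fun s => Real.cos (τ * s) * Real.sin (σ * s) / Real.sinh (Real.pi * s) := by
  simp only [cos_mul_sin_div_sinh]
  exact ((integrable_sin_div_sinh _).add (integrable_sin_div_sinh _)).const_mul _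

theorem integral_cos_mul_sin_div_sinh (τ σ : ℝ) :
    ∫ s in Set.Ioi (0 : ℝ), Real.cos (τ * s) * Real.sin (σ * s) / Real.sinh (Real.pi * s)
      = 1 / 2 * (Real.sinh σ / (Real.cosh σ + Real.cosh τ)) := by
  simp only [cos_mul_sin_div_sinh]
  rw [integral_const_mul, integral_add (integrable_sin_div_sinh _).integrableOn
    (integrable_sin_div_sinh _).integrableOn, integral_sin_div_sinh, integral_sin_div_sinh,
    Real.tanh_eq_sinh_div_cosh, Real.tanh_eq_sinh_div_cosh, cosh_add_cosh]
  have h1 := Real.cosh_pos ((σ + τ) / 2)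
  have h2 := Real.cosh_pos ((σ - τ) / 2)
  have h3 := Real.sinh_add ((σ + τ) / 2) ((σ - τ) / 2)
  rw [show (σ + τ) / 2 + (σ - τ) / 2 = σ by ring] at h3
  rw [h3]
  field_simp

theorem inner_sinS_cosS {τ σ ρ : ℝ} (hρ : 0 < ρ) :
    inner ℂ ((memLp_sinS hρ).toLp _) ((memLp_cosS τ σ).toLp _)
      = ((2 / (Real.cosh ρ + Real.cosh τ) - 2 / (Real.cosh ρ + Real.cosh σ) : ℝ) : ℂ) := by
  have hsρ := Real.sinh_pos_iff.mpr hρ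
  rw [inner_toLp_toLp, integral_measS]
  have h : ((2 / (Real.cosh ρ + Real.cosh τ) - 2 / (Real.cosh ρ + Real.cosh σ) : ℝ) : ℂ)
      = ((∫ s in Set.Ioi (0 : ℝ), 4 / Real.sinh ρ *
        (Real.cos (τ * s) * Real.sin (ρ * s) / Real.sinh (Real.pi * s)
        - Real.cos (σ * s) * Real.sin (ρ * s) / Real.sinh (Real.pi * s)) : ℝ) : ℂ) := by
    rw [integral_const_mul, integral_sub (integrable_cos_mul_sin_div_sinh _ _).integrableOn
      (integrable_cos_mul_sin_div_sinh _ _).integrableOn, integral_cos_mul_sin_div_sinh,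
      integral_cos_mul_sin_div_sinh]
    have h1 := Real.cosh_pos ρ
    have h2 := Real.cosh_pos τ
    have h3 := Real.cosh_pos σ
    congr 1
    field_simp
    ring
  rw [h, ← integral_complex_ofReal]
  refine setIntegral_congr_fun measurableSet_Ioi fun s hs => ?_
  have hs' : 0 < s := hs
  have hsh := sinh_pi_pos hs
  simp only [sinS, cosS, Complex.conj_ofReal, dens]
  rw [← Complex.ofReal_mul, ← Complex.ofReal_mul]
  congr 1
  field_simp
  ring

theorem eq_of_inner_sinS {f g : L2S} (h : ∀ τ (hτ : 0 < τ),
    inner ℂ ((memLp_sinS hτ).toLp _) f = inner ℂ ((memLp_sinS hτ).toLp _) g) : f = g := by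
  rw [← sub_eq_zero]
  refine L2S_eq_zero fun τ hτ => ?_
  rw [inner_sub_right, h τ hτ, sub_self]

section

variable {U : L2X ≃ₗᵢ[ℂ] L2S}

/-- Its inner products with the total family `sinS` agree with those of `cosS`, by
`inner_expX_mulCoreX` and `inner_sinS_cosS`. -/
theorem apply_mulCoreX (hU : ∀ τ (hτ : 0 < τ),
    U ((memLp_expX (Real.cosh_pos τ)).toLp _) = (memLp_sinS hτ).toLp _) (τ : ℝ) :
    U ((memLp_mulCoreX (Real.cosh_pos τ)).toLp _)
      = (memLp_cosS τ (Real.arcosh (Real.cosh τ + 1))).toLp _ := by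
  refine eq_of_inner_sinS fun ρ hρ => ?_
  rw [inner_sinS_cosS hρ, ← hU ρ hρ, U.inner_map_map,
    inner_expX_mulCoreX (Real.cosh_pos τ) (Real.cosh_pos ρ), cosh_arcosh_cosh_add_one]

theorem apply_expX {U : L2X ≃ₗᵢ[ℂ] L2S} (hU : ∀ τ (hτ : 0 < τ),
    U ((memLp_expX (Real.cosh_pos τ)).toLp _) = (memLp_sinS hτ).toLp _) {p : ℝ} (hp : 1 < p)
    (hp' : 0 < p) : U ((memLp_expX hp').toLp _) = (memLp_sinS (Real.arcosh_pos hp)).toLp _ := by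
  rw [← hU _ (Real.arcosh_pos hp)]
  congr 1
  simp only [Real.cosh_arcosh hp.le]

theorem apply_coreX (hU : ∀ τ (hτ : 0 < τ),
    U ((memLp_expX (Real.cosh_pos τ)).toLp _) = (memLp_sinS hτ).toLp _) {τ : ℝ} (hτ : 0 < τ) :
    U ((memLp_coreX (Real.cosh_pos τ)).toLp _)
      =ᵐ[measS] fun s => sinS τ s - sinS (Real.arcosh (Real.cosh τ + 1)) s := by
  have hp : 1 < Real.cosh τ + 1 := by linarith [Real.cosh_pos τ]
  have hp' : 0 < Real.cosh τ + 1 := by linarith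
  have h1 : (memLp_coreX (Real.cosh_pos τ)).toLp _ = (memLp_expX (Real.cosh_pos τ)).toLp _
      - (memLp_expX hp').toLp _ := rfl
  rw [h1, map_sub, hU τ hτ, apply_expX hU hp hp']
  filter_upwards [Lp.coeFn_sub ((memLp_sinS hτ).toLp _) ((memLp_sinS (Real.arcosh_pos hp)).toLp _),
    (memLp_sinS hτ).coeFn_toLp, (memLp_sinS (Real.arcosh_pos hp)).coeFn_toLp] with s h1 h2 h3
  rw [h1, Pi.sub_apply, h2, h3]

end

/-! ### Holomorphic extension of the core functions: membership in $\mathcal H[w]$. -/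

theorem exists_eq_sub_mul {f : ℂ → ℂ} (hf : Differentiable ℂ f) {c : ℂ} (hc : f c = 0) :
    ∃ g : ℂ → ℂ, Differentiable ℂ g ∧ ∀ z, f z = (z - c) * g z := by
  refine ⟨dslope f c, ?_, fun z => ?_⟩
  · rw [← differentiableOn_univ] at hf ⊢
    exact (Complex.differentiableOn_dslope Filter.univ_mem).mpr hf
  · have := sub_smul_dslope f c z
    rw [hc, sub_zero, smul_eq_mul] at this
    exact this.symm

/-- An odd entire function vanishing at `i` is the product of `z (z² + 1)` and an even entire
function. -/
theorem exists_eq_mul_of_odd {f : ℂ → ℂ} (hf : Differentiable ℂ f) (hodd : ∀ z, f (-z) = -f z)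
    (hI : f Complex.I = 0) :
    ∃ g : ℂ → ℂ, Differentiable ℂ g ∧ (∀ z, g (-z) = g z) ∧ ∀ z, f z = z * (z ^ 2 + 1) * g z := by
  have h0 : f 0 = 0 := by
    have := hodd 0
    rw [neg_zero] at this
    exact self_eq_neg.mp this
  obtain ⟨g₁, d₁, e₁⟩ := exists_eq_sub_mul hf h0
  have hI₁ : g₁ Complex.I = 0 := by
    have := e₁ Complex.I
    rw [hI, sub_zero] at this
    exact (mul_eq_zero.mp this.symm).resolve_left Complex.I_ne_zero
  obtain ⟨g₂, d₂, e₂⟩ := exists_eq_sub_mul d₁ hI₁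
  have hI₂ : g₂ (-Complex.I) = 0 := by
    have h := e₁ (-Complex.I)
    rw [hodd, hI, e₂, neg_zero, sub_zero] at h
    have h' : (2 : ℂ) * g₂ (-Complex.I) = 0 := by
      linear_combination h + 2 * g₂ (-Complex.I) * Complex.I_sq
    exact (mul_eq_zero.mp h').resolve_left two_ne_zero
  obtain ⟨g₃, d₃, e₃⟩ := exists_eq_sub_mul d₂ hI₂
  have e : ∀ z, f z = z * (z ^ 2 + 1) * g₃ z := fun z => by
    rw [e₁, e₂, e₃]
    linear_combination (-(z * g₃ z)) * Complex.I_sq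
  -- Symmetrising makes the quotient even everywhere, including at the zeros of $z(z^2+1)$, and
  -- keeps the factorisation because the left side is odd.
  refine ⟨fun z => (g₃ z + g₃ (-z)) / 2, by fun_prop, fun z => ?_, fun z => ?_⟩
  · simp only [neg_neg, add_comm]
  · have h1 := e (-z)
    rw [hodd] at h1
    linear_combination (1 / 2) * e z - (1 / 2) * h1

theorem norm_sin_le (z : ℂ) : ‖Complex.sin z‖ ≤ Real.exp |z.im| := by
  have h : ‖Complex.exp (-z * Complex.I) - Complex.exp (z * Complex.I)‖
      ≤ Real.exp |z.im| + Real.exp |z.im| := by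
    refine (norm_sub_le _ _).trans ?_
    rw [Complex.norm_exp, Complex.norm_exp]
    refine add_le_add (Real.exp_le_exp.mpr ?_) (Real.exp_le_exp.mpr ?_)
    · simpa using le_abs_self z.im
    · simpa using neg_le_abs z.im
  rw [Complex.sin, norm_div, norm_mul, Complex.norm_I, mul_one, Complex.norm_ofNat]
  linarith

theorem sinh_abs_re_le_norm_sinh (z : ℂ) : Real.sinh |z.re| ≤ ‖Complex.sinh z‖ := by
  have h : |Real.exp z.re - Real.exp (-z.re)| ≤ ‖Complex.exp z - Complex.exp (-z)‖ := by
    have := abs_norm_sub_norm_le (Complex.exp z) (Complex.exp (-z))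
    rwa [Complex.norm_exp, Complex.norm_exp, Complex.neg_re] at this
  rw [← Real.abs_sinh, Complex.sinh, norm_div, Complex.norm_ofNat, Real.sinh_eq, abs_div, abs_two]
  linarith

theorem exp_div_four_le_sinh {x : ℝ} (hx : 1 ≤ x) : Real.exp x / 4 ≤ Real.sinh x := by
  have h1 : 2 ≤ Real.exp x := by linarith [Real.add_one_le_exp x]
  have h2 : Real.exp (-x) ≤ 1 := Real.exp_le_one_iff.mpr (by linarith)
  rw [Real.sinh_eq]
  linarith

/-- The numerator of the difference `sinS τ - sinS σ`. -/
noncomputable def sinDiff (τ σ : ℝ) (z : ℂ) : ℂ :=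
  Real.pi * (Complex.sin (τ * z) / Real.sinh τ - Complex.sin (σ * z) / Real.sinh σ)

theorem differentiable_sinDiff (τ σ : ℝ) : Differentiable ℂ (sinDiff τ σ) := by
  unfold sinDiff
  fun_prop

theorem sinDiff_neg (τ σ : ℝ) (z : ℂ) : sinDiff τ σ (-z) = -sinDiff τ σ z := by
  simp only [sinDiff, mul_neg, Complex.sin_neg]
  ring

theorem sin_mul_I_div_sinh {τ : ℝ} (hτ : 0 < τ) :
    Complex.sin (τ * Complex.I) / Real.sinh τ = Complex.I := by
  have : ((Real.sinh τ : ℝ) : ℂ) ≠ 0 := Complex.ofReal_ne_zero.mpr (Real.sinh_pos_iff.mpr hτ).ne'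
  rw [Complex.sin_mul_I, ← Complex.ofReal_sinh, mul_div_right_comm, div_self this,
    one_mul]

/-- $\sin(i\tau)/\sinh\tau=i$ for every $\tau$. This zero cancels that of $\sinh\pi z$ at $z=i$,
which no single function `sinS` could achieve. -/
theorem sinDiff_I {τ σ : ℝ} (hτ : 0 < τ) (hσ : 0 < σ) : sinDiff τ σ Complex.I = 0 := by
  rw [sinDiff, sin_mul_I_div_sinh hτ, sin_mul_I_div_sinh hσ, sub_self, mul_zero]

theorem sin_mul_add_I_div_sinh {τ : ℝ} (hτ : 0 < τ) (z : ℂ) :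
    Complex.sin (τ * (z + Complex.I)) / Real.sinh τ
      = Complex.sin (τ * z) * Real.cosh τ / Real.sinh τ + Complex.cos (τ * z) * Complex.I := by
  have : ((Real.sinh τ : ℝ) : ℂ) ≠ 0 := Complex.ofReal_ne_zero.mpr (Real.sinh_pos_iff.mpr hτ).ne'
  rw [mul_add, Complex.sin_add_mul_I, ← Complex.ofReal_sinh, ← Complex.ofReal_cosh]
  field_simp

theorem sin_mul_sub_I_div_sinh {τ : ℝ} (hτ : 0 < τ) (z : ℂ) :
    Complex.sin (τ * (z - Complex.I)) / Real.sinh τ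
      = Complex.sin (τ * z) * Real.cosh τ / Real.sinh τ - Complex.cos (τ * z) * Complex.I := by
  have h := sin_mul_add_I_div_sinh hτ (-z)
  rw [show (τ : ℂ) * (-z + Complex.I) = -(τ * (z - Complex.I)) by ring, mul_neg, Complex.sin_neg,
    Complex.sin_neg, Complex.cos_neg] at h
  linear_combination -h

theorem sinDiff_sub_I_sub {τ σ : ℝ} (hτ : 0 < τ) (hσ : 0 < σ) (z : ℂ) :
    sinDiff τ σ (z - Complex.I) - sinDiff τ σ (z + Complex.I)
      = -(2 * Real.pi * Complex.I) * (Complex.cos (τ * z) - Complex.cos (σ * z)) := by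
  simp only [sinDiff, sin_mul_add_I_div_sinh hτ, sin_mul_add_I_div_sinh hσ,
    sin_mul_sub_I_div_sinh hτ, sin_mul_sub_I_div_sinh hσ]
  ring

theorem exists_norm_sinDiff_le (τ σ r : ℝ) : ∃ C : ℝ, 0 ≤ C ∧ ∀ z : ℂ, |z.im| ≤ r →
    ‖sinDiff τ σ z‖ ≤ C := by
  refine ⟨Real.pi * (Real.exp (|τ| * r) / |Real.sinh τ| + Real.exp (|σ| * r) / |Real.sinh σ|),
    by positivity, fun z hz => ?_⟩
  have key : ∀ ρ : ℝ, ‖Complex.sin (ρ * z) / Real.sinh ρ‖ ≤ Real.exp (|ρ| * r) / |Real.sinh ρ| := by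
    intro ρ
    rw [norm_div, Complex.norm_real, Real.norm_eq_abs]
    gcongr
    refine (norm_sin_le _).trans (Real.exp_le_exp.mpr ?_)
    rw [Complex.im_ofReal_mul, abs_mul]
    gcongr
  rw [sinDiff, norm_mul, Complex.norm_real, Real.norm_of_nonneg Real.pi_pos.le]
  gcongr
  exact (norm_sub_le _ _).trans (add_le_add (key τ) (key σ))

/-- The left side is holomorphic for $|\mathrm{Im}\,z|<2$, so it supplies the values of $\pi
z(z^2+1)/\sinh\pi z$ at the removable singularities $0,\pm i$. -/
theorem Gamma_two_add_mul_Gamma_two_sub {z : ℂ} (hz : Complex.sinh (Real.pi * z) ≠ 0) :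
    Complex.Gamma (2 + Complex.I * z) * Complex.Gamma (2 - Complex.I * z)
      = Real.pi * (z * (z ^ 2 + 1)) / Complex.sinh (Real.pi * z) := by
  have hs : Complex.sin (Real.pi * (Complex.I * z)) = Complex.sinh (Real.pi * z) * Complex.I := by
    rw [← Complex.sin_mul_I]; congr 1; ring
  have hne : Complex.sin (Real.pi * (Complex.I * z)) ≠ 0 := by
    rw [hs]; exact mul_ne_zero hz Complex.I_ne_zero
  have h0 : Complex.I * z ≠ 0 := fun h => hne (by rw [h, mul_zero, Complex.sin_zero])
  have h1 : 1 + Complex.I * z ≠ 0 := fun h => hne (by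
    rw [eq_neg_of_add_eq_zero_right h, mul_neg_one, Complex.sin_neg, Complex.sin_pi, neg_zero])
  have h2 : 1 - Complex.I * z ≠ 0 := fun h => hne (by
    rw [← sub_eq_zero.mp h, mul_one, Complex.sin_pi])
  rw [show 2 + Complex.I * z = (1 + Complex.I * z) + 1 by ring, Complex.Gamma_add_one _ h1,
    add_comm 1 (Complex.I * z), Complex.Gamma_add_one _ h0,
    show 2 - Complex.I * z = (1 - Complex.I * z) + 1 by ring, Complex.Gamma_add_one _ h2]
  have h3 := Complex.Gamma_mul_Gamma_one_sub (Complex.I * z)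
  rw [hs] at h3
  have h4 : Complex.Gamma (Complex.I * z) * Complex.Gamma (1 - Complex.I * z)
      * (Complex.sinh (Real.pi * z) * Complex.I) = Real.pi := by
    rw [h3, div_mul_cancel₀ _ (mul_ne_zero hz Complex.I_ne_zero)]
  rw [eq_div_iff hz]
  linear_combination (z * (z ^ 2 + 1)) * h4 - (z * (z ^ 2 * Complex.Gamma (Complex.I * z)
    * Complex.Gamma (1 - Complex.I * z) * Complex.sinh (Real.pi * z) * Complex.I)) * Complex.I_sq

/-- An even function, holomorphic for `|Im z| < 2`, which is the quotient
`sinDiff τ σ z / sinh (π z)` where the latter is defined. -/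
theorem exists_even_eq_sinDiff_div {τ σ : ℝ} (hτ : 0 < τ) (hσ : 0 < σ) :
    ∃ F : ℂ → ℂ, DifferentiableOn ℂ F {s | |s.im| < 1 + 1} ∧ (∀ z, F (-z) = F z) ∧
      ∀ z, Complex.sinh (Real.pi * z) ≠ 0 → F z = sinDiff τ σ z / Complex.sinh (Real.pi * z) := by
  obtain ⟨g, hg, heven, hfac⟩ := exists_eq_mul_of_odd (differentiable_sinDiff τ σ)
    (sinDiff_neg τ σ) (sinDiff_I hτ hσ)
  have hG : ∀ w : ℂ, 0 < w.re → DifferentiableAt ℂ Complex.Gamma w := fun w hw =>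
    Complex.differentiableAt_Gamma _ fun m h => by
      rw [h] at hw
      simp at hw
      linarith [(Nat.cast_nonneg m : (0 : ℝ) ≤ m)]
  refine ⟨fun z => Complex.Gamma (2 + Complex.I * z) * Complex.Gamma (2 - Complex.I * z) * g z
    / Real.pi, fun z (hz : |z.im| < 1 + 1) => ?_, fun z => ?_, fun z hz => ?_⟩
  · have hz' := abs_lt.mp hz
    have h1 := hG (2 + Complex.I * z) (by simp; linarith)
    have h2 := hG (2 - Complex.I * z) (by simp; linarith)
    have h3 : DifferentiableAt ℂ (fun z => Complex.Gamma (2 + Complex.I * z)) z :=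
      h1.comp z (by fun_prop)
    have h4 : DifferentiableAt ℂ (fun z => Complex.Gamma (2 - Complex.I * z)) z :=
      h2.comp z (by fun_prop)
    exact (((h3.mul h4).mul hg.differentiableAt).div_const _).differentiableWithinAt
  · simp only [heven, mul_neg, sub_neg_eq_add, ← sub_eq_add_neg]
    ring
  · have hpi : (Real.pi : ℂ) ≠ 0 := Complex.ofReal_ne_zero.mpr Real.pi_ne_zero
    simp only [Gamma_two_add_mul_Gamma_two_sub hz, hfac]
    field_simp

theorem sinh_pi_mul_ne_zero {z : ℂ} (hz : z.re ≠ 0) : Complex.sinh (Real.pi * z) ≠ 0 := by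
  have h1 := sinh_abs_re_le_norm_sinh (Real.pi * z)
  have h2 : 0 < Real.sinh |(Real.pi * z : ℂ).re| := by
    rw [Real.sinh_pos_iff, abs_pos, Complex.re_ofReal_mul]
    exact mul_ne_zero Real.pi_ne_zero hz
  exact norm_pos_iff.mp (h2.trans_le h1)

theorem exp_div_four_le_norm_sinh {z : ℂ} (hz : 1 ≤ |z.re|) :
    Real.exp (Real.pi * |z.re|) / 4 ≤ ‖Complex.sinh (Real.pi * z)‖ := by
  have h1 := sinh_abs_re_le_norm_sinh (Real.pi * z)
  rw [Complex.re_ofReal_mul, abs_mul, abs_of_pos Real.pi_pos] at h1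
  refine (exp_div_four_le_sinh ?_).trans h1
  nlinarith [Real.pi_gt_three]

theorem norm_le_abs_re_add_one {z : ℂ} (hz : |z.im| ≤ 1) : ‖z‖ ≤ |z.re| + 1 :=
  (Complex.norm_le_abs_re_add_abs_im z).trans (by linarith)

theorem isEvenWDecreasing_of_exp {F : ℂ → ℂ} {δ C : ℝ} (hδ : 0 < δ)
    (hd : DifferentiableOn ℂ F {s | |s.im| < 1 + δ}) (he : ∀ z, F (-z) = F z)
    (hC : ∀ z : ℂ, |z.im| ≤ 1 → 1 ≤ |z.re| → ‖F z‖ ≤ C * Real.exp (-(Real.pi * |z.re|))) :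
    IsEvenWDecreasing F := by
  -- With $\varepsilon=1/2$ the required bound is $|z|^{-3/2}e^{-\pi|\mathrm{Re}\,z|/2}$. The spare
  -- factor $e^{-\pi|\mathrm{Re}\,z|/2}$ absorbs the power of $|z|$.
  refine ⟨⟨δ, hδ, hd, fun s _ => he s⟩, 1 / 2, by norm_num, ?_⟩
  have hC0 : 0 ≤ C := by
    have h := (norm_nonneg _).trans (hC 1 (by simp) (by simp))
    exact nonneg_of_mul_nonneg_left h (Real.exp_pos _)
  refine Asymptotics.IsBigO.of_bound (C * (2 * Real.exp 1)) ?_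
  -- In the strip $|\mathrm{Im}\,z|\le1$, $|z|\ge2$ forces $|\mathrm{Re}\,z|\ge1$.
  have h1 : ∀ᶠ s : ℂ in Bornology.cobounded ℂ, 2 ≤ ‖s‖ :=
    tendsto_norm_cobounded_atTop.eventually_ge_atTop 2
  filter_upwards [h1.filter_mono inf_le_left, mem_inf_of_right (mem_principal_self _)]
    with z hz (him : |z.im| ≤ 1)
  have hre : ‖z‖ ≤ |z.re| + 1 := norm_le_abs_re_add_one him
  have hz0 : 0 < ‖z‖ := by linarith
  refine (hC z him (by linarith)).trans ?_
  rw [mul_assoc]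
  gcongr
  rw [Real.norm_of_nonneg (by unfold weightPsi; positivity), weightPsi,
    Real.mul_rpow hz0.le (Real.exp_pos _).le, ← Real.exp_mul]
  have e1 : ‖z‖ ^ (-(1 / 2) : ℝ) * Real.exp (Real.pi * |z.re| * -(1 / 2))
      * ‖z‖ ^ (-(1 / 2) - 1 / 2 : ℝ)
      = Real.exp (-(Real.pi * |z.re| / 2)) * ‖z‖ ^ (-(3 / 2) : ℝ) := by
    rw [mul_right_comm, ← Real.rpow_add hz0, mul_comm]
    congr 2 <;> ring
  have e2 : Real.exp (-(Real.pi * |z.re|))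
      = Real.exp (-(Real.pi * |z.re| / 2)) * Real.exp (-(Real.pi * |z.re| / 2)) := by
    rw [← Real.exp_add]; congr 1; ring
  rw [e1, e2, mul_left_comm]
  gcongr
  -- Passing to the exponent $-2$ allows the bound $u^2/2\le e^u$ with $u=|\mathrm{Re}\,z|+1$.
  have h2 : ‖z‖ ^ (-2 : ℝ) ≤ ‖z‖ ^ (-(3 / 2) : ℝ) :=
    Real.rpow_le_rpow_of_exponent_le (by linarith) (by norm_num)
  refine le_trans ?_ (mul_le_mul_of_nonneg_left h2 (by positivity))
  rw [Real.rpow_neg hz0.le, Real.rpow_two, Real.exp_neg, ← div_eq_mul_inv,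
    le_div_iff₀ (by positivity), inv_mul_le_iff₀ (Real.exp_pos _)]
  have h3 : (|z.re| + 1) ^ 2 / 2 ≤ Real.exp (|z.re| + 1) := by
    linarith [Real.quadratic_le_exp_of_nonneg (x := |z.re| + 1) (by positivity),
      abs_nonneg z.re]
  have h4 : ‖z‖ ^ 2 ≤ (|z.re| + 1) ^ 2 := by gcongr
  have h5 : Real.exp |z.re| ≤ Real.exp (Real.pi * |z.re| / 2) :=
    Real.exp_le_exp.mpr (by nlinarith [Real.pi_gt_three, abs_nonneg z.re])
  rw [Real.exp_add] at h3
  nlinarith [Real.exp_pos 1]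

theorem sinh_pi_mul_add_I (z : ℂ) :
    Complex.sinh (Real.pi * (z + Complex.I)) = -Complex.sinh (Real.pi * z) := by
  rw [mul_add, Complex.sinh_add, Complex.cosh_mul_I, Complex.sinh_mul_I, Complex.sin_pi,
    Complex.cos_pi]
  ring

theorem sinh_pi_mul_sub_I (z : ℂ) :
    Complex.sinh (Real.pi * (z - Complex.I)) = -Complex.sinh (Real.pi * z) := by
  rw [mul_sub, Complex.sinh_sub, Complex.cosh_mul_I, Complex.sinh_mul_I, Complex.sin_pi,
    Complex.cos_pi]
  ring

/-- Shifting by $\pm i$ only changes the sign of $\sinh\pi z$, so the difference expression acts on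
the numerator, where the addition theorem leaves the cosines of `cosS`. -/
theorem exists_isEvenWDecreasing {τ σ : ℝ} (hτ : 0 < τ) (hσ : 0 < σ) :
    ∃ F : ℂ → ℂ, IsEvenWDecreasing F ∧ (∀ s : ℝ, 0 < s → F s = sinS τ s - sinS σ s) ∧
      ∀ s : ℝ, 0 < s → diffExpr F s = cosS τ σ s := by
  obtain ⟨F, hd, he, hF⟩ := exists_even_eq_sinDiff_div hτ hσ
  refine ⟨F, ?_, fun s hs => ?_, fun s hs => ?_⟩
  · obtain ⟨C, hC0, hC⟩ := exists_norm_sinDiff_le τ σ 1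
    refine isEvenWDecreasing_of_exp (C := C * 4) one_pos hd he fun z h1 h2 => ?_
    have h3 : z.re ≠ 0 := fun h => by rw [h, abs_zero] at h2; linarith
    rw [hF z (sinh_pi_mul_ne_zero h3), norm_div, Real.exp_neg,
      show C * 4 * (Real.exp (Real.pi * |z.re|))⁻¹ = C / (Real.exp (Real.pi * |z.re|) / 4) by
        field_simp]
    exact div_le_div₀ hC0 (hC z h1) (by positivity) (exp_div_four_le_norm_sinh h2)
  · have hsτ := (Real.sinh_pos_iff.mpr hτ).ne'
    have hsσ := (Real.sinh_pos_iff.mpr hσ).ne'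
    have hsh := (sinh_pi_pos hs).ne'
    rw [hF s (sinh_pi_mul_ne_zero (by simpa using hs.ne')), sinDiff, sinS, sinS]
    simp only [← Complex.ofReal_mul, ← Complex.ofReal_sin, ← Complex.ofReal_sinh,
      ← Complex.ofReal_div, ← Complex.ofReal_sub]
    congr 1
    field_simp
  · have hsh := (sinh_pi_pos hs).ne'
    have hsC : (s : ℂ) ≠ 0 := Complex.ofReal_ne_zero.mpr hs.ne'
    have hshC : Complex.sinh (Real.pi * s) ≠ 0 := sinh_pi_mul_ne_zero (by simpa using hs.ne')
    rw [diffExpr, hF _ (sinh_pi_mul_ne_zero (by simpa using hs.ne')),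
      hF _ (sinh_pi_mul_ne_zero (by simpa using hs.ne')), sinh_pi_mul_add_I, sinh_pi_mul_sub_I,
      ← sub_div, sinDiff_sub_I_sub hτ hσ, cosS]
    push_cast
    field_simp

theorem mem_diffGraph_of_apply {U : L2X ≃ₗᵢ[ℂ] L2S} (hU : ∀ τ (hτ : 0 < τ),
    U ((memLp_expX (Real.cosh_pos τ)).toLp _) = (memLp_sinS hτ).toLp _) {τ : ℝ} (hτ : 0 < τ) :
    (U ((memLp_coreX (Real.cosh_pos τ)).toLp _), U ((memLp_mulCoreX (Real.cosh_pos τ)).toLp _))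
      ∈ diffGraph := by
  obtain ⟨F, hF, h1, h2⟩ := exists_isEvenWDecreasing hτ (arcosh_cosh_add_one_pos τ)
  refine ⟨F, hF, ?_, ?_⟩
  · filter_upwards [apply_coreX hU hτ, ae_measS_pos] with s hs hs'
    rw [hs, h1 s hs']
  · rw [apply_mulCoreX hU]
    filter_upwards [(memLp_cosS τ (Real.arcosh (Real.cosh τ + 1))).coeFn_toLp, ae_measS_pos]
      with s hs hs'
    rw [hs, h2 s hs']

/-! ### The contour shift and the symmetry of the difference operator against the core. -/

theorem integral_eq_integral_Ioi_add_comp_neg {g : ℝ → ℂ} (hg : Integrable g) :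
    ∫ s, g s = ∫ s in Set.Ioi (0 : ℝ), (g s + g (-s)) := by
  rw [integral_add hg.integrableOn hg.comp_neg.integrableOn, integral_comp_neg_Ioi, neg_zero,
    add_comm, intervalIntegral.integral_Iic_add_Ioi hg.integrableOn hg.integrableOn]

theorem tendsto_exp_neg_mul_atTop {c : ℝ} (hc : 0 < c) (C : ℝ) :
    Tendsto (fun R : ℝ => C * Real.exp (-(c * R))) atTop (𝓝 0) := by
  have h := (Real.tendsto_exp_neg_atTop_nhds_zero.comp (tendsto_id.const_mul_atTop hc)).const_mul C
  rw [mul_zero] at h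
  exact h

section

variable {G : ℂ → ℂ} {δ C c : ℝ}

theorem integrable_of_strip (hδ : 0 < δ) (hd : DifferentiableOn ℂ G {s | |s.im| < 1 + δ})
    (hc : 0 < c) (hb : ∀ z : ℂ, |z.im| ≤ 1 → ‖G z‖ ≤ C * Real.exp (-(c * |z.re|))) {y : ℝ}
    (hy : |y| ≤ 1) : Integrable fun s : ℝ => G (s + y * Complex.I) := by
  have hcont : Continuous fun s : ℝ => G (s + y * Complex.I) :=
    hd.continuousOn.comp_continuous (by fun_prop) fun s => by
      change |((s : ℂ) + y * Complex.I).im| < 1 + δ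
      simp
      linarith
  refine ((integrable_exp_neg_mul_abs hc).const_mul C).mono' hcont.aestronglyMeasurable
    (Eventually.of_forall fun s => ?_)
  have := hb (s + y * Complex.I) (by simpa using hy)
  simpa using this

/-- Cauchy's theorem on $[-R,R]\times[-1,0]$; the vertical sides are $O(e^{-cR})$. -/
theorem integral_sub_I_eq (hδ : 0 < δ) (hd : DifferentiableOn ℂ G {s | |s.im| < 1 + δ})
    (hc : 0 < c) (hb : ∀ z : ℂ, |z.im| ≤ 1 → ‖G z‖ ≤ C * Real.exp (-(c * |z.re|))) :
    ∫ s : ℝ, G (s - Complex.I) = ∫ s : ℝ, G s := by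
  have key : ∀ y : ℝ, |y| ≤ 1 → Tendsto (fun R : ℝ => ∫ x in -R..R, G (x + y * Complex.I)) atTop
      (𝓝 (∫ s : ℝ, G (s + y * Complex.I))) := fun y hy =>
    intervalIntegral_tendsto_integral (integrable_of_strip hδ hd hc hb hy)
      tendsto_neg_atTop_atBot tendsto_id
  have side : ∀ ε : ℝ, |ε| = 1 → Tendsto (fun R : ℝ => Complex.I • ∫ y in (-1 : ℝ)..0,
      G ((ε * R : ℝ) + y * Complex.I)) atTop (𝓝 0) := by
    intro ε hε
    refine squeeze_zero_norm' ?_ (tendsto_exp_neg_mul_atTop hc C)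
    filter_upwards [eventually_ge_atTop 0] with R hR
    rw [norm_smul, Complex.norm_I, one_mul]
    have := intervalIntegral.norm_integral_le_of_norm_le_const (a := (-1 : ℝ)) (b := 0)
      (f := fun y : ℝ => G ((ε * R : ℝ) + y * Complex.I)) (C := C * Real.exp (-(c * R))) ?_
    · simpa using this
    · intro y hy
      rw [Set.uIoc_of_le (by norm_num)] at hy
      have h := hb ((ε * R : ℝ) + y * Complex.I) (by
        simp only [Complex.add_im, Complex.ofReal_im, Complex.im_ofReal_mul, Complex.I_im, mul_one,
          zero_add]
        exact abs_le.mpr ⟨hy.1.le, by linarith [hy.2]⟩)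
      have e : ((ε * R : ℝ) + y * Complex.I : ℂ).re = ε * R := by simp
      rwa [e, abs_mul, hε, one_mul, abs_of_nonneg hR] at h
  have rect : ∀ R : ℝ, (∫ x in -R..R, G (x + (-1 : ℝ) * Complex.I))
      - (∫ x in -R..R, G (x + (0 : ℝ) * Complex.I))
      + Complex.I • (∫ y in (-1 : ℝ)..0, G ((1 * R : ℝ) + y * Complex.I))
      - Complex.I • (∫ y in (-1 : ℝ)..0, G ((-1 * R : ℝ) + y * Complex.I)) = 0 := by
    intro R
    have := Complex.integral_boundary_rect_eq_zero_of_differentiableOn G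
      (⟨-R, -1⟩ : ℂ) (⟨R, 0⟩ : ℂ) (hd.mono ?_)
    · simpa only [one_mul, neg_one_mul] using this
    · rintro z ⟨-, hz⟩
      change z.im ∈ Set.uIcc (-1 : ℝ) 0 at hz
      rw [Set.uIcc_of_le (by norm_num)] at hz
      change |z.im| < 1 + δ
      exact abs_lt.mpr ⟨by linarith [hz.1], by linarith [hz.2]⟩
  have lim := (((key (-1) (by simp)).sub (key 0 (by simp))).add (side 1 (by simp))).sub
    (side (-1) (by simp))
  simp only [rect, add_zero, sub_zero] at lim
  have h := tendsto_nhds_unique tendsto_const_nhds lim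
  have h' := sub_eq_zero.mp h.symm
  simpa [sub_eq_add_neg] using h'

end

/-- For $|z|\ge1$ the powers of $|z|$ in the decay condition are at most 1 and may be dropped; the
remaining part of the strip is compact. -/
theorem IsEvenWDecreasing.exists_norm_le {F : ℂ → ℂ} (hF : IsEvenWDecreasing F) :
    ∃ C : ℝ, 0 ≤ C ∧ ∀ z : ℂ, |z.im| ≤ 1 → ‖F z‖ ≤ C * Real.exp (-(Real.pi / 2 * |z.re|)) := by
  obtain ⟨⟨δ, hδ, hd, -⟩, ε, hε, hO⟩ := hF
  obtain ⟨c, hc, hO⟩ := hO.exists_nonneg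
  have hO' := hO.bound
  rw [eventually_inf_principal] at hO'
  obtain ⟨R, -, hR⟩ := hasBasis_cobounded_norm.eventually_iff.mp hO'
  have hK : IsCompact (Metric.closedBall (0 : ℂ) (max R 1) ∩ {s : ℂ | |s.im| ≤ 1}) :=
    (isCompact_closedBall _ _).inter_right (isClosed_le (by fun_prop) continuous_const)
  obtain ⟨C', hC'⟩ := hK.exists_bound_of_continuousOn (f := F) (hd.continuousOn.mono
    fun z hz => (lt_of_le_of_lt hz.2 (by linarith) : |z.im| < 1 + δ))
  have hC'0 : 0 ≤ C' := (norm_nonneg _).trans (hC' 0 ⟨by simp, by simp⟩)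
  refine ⟨c + C' * Real.exp (Real.pi / 2 * max R 1), by positivity, fun z hz => ?_⟩
  rw [add_mul]
  rcases le_total ‖z‖ (max R 1) with h | h
  · have h1 : ‖F z‖ ≤ C' * Real.exp (Real.pi / 2 * max R 1)
        * Real.exp (-(Real.pi / 2 * |z.re|)) := by
      refine (hC' z ⟨by simpa using h, hz⟩).trans ?_
      rw [mul_assoc, ← Real.exp_add]
      refine le_mul_of_one_le_right hC'0 (Real.one_le_exp ?_)
      have : |z.re| ≤ max R 1 := (Complex.abs_re_le_norm z).trans h
      nlinarith [Real.pi_pos]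
    have h2 : 0 ≤ c * Real.exp (-(Real.pi / 2 * |z.re|)) := by positivity
    linarith
  · have h0 : 1 ≤ ‖z‖ := (le_max_right _ _).trans h
    have h1 : ‖F z‖ ≤ c * Real.exp (-(Real.pi / 2 * |z.re|)) := by
      refine (hR (show R ≤ ‖z‖ from (le_max_left _ _).trans h) hz).trans ?_
      gcongr
      rw [Real.norm_of_nonneg (by unfold weightPsi; positivity), weightPsi,
        Real.mul_rpow (norm_nonneg _) (Real.exp_pos _).le, ← Real.exp_mul,
        show Real.pi * |z.re| * -(1 / 2) = -(Real.pi / 2 * |z.re|) by ring]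
      have e1 : ‖z‖ ^ (-(1 / 2) : ℝ) ≤ 1 := Real.rpow_le_one_of_one_le_of_nonpos h0 (by norm_num)
      have e2 : ‖z‖ ^ (-(1 / 2) - ε : ℝ) ≤ 1 :=
        Real.rpow_le_one_of_one_le_of_nonpos h0 (by linarith)
      calc _ ≤ 1 * Real.exp (-(Real.pi / 2 * |z.re|)) * 1 := by gcongr
        _ = _ := by ring
    have h2 : 0 ≤ C' * Real.exp (Real.pi / 2 * max R 1) * Real.exp (-(Real.pi / 2 * |z.re|)) := by
      positivity
    linarith

/-- Shifting the contour of $D(z+i)F(z)$, with $D$ = `sinDiff τ σ`, gives $\int_{\mathbb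
R}D(s)F(s-i)\,ds=\int_{\mathbb R}D(s+i)F(s)\,ds$. Folding onto the half-line, with $D$ odd and $F$
even, makes both shifts appear on each side. -/
theorem integral_sinDiff_mul_diff {F : ℂ → ℂ} (hF : IsEvenWDecreasing F) {τ σ : ℝ} (hτ : 0 < τ)
    (hσ : 0 < σ) :
    ∫ s in Set.Ioi (0 : ℝ), sinDiff τ σ s * (F (s - Complex.I) - F (s + Complex.I))
      = ∫ s in Set.Ioi (0 : ℝ), 2 * Real.pi * Complex.I
        * ((Complex.cos (τ * s) - Complex.cos (σ * s)) * F s) := by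
  obtain ⟨C, hC0, hC⟩ := hF.exists_norm_le
  obtain ⟨⟨δ, hδ, hd, he⟩, -⟩ := hF
  -- The argument $z+i$ with $|\mathrm{Im}\,z|\le1$ stays within height 2.
  obtain ⟨D, hD0, hD⟩ := exists_norm_sinDiff_le τ σ 2
  have hc : 0 < Real.pi / 2 := by positivity
  have hGd : DifferentiableOn ℂ (fun z => sinDiff τ σ (z + Complex.I) * F z)
      {s | |s.im| < 1 + δ} :=
    (((differentiable_sinDiff τ σ).comp (by fun_prop :
      Differentiable ℂ fun z : ℂ => z + Complex.I)).differentiableOn).mul hd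
  have hGb : ∀ z : ℂ, |z.im| ≤ 1 → ‖sinDiff τ σ (z + Complex.I) * F z‖
      ≤ D * C * Real.exp (-(Real.pi / 2 * |z.re|)) := fun z hz => by
    rw [norm_mul, mul_assoc]
    refine mul_le_mul (hD _ ?_) (hC z hz) (norm_nonneg _) hD0
    rw [Complex.add_im, Complex.I_im]
    exact (abs_add_le _ _).trans (by rw [abs_one]; linarith)
  have h := integral_sub_I_eq hδ hGd hc hGb
  have i1 := integrable_of_strip hδ hGd hc hGb (y := -1) (by simp)
  have i2 := integrable_of_strip hδ hGd hc hGb (y := 0) (by simp)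
  simp only [Complex.ofReal_neg, Complex.ofReal_one, neg_mul, one_mul, ← sub_eq_add_neg,
    sub_add_cancel] at i1
  simp only [Complex.ofReal_zero, zero_mul, add_zero] at i2
  simp only [sub_add_cancel] at h
  rw [integral_eq_integral_Ioi_add_comp_neg i1, integral_eq_integral_Ioi_add_comp_neg i2] at h
  have e1 : ∀ s : ℝ, F (-s - Complex.I) = F (s + Complex.I) := fun s => by
    rw [← he (s + Complex.I) (by simp; linarith), neg_add, sub_eq_add_neg]
  have e2 : ∀ s : ℝ, F (-s) = F s := fun s => he s (by simp; linarith)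
  have e3 : ∀ s : ℝ, sinDiff τ σ (-s + Complex.I) = -sinDiff τ σ (s - Complex.I) := fun s => by
    rw [← sinDiff_neg, neg_sub, sub_eq_add_neg, add_comm]
  simp only [Complex.ofReal_neg, sinDiff_neg, e1, e2, e3] at h
  refine Eq.trans ?_ (h.trans ?_)
  · congr 1; ext s; ring
  · congr 1; ext s
    linear_combination (-F s) * sinDiff_sub_I_sub hτ hσ s

/-- The symmetry relation with one argument in the core and the other arbitrary in $\mathcal H[w]$.
The weight, a multiple of $s\sinh\pi s$, cancels the denominators on both sides and leaves
`integral_sinDiff_mul_diff`. -/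
theorem inner_apply_coreX_eq {U : L2X ≃ₗᵢ[ℂ] L2S} (hU : ∀ τ (hτ : 0 < τ),
    U ((memLp_expX (Real.cosh_pos τ)).toLp _) = (memLp_sinS hτ).toLp _) {τ : ℝ} (hτ : 0 < τ)
    {f ℓ : L2S} (h : (f, ℓ) ∈ diffGraph) :
    inner ℂ (U ((memLp_coreX (Real.cosh_pos τ)).toLp _)) ℓ
      = inner ℂ (U ((memLp_mulCoreX (Real.cosh_pos τ)).toLp _)) f := by
  obtain ⟨F, hF, h1, h2⟩ := h
  have hσ := arcosh_cosh_add_one_pos τ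
  set σ := Real.arcosh (Real.cosh τ + 1)
  have key := integral_sinDiff_mul_diff hF hτ hσ
  have l1 : inner ℂ (U ((memLp_coreX (Real.cosh_pos τ)).toLp _)) ℓ
      = 2 / Real.pi ^ 2 / Complex.I * ∫ s in Set.Ioi (0 : ℝ),
        sinDiff τ σ s * (F (s - Complex.I) - F (s + Complex.I)) := by
    rw [L2.inner_def, ← integral_const_mul]
    trans ∫ s : ℝ, ((sinS τ s - sinS σ s) * diffExpr F s) ∂measS
    · refine integral_congr_ae ?_
      filter_upwards [apply_coreX hU hτ, h2] with s e1 e2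
      rw [e1, e2, RCLike.inner_apply, map_sub]
      simp only [sinS, Complex.conj_ofReal]
      ring
    · rw [integral_measS]
      refine setIntegral_congr_fun measurableSet_Ioi fun s hs => ?_
      have hs' : 0 < s := hs
      have hsC : (s : ℂ) ≠ 0 := Complex.ofReal_ne_zero.mpr hs'.ne'
      have hshC : Complex.sinh (Real.pi * s) ≠ 0 := sinh_pi_mul_ne_zero (by simpa using hs'.ne')
      have hpi : (Real.pi : ℂ) ≠ 0 := Complex.ofReal_ne_zero.mpr Real.pi_ne_zero
      have hsτ : Complex.sinh τ ≠ 0 := by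
        rw [← Complex.ofReal_sinh]
        exact Complex.ofReal_ne_zero.mpr (Real.sinh_pos_iff.mpr hτ).ne'
      have hsσ : Complex.sinh σ ≠ 0 := by
        rw [← Complex.ofReal_sinh]
        exact Complex.ofReal_ne_zero.mpr (Real.sinh_pos_iff.mpr hσ).ne'
      have hI := Complex.I_ne_zero
      simp only [dens, sinS, diffExpr, sinDiff]
      push_cast
      field_simp
  have l2 : inner ℂ (U ((memLp_mulCoreX (Real.cosh_pos τ)).toLp _)) f
      = 2 / Real.pi ^ 2 / Complex.I * ∫ s in Set.Ioi (0 : ℝ), 2 * Real.pi * Complex.I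
        * ((Complex.cos (τ * s) - Complex.cos (σ * s)) * F s) := by
    rw [L2.inner_def, ← integral_const_mul, apply_mulCoreX hU]
    trans ∫ s : ℝ, cosS τ σ s * F s ∂measS
    · refine integral_congr_ae ?_
      filter_upwards [(memLp_cosS τ σ).coeFn_toLp, h1] with s e1 e2
      rw [e1, e2, RCLike.inner_apply, cosS, Complex.conj_ofReal, mul_comm]
    · rw [integral_measS]
      refine setIntegral_congr_fun measurableSet_Ioi fun s hs => ?_
      have hs' : 0 < s := hs
      have hsC : (s : ℂ) ≠ 0 := Complex.ofReal_ne_zero.mpr hs'.ne'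
      have hshC : Complex.sinh (Real.pi * s) ≠ 0 := sinh_pi_mul_ne_zero (by simpa using hs'.ne')
      have hpi : (Real.pi : ℂ) ≠ 0 := Complex.ofReal_ne_zero.mpr Real.pi_ne_zero
      have hI := Complex.I_ne_zero
      simp only [dens, cosS]
      push_cast
      field_simp
  rw [l1, l2, key]

/-! ### Graphs, closure and self-adjointness. -/

theorem mem_mulGraph {a b : L2X} :
    (a, b) ∈ mulGraph ↔ b =ᵐ[measX] fun x : ℝ => ((2 / x : ℝ) : ℂ) * a x := Iff.rfl

theorem core_mem_mulGraph {p : ℝ} (hp : 0 < p) :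
    ((memLp_coreX hp).toLp _, (memLp_mulCoreX hp).toLp _) ∈ mulGraph := by
  rw [mem_mulGraph]
  filter_upwards [(memLp_coreX hp).coeFn_toLp, (memLp_mulCoreX hp).coeFn_toLp, ae_measX_pos]
    with x h1 h2 h3
  rw [h1, h2, mulCoreX_eq h3]

theorem inner_snd_fst_eq_of_mem_mulGraph {a b c d : L2X} (h : (a, b) ∈ mulGraph)
    (h' : (c, d) ∈ mulGraph) : inner ℂ b c = inner ℂ a d := by
  rw [mem_mulGraph] at h h'
  rw [L2.inner_def, L2.inner_def]
  refine integral_congr_ae ?_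
  filter_upwards [h, h'] with x h1 h2
  rw [h1, h2, RCLike.inner_apply, RCLike.inner_apply, map_mul, Complex.conj_ofReal]
  ring

theorem snd_eq_zero_of_mem_mulGraph {b : L2X} (h : (0, b) ∈ mulGraph) : b = 0 := by
  rw [← mulOp_graph] at h
  exact mulOp.graph_fst_eq_zero_snd h rfl

/-- The graph of `mulOp` is the orthogonal of the graph of its restriction to the core. -/
theorem mem_mulGraph_iff_inner {a b : L2X} : (a, b) ∈ mulGraph ↔ ∀ τ : ℝ, 0 < τ →
    inner ℂ ((memLp_mulCoreX (Real.cosh_pos τ)).toLp _) a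
      = inner ℂ ((memLp_coreX (Real.cosh_pos τ)).toLp _) b := by
  refine ⟨fun h τ _ => inner_snd_fst_eq_of_mem_mulGraph (core_mem_mulGraph (Real.cosh_pos τ)) h,
    fun h => ?_⟩
  -- The defect of the relation at $p$ is the Laplace transform of this function. The factor
  -- $1-e^{-x}$ comes from the difference of exponentials in the core and has no zero on $x>0$.
  let φ : ℝ → ℂ := fun x => ((1 - Real.exp (-x) : ℝ) : ℂ) * (b x - ((2 / x : ℝ) : ℂ) * a x)
  have hφ : ∀ p : ℝ, ∀ x ∈ Set.Ioi (0 : ℝ),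
      ((1 / x : ℝ) : ℂ) * ((starRingEnd ℂ) (coreX p x) * b x)
        - ((1 / x : ℝ) : ℂ) * ((starRingEnd ℂ) (mulCoreX p x) * a x)
      = φ x * Real.exp (-(p * x)) := by
    intro p x hx
    have hx' : (x : ℂ) ≠ 0 := Complex.ofReal_ne_zero.mpr (ne_of_gt hx)
    have e : Real.exp (-((p + 1) * x)) = Real.exp (-(p * x)) * Real.exp (-x) := by
      rw [← Real.exp_add]; congr 1; ring
    simp only [φ, coreX, expX, mulCoreX, map_sub, Complex.conj_ofReal, e]
    push_cast
    field_simp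
  have hint : ∀ (p : ℝ) (hp : 0 < p),
      IntegrableOn (fun x => φ x * Real.exp (-(p * x))) (Set.Ioi 0) ∧
      ∫ x in Set.Ioi 0, φ x * Real.exp (-(p * x))
        = inner ℂ ((memLp_coreX hp).toLp _) b
          - inner ℂ ((memLp_mulCoreX hp).toLp _) a := by
    intro p hp
    have i1 := integrable_measX_iff.mp (integrable_conj_mul (memLp_coreX hp) b)
    have i2 := integrable_measX_iff.mp (integrable_conj_mul (memLp_mulCoreX hp) a)
    refine ⟨(i1.sub i2).congr_fun (hφ p) measurableSet_Ioi, ?_⟩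
    rw [inner_toLp_left, inner_toLp_left, integral_measX, integral_measX, ← integral_sub i1 i2]
    exact (setIntegral_congr_fun measurableSet_Ioi (hφ p)).symm
  have h0 : φ =ᵐ[volume.restrict (Set.Ioi 0)] 0 := by
    refine ae_eq_zero_of_laplace (fun p hp => (hint p (by linarith)).1) fun p hp => ?_
    have h1 := h (Real.arcosh p) (Real.arcosh_pos hp)
    simp only [Real.cosh_arcosh hp.le] at h1
    rw [(hint p (by linarith)).2, h1, sub_self]
  rw [mem_mulGraph, EventuallyEq, ae_measX_iff]
  filter_upwards [h0, ae_restrict_mem measurableSet_Ioi] with x h1 hx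
  have hx' : (0 : ℝ) < x := hx
  have h2 : ((1 - Real.exp (-x) : ℝ) : ℂ) ≠ 0 := Complex.ofReal_ne_zero.mpr
    (sub_pos.mpr (Real.exp_lt_one_iff.mpr (by linarith))).ne'
  exact sub_eq_zero.mp ((mul_eq_zero.mp h1).resolve_left h2)

/-- Positivity of $2/x$ gives $|a+Pa|=(1+2/x)|a|$ pointwise. So approximating $a+Pa$ approximates
$a$ and $Pa$ separately. -/
theorem norm_le_of_mem_mulGraph {a b : L2X} (h : (a, b) ∈ mulGraph) :
    ‖a‖ ≤ ‖a + b‖ ∧ ‖b‖ ≤ ‖a + b‖ := by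
  rw [mem_mulGraph] at h
  have key : ∀ᵐ x ∂measX, 0 < x ∧ b x = ((2 / x : ℝ) : ℂ) * a x
      ∧ ‖(a + b) x‖ = (1 + 2 / x) * ‖a x‖ := by
    filter_upwards [h, ae_measX_pos, Lp.coeFn_add a b] with x h1 h2 h3
    refine ⟨h2, h1, ?_⟩
    rw [h3, Pi.add_apply, h1, show a x + ((2 / x : ℝ) : ℂ) * a x = ((1 + 2 / x : ℝ) : ℂ) * a x by
      push_cast; ring, norm_mul, Complex.norm_real, Real.norm_of_nonneg (by positivity)]
  constructor
  · refine Lp.norm_le_norm_of_ae_le ?_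
    filter_upwards [key] with x ⟨h1, _, h3⟩
    rw [h3]
    exact le_mul_of_one_le_left (norm_nonneg _) (by linarith [show 0 < 2 / x by positivity])
  · refine Lp.norm_le_norm_of_ae_le ?_
    filter_upwards [key] with x ⟨h1, h2, h3⟩
    rw [h3, h2, norm_mul, Complex.norm_real, Real.norm_of_nonneg (by positivity)]
    gcongr
    linarith

/-- The elements of `M` which the isometry `U × U` maps into `N`. -/
def commonGraph {E F : Type*} [NormedAddCommGroup E] [InnerProductSpace ℂ E]
    [NormedAddCommGroup F] [InnerProductSpace ℂ F] (U : E ≃ₗᵢ[ℂ] F) (M : Submodule ℂ (E × E))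
    (N : Submodule ℂ (F × F)) : Submodule ℂ (E × E) :=
  M ⊓ N.comap (U.toLinearEquiv.toLinearMap.prodMap U.toLinearEquiv.toLinearMap)

theorem mem_commonGraph {E F : Type*} [NormedAddCommGroup E] [InnerProductSpace ℂ E]
    [NormedAddCommGroup F] [InnerProductSpace ℂ F] {U : E ≃ₗᵢ[ℂ] F} {M : Submodule ℂ (E × E)}
    {N : Submodule ℂ (F × F)} {a b : E} :
    (a, b) ∈ commonGraph U M N ↔ (a, b) ∈ M ∧ (U a, U b) ∈ N := Iff.rfl

section

variable {U : L2X ≃ₗᵢ[ℂ] L2S}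

theorem inner_apply_left (a : L2X) (f : L2S) : inner ℂ (U a) f = inner ℂ a (U.symm f) := by
  rw [← U.inner_map_map, U.apply_symm_apply]

/-- A vector $f$ orthogonal to all $c+Pc$ satisfies the relations defining $Pf=-f$, and positivity
forces $f=0$. -/
theorem dense_range_add_commonGraph (hU : ∀ τ (hτ : 0 < τ),
    U ((memLp_expX (Real.cosh_pos τ)).toLp _) = (memLp_sinS hτ).toLp _) :
    ((commonGraph U mulGraph diffGraph).map (LinearMap.fst ℂ L2X L2X
      + LinearMap.snd ℂ L2X L2X)).topologicalClosure = ⊤ := by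
  rw [Submodule.topologicalClosure_eq_top_iff, Submodule.eq_bot_iff]
  intro f hf
  have h : (f, -f) ∈ mulGraph := by
    refine mem_mulGraph_iff_inner.mpr fun τ hτ => ?_
    have h1 := (Submodule.mem_orthogonal _ _).mp hf _ (Submodule.mem_map_of_mem
      (mem_commonGraph.mpr ⟨core_mem_mulGraph (Real.cosh_pos τ), mem_diffGraph_of_apply hU hτ⟩))
    rw [LinearMap.add_apply, LinearMap.fst_apply, LinearMap.snd_apply, inner_add_left] at h1
    rw [inner_neg_right]
    linear_combination h1
  have h2 := (norm_le_of_mem_mulGraph h).1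
  rw [add_neg_cancel, norm_zero] at h2
  exact norm_le_zero_iff.mp h2

/-- One inclusion: the symmetry relations against the core are closed conditions, and they
characterise the multiplication graph. The other: `dense_range_add_commonGraph` with
`norm_le_of_mem_mulGraph` approximates a point of that graph by points whose images lie in
`diffGraph`. -/
theorem mem_closure_diffGraph_iff (hU : ∀ τ (hτ : 0 < τ),
    U ((memLp_expX (Real.cosh_pos τ)).toLp _) = (memLp_sinS hτ).toLp _) {f ℓ : L2S} :
    (f, ℓ) ∈ diffGraph.topologicalClosure ↔ (U.symm f, U.symm ℓ) ∈ mulGraph := by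
  constructor
  · intro h
    refine mem_mulGraph_iff_inner.mpr fun τ hτ => ?_
    rw [← inner_apply_left, ← inner_apply_left]
    have hc : IsClosed {q : L2S × L2S |
        inner ℂ (U ((memLp_mulCoreX (Real.cosh_pos τ)).toLp _)) q.1
          = inner ℂ (U ((memLp_coreX (Real.cosh_pos τ)).toLp _)) q.2} :=
      isClosed_eq (by fun_prop) (by fun_prop)
    exact closure_minimal (fun q hq => (inner_apply_coreX_eq hU hτ hq).symm) hc h
  · intro h
    change (f, ℓ) ∈ closure (diffGraph : Set (L2S × L2S))
    rw [Metric.mem_closure_iff]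
    intro ε hε
    have hd : U.symm f + U.symm ℓ ∈ ((commonGraph U mulGraph diffGraph).map
        (LinearMap.fst ℂ L2X L2X + LinearMap.snd ℂ L2X L2X)).topologicalClosure := by
      rw [dense_range_add_commonGraph hU]; trivial
    obtain ⟨_, ⟨⟨a, b⟩, hab, rfl⟩, hε'⟩ := Metric.mem_closure_iff.mp hd ε hε
    obtain ⟨h1, h2⟩ := mem_commonGraph.mp hab
    refine ⟨(U a, U b), h2, ?_⟩
    have h3 := norm_le_of_mem_mulGraph (mulGraph.sub_mem h h1)
    rw [LinearMap.add_apply, LinearMap.fst_apply, LinearMap.snd_apply, dist_eq_norm,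
      add_sub_add_comm] at hε'
    have e1 : ∀ (g : L2S) (c : L2X), dist g (U c) = ‖U.symm g - c‖ := fun g c => by
      rw [← U.symm.dist_map, U.symm_apply_apply, dist_eq_norm]
    rw [Prod.dist_eq, e1, e1]
    exact max_lt (h3.1.trans_lt hε') (h3.2.trans_lt hε')

theorem isClosable_diffOp (hU : ∀ τ (hτ : 0 < τ),
    U ((memLp_expX (Real.cosh_pos τ)).toLp _) = (memLp_sinS hτ).toLp _) : diffOp.IsClosable := by
  refine ⟨diffGraph.topologicalClosure.toLinearPMap, ?_⟩
  rw [diffOp_graph, Submodule.toLinearPMap_graph_eq]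
  rintro ⟨f, ℓ⟩ h (rfl : f = 0)
  rw [mem_closure_diffGraph_iff hU, map_zero] at h
  exact U.symm.map_eq_zero_iff.mp (snd_eq_zero_of_mem_mulGraph h)

theorem mem_graph_closure_diffOp_iff (hU : ∀ τ (hτ : 0 < τ),
    U ((memLp_expX (Real.cosh_pos τ)).toLp _) = (memLp_sinS hτ).toLp _) {f ℓ : L2S} :
    (f, ℓ) ∈ diffOp.closure.graph ↔ (U.symm f, U.symm ℓ) ∈ mulGraph := by
  rw [← (isClosable_diffOp hU).graph_closure_eq_closure_graph, diffOp_graph,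
    mem_closure_diffGraph_iff hU]

theorem apply_core_mem_graph_closure_diffOp (hU : ∀ τ (hτ : 0 < τ),
    U ((memLp_expX (Real.cosh_pos τ)).toLp _) = (memLp_sinS hτ).toLp _) (τ : ℝ) :
    (U ((memLp_coreX (Real.cosh_pos τ)).toLp _), U ((memLp_mulCoreX (Real.cosh_pos τ)).toLp _))
      ∈ diffOp.closure.graph := by
  rw [mem_graph_closure_diffOp_iff hU, U.symm_apply_apply, U.symm_apply_apply]
  exact core_mem_mulGraph (Real.cosh_pos τ)

/-- If $f$ is orthogonal to the images of the core, then the pair $(0,U^{-1}f)$ satisfies the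
relations characterising the multiplication graph, hence $U^{-1}f=P0=0$. -/
theorem dense_domain_closure_diffOp (hU : ∀ τ (hτ : 0 < τ),
    U ((memLp_expX (Real.cosh_pos τ)).toLp _) = (memLp_sinS hτ).toLp _) :
    Dense (diffOp.closure.domain : Set L2S) := by
  rw [Submodule.dense_iff_topologicalClosure_eq_top, Submodule.topologicalClosure_eq_top_iff,
    Submodule.eq_bot_iff]
  intro f hf
  refine U.symm.map_eq_zero_iff.mp (snd_eq_zero_of_mem_mulGraph
    (mem_mulGraph_iff_inner.mpr fun τ hτ => ?_))
  rw [← inner_apply_left, inner_zero_right]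
  exact ((Submodule.mem_orthogonal _ _).mp hf _
    (LinearPMap.mem_domain_of_mem_graph (apply_core_mem_graph_closure_diffOp hU τ))).symm

/-- Testing an element of the adjoint graph on the core alone already places it in the
multiplication graph; the converse is the symmetry of multiplication by the real function $2/x$. -/
theorem isSelfAdjoint_closure_diffOp (hU : ∀ τ (hτ : 0 < τ),
    U ((memLp_expX (Real.cosh_pos τ)).toLp _) = (memLp_sinS hτ).toLp _) :
    IsSelfAdjoint diffOp.closure := by
  rw [LinearPMap.isSelfAdjoint_def]
  refine LinearPMap.eq_of_eq_graph ?_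
  rw [LinearPMap.adjoint_graph_eq_graph_adjoint (dense_domain_closure_diffOp hU)]
  ext ⟨f, ℓ⟩
  rw [Submodule.mem_adjoint_iff, mem_graph_closure_diffOp_iff hU]
  constructor
  · intro h
    refine mem_mulGraph_iff_inner.mpr fun τ _ => ?_
    rw [← inner_apply_left, ← inner_apply_left]
    exact sub_eq_zero.mp (h _ _ (apply_core_mem_graph_closure_diffOp hU τ))
  · intro h a b hab
    rw [mem_graph_closure_diffOp_iff hU] at hab
    rw [sub_eq_zero, ← U.symm.inner_map_map, ← U.symm.inner_map_map a]
    exact inner_snd_fst_eq_of_mem_mulGraph hab h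

end

end KontorovichLebedev

theorem mainTheorem6 :
    (∀ ν z : ℂ, z ≠ 0 →
      KontorovichLebedev.macdonaldK (ν - 1) z - KontorovichLebedev.macdonaldK (ν + 1) z
        = -(2 * ν / z) * KontorovichLebedev.macdonaldK ν z) ∧
    ∃ U : KontorovichLebedev.L2X ≃ₗᵢ[ℂ] KontorovichLebedev.L2S,
      (∀ g : KontorovichLebedev.L2X,
        (∀ᵐ s : ℝ ∂KontorovichLebedev.measS, Integrable
          (fun x : ℝ => KontorovichLebedev.macdonaldK (Complex.I * s) x * g x)
          KontorovichLebedev.measX) →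
        U g =ᵐ[KontorovichLebedev.measS] fun s : ℝ =>
          ∫ x : ℝ, KontorovichLebedev.macdonaldK (Complex.I * s) x * g x
            ∂KontorovichLebedev.measX) ∧
      (∀ f : KontorovichLebedev.L2S,
        (∀ᵐ x : ℝ ∂KontorovichLebedev.measX, Integrable
          (fun s : ℝ => f s * KontorovichLebedev.macdonaldK (Complex.I * s) x)
          KontorovichLebedev.measS) →
        U.symm f =ᵐ[KontorovichLebedev.measX] fun x : ℝ =>
          ∫ s : ℝ, f s * KontorovichLebedev.macdonaldK (Complex.I * s) x
            ∂KontorovichLebedev.measS) ∧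
      KontorovichLebedev.diffOp.IsClosable ∧
      IsSelfAdjoint KontorovichLebedev.diffOp.closure ∧
      ∀ g h : KontorovichLebedev.L2X,
        (g, h) ∈ KontorovichLebedev.mulOp.graph ↔
          (U g, U h) ∈ KontorovichLebedev.diffOp.closure.graph := by
  refine ⟨fun ν z hz => KontorovichLebedev.macdonaldK_sub hz ν, ?_⟩
  obtain ⟨U, hU⟩ := KontorovichLebedev.exists_unitary
  refine ⟨U, KontorovichLebedev.apply_ae_eq_macdonaldK hU,
    KontorovichLebedev.symm_apply_ae_eq_macdonaldK hU, KontorovichLebedev.isClosable_diffOp hU,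
    KontorovichLebedev.isSelfAdjoint_closure_diffOp hU, fun g h => ?_⟩
  rw [KontorovichLebedev.mem_graph_closure_diffOp_iff hU, U.symm_apply_apply, U.symm_apply_apply,
    KontorovichLebedev.mulOp_graph]
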